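/- Let $(M,g)$ be a smooth 4-dimensional Lorentzian manifold of signature $(-,+,+,+)$ with Levi-Civita connection $\nabla$. Let $l$ be a smooth null geodesic vector field ($l\neq 0$, $g(l,l)=0$, and $\nabla_l l$ is pointwise proportional to $l$), and let $(s,l,\alpha,n)$ be a smooth tetrad with $g(s,s)=g(\alpha,\alpha)=-g(n,l)=1$ and $g(l,l)=g(n,n)=g(n,s)=g(n,\alpha)=g(\alpha,s)=g(\alpha,l)=g(s,l)=0$. Suppose that $$g(\nabla_s l,s)=g(\nabla_\alpha l,\alpha)\qquad\text{and}\qquad g(\nabla_s l,\alpha)+g(\nabla_\alpha l,s)=0 .$$ For a function $\Theta$ put $\hat s=\cos\Theta\, s+\sin\Theta\,\alpha$ and $\hat\alpha=-\sin\Theta\, s+\cos\Theta\,\alpha$. Then: 1. For every open $\Omega\subseteq M$ and every smooth $\Theta$ on $\Omega$, the pair $(l,\hat s)$ is involutive on $\Omega$ (that is, $[l,\hat s]\in\operatorname{span}(l,\hat s)$) if and only if $\Theta$ solves the transport equation $l(\Theta)=-g([l,s],\alpha)$ on $\Omega$. 2. Every point of $M$ lies in the domain $U$ of a chart $(x^1,x^2,x^3,x^4)$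 whose image is an open box, with $l=\partial/\partial x^1$, such that for some function $\Theta_0$ on $U$ the smooth solutions of the transport equation on $U$ are exactly the functions $\Theta=\Theta_0+\tilde\Theta(x^2,x^3,x^4)$, where $\tilde\Theta$ is an arbitrary smooth function of three variables. 3. Let $\Theta$ be any smooth solution of the transport equation on an open set $\Omega\subseteq M$. Then $\Omega$ is foliated by connected 2-dimensional submanifolds (leaves) with tangent spaces $\operatorname{span}(l,\hat s)$, and this is a null field sheet foliation with adapted frame $(\hat s,l,\hat\alpha,n)$: this frame satisfies the same inner product relations, and $g(\nabla_{\hat s}l,\hat s)=g(\nabla_{\hat\alpha}l,\hat\alpha)$. 4. Let $\Theta$ and $\Omega$ be as in 3, and let $(x^1,\dots,x^4)$ be any chart with domain $V\subseteq\Omega$ whose image is an open box and in which $\operatorname{span}(l,\hat s)$ is tangent to the slices $x^3,x^4=\mathrm{const}$ (such charts exist around each point of $\Omega$). Write $\hat\alpha^\flat=\alpha_3dx^3+\alpha_4dx^4$, $l^\flat=l_3dx^3+l_4dx^4$ and $\kappa=(\alpha_3l_4-\alpha_4l_3)^{-1}$. Then for every smooth function $u$ of two variables $$F=u(x^3,x^4)\,\kappa\,\hat\alpha^\flat\wedge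 l^\flat$$ is a smooth null force-free electromagnetic field on $V$, that is, $dF=0$, $F(j^\sharp,\cdot)=0$ for $j=*\,d*F$, and $F_{\mu\nu}F^{\mu\nu}=0$; at each point where $u\neq0$ the kernel of $F$ is $\operatorname{span}(l,\hat s)$. Conversely, every smooth null force-free field on $V$ whose kernel contains $\operatorname{span}(l,\hat s)$ is of this form. -/

import Mathlib

open Set Filter Topology
open scoped Manifold ContDiff

noncomputable section

namespace NullFFE

/-! ### Linear algebra and calculus on the coordinate space -/

/-- The coordinate space `ℝ⁴`. -/
abbrev E4 : Type := EuclideanSpace ℝ (Fin 4)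

/-- The standard basis vectors `e_a` of `ℝ⁴`. -/
def stdVec (a : Fin 4) : E4 := EuclideanSpace.single a (1 : ℝ)

/-- The standard dual basis `e^a` of `ℝ⁴`. -/
def stdCovec (a : Fin 4) : E4 →L[ℝ] ℝ := EuclideanSpace.proj a

/-- The standard determinant form `dx⁰ ∧ dx¹ ∧ dx² ∧ dx³` on `ℝ⁴`. -/
def detForm : E4 [⋀^Fin 4]→L[ℝ] ℝ where
  toAlternatingMap := (EuclideanSpace.basisFun (Fin 4) ℝ).toBasis.det
  cont := by
    change Continuous fun v : Fin 4 → E4 => (EuclideanSpace.basisFun (Fin 4) ℝ).toBasis.det v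
    simp only [Module.Basis.det_apply]
    refine Continuous.matrix_det (continuous_matrix fun i j => ?_)
    simp only [Module.Basis.toMatrix_apply, OrthonormalBasis.coe_toBasis_repr_apply,
      EuclideanSpace.basisFun_repr]
    fun_prop

/-- The volume form `√|det G| dx⁰ ∧ dx¹ ∧ dx² ∧ dx³` of a scalar product `G` on `ℝ⁴`. -/
def volForm (G : E4 →L[ℝ] E4 →L[ℝ] ℝ) : E4 [⋀^Fin 4]→L[ℝ] ℝ :=
  Real.sqrt |Matrix.det (Matrix.of fun a b => G (stdVec a) (stdVec b))| • detForm

/-- Hodge star of a 2-form: `(*η)_{cd} = (1/2!) η^{ab} ε_{abcd}`, where `η^{ab} = η(♯e^a, ♯e^b)`. -/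
def star2 (G : E4 →L[ℝ] E4 →L[ℝ] ℝ) (η : E4 [⋀^Fin 2]→L[ℝ] ℝ) : E4 [⋀^Fin 2]→L[ℝ] ℝ :=
  (1 / 2 : ℝ) • ∑ a, ∑ b, η ![G.inverse (stdCovec a), G.inverse (stdCovec b)] •
    ((volForm G).curryLeft (stdVec a)).curryLeft (stdVec b)

/-- Hodge star of a 3-form, as a 1-form: `(*H)_d = (1/3!) H^{abc} ε_{abcd}`. -/
def star3 (G : E4 →L[ℝ] E4 →L[ℝ] ℝ) (H : E4 [⋀^Fin 3]→L[ℝ] ℝ) : E4 →L[ℝ] ℝ :=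
  (1 / 6 : ℝ) • ∑ a, ∑ b, ∑ c,
    H ![G.inverse (stdCovec a), G.inverse (stdCovec b), G.inverse (stdCovec c)] •
      (ContinuousAlternatingMap.ofSubsingleton ℝ E4 ℝ (0 : Fin 1)).symm
        ((((volForm G).curryLeft (stdVec a)).curryLeft (stdVec b)).curryLeft (stdVec c))

/-- `η_{ab} η^{ab}`. -/
def normSq2 (G : E4 →L[ℝ] E4 →L[ℝ] ℝ) (η : E4 [⋀^Fin 2]→L[ℝ] ℝ) : ℝ :=
  ∑ a, ∑ b, η ![stdVec a, stdVec b] * η ![G.inverse (stdCovec a), G.inverse (stdCovec b)]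

/-- `* d * F` in coordinates, for a field of scalar products `G`. -/
def coordCurrent (G : E4 → E4 →L[ℝ] E4 →L[ℝ] ℝ) (F : E4 → E4 [⋀^Fin 2]→L[ℝ] ℝ) (y : E4) :
    E4 →L[ℝ] ℝ :=
  star3 (G y) (extDeriv (fun z => star2 (G z) (F z)) y)

/-- The exterior product `β ∧ γ` of two covectors. -/
def wedge {V : Type*} [AddCommGroup V] [Module ℝ V] [TopologicalSpace V]
    (β γ : V →L[ℝ] ℝ) : V [⋀^Fin 2]→L[ℝ] ℝ where
  toFun v := β (v 0) * γ (v 1) - β (v 1) * γ (v 0)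
  map_update_add' := by
    intro _ v i x y
    fin_cases i <;> simp [Function.update] <;> ring
  map_update_smul' := by
    intro _ v i c x
    fin_cases i <;> simp [Function.update] <;> ring
  map_eq_zero_of_eq' := by
    intro v i j hij hne
    fin_cases i <;> fin_cases j <;> simp_all
  cont := by fun_prop

/-! ### Spacetimes -/

section Spacetime

variable (M : Type*) [TopologicalSpace M] [ChartedSpace E4 M]

/-- (Not necessarily smooth) vector fields on `M`. -/
abbrev VField : Type _ := (x : M) → TangentSpace (𝓡 4) x

/-- (Not necessarily smooth) differential `k`-forms on `M`. -/
abbrev DForm (k : ℕ) : Type _ := (x : M) → TangentSpace (𝓡 4) x [⋀^Fin k]→L[ℝ] ℝ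

/-- A smooth Lorentzian metric of signature `(-,+,+,+)` on the 4-dimensional manifold `M`. -/
structure LorentzMetric [IsManifold (𝓡 4) ∞ M] where
  /-- the scalar product `g_x` on the tangent space at `x` -/
  val (x : M) : TangentSpace (𝓡 4) x →L[ℝ] TangentSpace (𝓡 4) x →L[ℝ] ℝ
  symm (x : M) (v w : TangentSpace (𝓡 4) x) : val x v w = val x w v
  lorentzian (x : M) : ∃ b : Module.Basis (Fin 4) ℝ (TangentSpace (𝓡 4) x), ∀ i j,
    val x (b i) (b j) = if i = j then (if i = 0 then -1 else 1) else 0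
  contMDiff : ContMDiff (𝓡 4) ((𝓡 4).prod 𝓘(ℝ, E4 →L[ℝ] E4 →L[ℝ] ℝ)) ∞
    (fun x => Bundle.TotalSpace.mk' (E4 →L[ℝ] E4 →L[ℝ] ℝ)
      (E := fun x : M => TangentSpace (𝓡 4) x →L[ℝ] TangentSpace (𝓡 4) x →L[ℝ] ℝ) x (val x))

variable {M} [IsManifold (𝓡 4) ∞ M]

/-- The vector field `X` is smooth on `Ω`. -/
def SmoothOn (X : VField M) (Ω : Set M) : Prop :=
  ContMDiffOn (𝓡 4) (𝓡 4).tangent ∞ (fun x => (⟨x, X x⟩ : TangentBundle (𝓡 4) M)) Ω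

/-- The vector field `X` is smooth at `x`. -/
def SmoothAt (X : VField M) (x : M) : Prop :=
  ContMDiffAt (𝓡 4) (𝓡 4).tangent ∞ (fun x => (⟨x, X x⟩ : TangentBundle (𝓡 4) M)) x

/-- The derivative `X(f)` of a function `f` along a vector field `X`. -/
def dirDeriv (X : VField M) (f : M → ℝ) (x : M) : ℝ := mfderiv (𝓡 4) 𝓘(ℝ, ℝ) f x (X x)

/-- The Lie bracket `[X, Y]`. -/
def bracket (X Y : VField M) : VField M := VectorField.mlieBracket (𝓡 4) X Y

/-- The representative of a `k`-form in the chart around `p`. -/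
def formInChart {k : ℕ} (p : M) (η : DForm M k) (y : E4) : E4 [⋀^Fin k]→L[ℝ] ℝ :=
  (η ((extChartAt (𝓡 4) p).symm y)).compContinuousLinearMap
    (mfderiv 𝓘(ℝ, E4) (𝓡 4) (extChartAt (𝓡 4) p).symm y)

/-- The differential form `η` is smooth on the open set `Ω`. -/
def SmoothFormOn {k : ℕ} (η : DForm M k) (Ω : Set M) : Prop :=
  ∀ x ∈ Ω, ContDiffAt ℝ ∞ (formInChart x η) (extChartAt (𝓡 4) x x)

/-- The exterior derivative of a differential form on `M`, computed at `x` in the chart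
around `x`. -/
def extD {k : ℕ} (η : DForm M k) : DForm M (k + 1) := fun x =>
  (extDeriv (formInChart x η) (extChartAt (𝓡 4) x x)).compContinuousLinearMap
    (mfderiv (𝓡 4) 𝓘(ℝ, E4) (extChartAt (𝓡 4) x) x)

variable (g : LorentzMetric M)

/-- The function `g(X, Y)`. -/
def LorentzMetric.ip (X Y : VField M) (x : M) : ℝ := g.val x (X x) (Y x)

/-- Right-hand side of the Koszul formula for `g(∇_X Y, Z)`. -/
def koszul (X Y Z : VField M) (x : M) : ℝ :=
  (1 / 2 : ℝ) * (dirDeriv X (g.ip Y Z) x + dirDeriv Y (g.ip X Z) x - dirDeriv Z (g.ip X Y) x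
    + g.ip (bracket X Y) Z x - g.ip (bracket X Z) Y x - g.ip (bracket Y Z) X x)

/-- The Levi-Civita covariant derivative `∇_X Y`: at each point it is the tangent vector
determined by the Koszul formula, tested against all vector fields `Z` smooth near the point. -/
def nabla (X Y : VField M) : VField M := fun x =>
  Classical.epsilon fun v : TangentSpace (𝓡 4) x =>
    ∀ Z : VField M, SmoothAt Z x → g.val x v (Z x) = koszul g X Y Z x

/-- The metric in the chart around `p`. -/
def metricInChart (p : M) (y : E4) : E4 →L[ℝ] E4 →L[ℝ] ℝ :=
  let A : E4 →L[ℝ] TangentSpace (𝓡 4) ((extChartAt (𝓡 4) p).symm y) :=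
    mfderiv 𝓘(ℝ, E4) (𝓡 4) (extChartAt (𝓡 4) p).symm y
  (ContinuousLinearMap.precomp ℝ A).comp ((g.val ((extChartAt (𝓡 4) p).symm y)).comp A)

/-- The current density 1-form `j = * d * F`, computed at `x` in the chart around `x`. (The choice
of an orientation near `x` does not matter, since the Hodge star is applied twice.) -/
def current (F : DForm M 2) (x : M) : TangentSpace (𝓡 4) x →L[ℝ] ℝ :=
  (coordCurrent (metricInChart g x) (formInChart x F) (extChartAt (𝓡 4) x x)).comp
    (mfderiv (𝓡 4) 𝓘(ℝ, E4) (extChartAt (𝓡 4) x) x)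

/-- The scalar `F_{μν} F^{μν}`. -/
def fieldSq (F : DForm M 2) (x : M) : ℝ :=
  normSq2 (metricInChart g x (extChartAt (𝓡 4) x x)) (formInChart x F (extChartAt (𝓡 4) x x))

/-- The metric dual `β^♯` of a covector. -/
def sharp (x : M) (β : TangentSpace (𝓡 4) x →L[ℝ] ℝ) : TangentSpace (𝓡 4) x :=
  (g.val x).inverse β

/-- `F` is a smooth null force-free electromagnetic field on the open set `Ω`:
`dF = 0`, `F(j^♯, ·) = 0` with `j = * d * F`, and `F_{μν} F^{μν} = 0`. -/
structure IsNullForceFree (F : DForm M 2) (Ω : Set M) : Prop where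
  smooth : SmoothFormOn F Ω
  closed : ∀ x ∈ Ω, extD F x = 0
  forceFree : ∀ x ∈ Ω, ∀ v : TangentSpace (𝓡 4) x, F x ![sharp g x (current g F x), v] = 0
  null : ∀ x ∈ Ω, fieldSq g F x = 0

/-! ### Null congruences and frames -/

/-- `l` is a null geodesic congruence on `Ω`; its integral curves need not be affinely
parametrized. -/
structure IsNullGeodesic (l : VField M) (Ω : Set M) : Prop where
  smooth : SmoothOn l Ω
  ne_zero : ∀ x ∈ Ω, l x ≠ 0
  null : ∀ x ∈ Ω, g.ip l l x = 0
  geodesic : ∀ x ∈ Ω, ∃ c : ℝ, nabla g l l x = c • l x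

/-- `(s, l, α, n)` is a smooth null tetrad on `Ω`. -/
structure IsNullTetrad (s l α n : VField M) (Ω : Set M) : Prop where
  smooth_s : SmoothOn s Ω
  smooth_l : SmoothOn l Ω
  smooth_α : SmoothOn α Ω
  smooth_n : SmoothOn n Ω
  ss : ∀ x ∈ Ω, g.ip s s x = 1
  αα : ∀ x ∈ Ω, g.ip α α x = 1
  nl : ∀ x ∈ Ω, g.ip n l x = -1
  ll : ∀ x ∈ Ω, g.ip l l x = 0
  nn : ∀ x ∈ Ω, g.ip n n x = 0
  ns : ∀ x ∈ Ω, g.ip n s x = 0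
  nα : ∀ x ∈ Ω, g.ip n α x = 0
  αs : ∀ x ∈ Ω, g.ip α s x = 0
  αl : ∀ x ∈ Ω, g.ip α l x = 0
  sl : ∀ x ∈ Ω, g.ip s l x = 0

/-- Equipartition of null mean curvature: `g(∇_s l, s) = g(∇_α l, α)`. -/
def Equipartition (s l α : VField M) (Ω : Set M) : Prop :=
  ∀ x ∈ Ω, g.ip (nabla g s l) s x = g.ip (nabla g α l) α x

/-- The additional condition of uniform equipartition: `g(∇_s l, α) + g(∇_α l, s) = 0`. -/
def UniformEquipartition (s l α : VField M) (Ω : Set M) : Prop :=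
  ∀ x ∈ Ω, g.ip (nabla g s l) α x + g.ip (nabla g α l) s x = 0

/-- The rotated field `ŝ = cos Θ s + sin Θ α`. -/
def rotS (Θ : M → ℝ) (s α : VField M) : VField M := fun x =>
  Real.cos (Θ x) • s x + Real.sin (Θ x) • α x

/-- The rotated field `α̂ = - sin Θ s + cos Θ α`. -/
def rotα (Θ : M → ℝ) (s α : VField M) : VField M := fun x =>
  -(Real.sin (Θ x) • s x) + Real.cos (Θ x) • α x

/-- The transport equation `l(Θ) = - g([l, s], α)` on `Ω`. -/
def Transport (s l α : VField M) (Θ : M → ℝ) (Ω : Set M) : Prop :=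
  ∀ x ∈ Ω, dirDeriv l Θ x = -g.ip (bracket l s) α x

/-! ### Foliations -/

/-- The distribution spanned by two vector fields. -/
def spanDist (X Y : VField M) (x : M) : Submodule ℝ (TangentSpace (𝓡 4) x) :=
  Submodule.span ℝ {X x, Y x}

/-- The pair `(X, Y)` is involutive on `Ω`: `[X, Y]` is a section of the span of `X` and `Y`. -/
def Involutive (X Y : VField M) (Ω : Set M) : Prop :=
  ∀ x ∈ Ω, bracket X Y x ∈ spanDist X Y x

/-- A smooth chart of `M` whose image is an open box in `ℝ⁴`. -/
structure IsBoxChart (e : OpenPartialHomeomorph M E4) : Prop where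
  mem_atlas : e ∈ IsManifold.maximalAtlas (𝓡 4) ∞ M
  box : ∃ a b : Fin 4 → ℝ, e.target = {v : E4 | ∀ i, a i < v i ∧ v i < b i}

/-- The differential of a chart. -/
def chartDiff (e : OpenPartialHomeomorph M E4) (x : M) : TangentSpace (𝓡 4) x →L[ℝ] E4 :=
  mfderiv (𝓡 4) 𝓘(ℝ, E4) e x

/-- The coordinate vector `∂_i` of the chart `e` at `x`. -/
def coordVec (e : OpenPartialHomeomorph M E4) (x : M) (i : Fin 4) : TangentSpace (𝓡 4) x :=
  (chartDiff e x).inverse (stdVec i)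

/-- A chart adapted to the rank 2 distribution `D`: at each point, `D` is tangent to the slice on
which the last two coordinates are constant. -/
structure IsFoliatedChart (D : (x : M) → Submodule ℝ (TangentSpace (𝓡 4) x))
    (e : OpenPartialHomeomorph M E4) : Prop extends IsBoxChart e where
  tangent : ∀ x ∈ e.source, ∀ v : TangentSpace (𝓡 4) x,
    v ∈ D x ↔ chartDiff e x v 2 = 0 ∧ chartDiff e x v 3 = 0

/-- The plaque through `x` of a chart: the slice of constant last two coordinates. -/
def plaque (e : OpenPartialHomeomorph M E4) (x : M) : Set M :=
  {y | y ∈ e.source ∧ e y 2 = e x 2 ∧ e y 3 = e x 3}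

/-- The collection `leaves` is a foliation of the open set `Ω` by connected 2-dimensional
(immersed) submanifolds with tangent distribution `D`: the leaves partition `Ω`; around each point
of `Ω` there is a chart adapted to `D`; each plaque of an adapted chart lies in one leaf;
and each leaf is connected through plaques. -/
structure IsFoliation (D : (x : M) → Submodule ℝ (TangentSpace (𝓡 4) x)) (Ω : Set M)
    (leaves : Set (Set M)) : Prop where
  nonempty : ∀ L ∈ leaves, L.Nonempty
  disjoint : leaves.PairwiseDisjoint id
  cover : ⋃₀ leaves = Ω
  charts : ∀ x ∈ Ω, ∃ e, IsFoliatedChart D e ∧ x ∈ e.source ∧ e.source ⊆ Ω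
  plaques : ∀ e, IsFoliatedChart D e → e.source ⊆ Ω → ∀ x ∈ e.source, ∀ L ∈ leaves, x ∈ L →
    plaque e x ⊆ L
  connected : ∀ L ∈ leaves, ∀ x ∈ L, ∀ y ∈ L, Relation.ReflTransGen
    (fun p q => ∃ e, IsFoliatedChart D e ∧ e.source ⊆ Ω ∧ p ∈ e.source ∧ q ∈ plaque e p) x y

/-- `leaves` is a null foliation of `Ω`, and `(s, l, α, n)` is a foliation-adapted frame. -/
structure IsNullFoliation (s l α n : VField M) (Ω : Set M) (leaves : Set (Set M)) : Prop where
  foliation : IsFoliation (spanDist l s) Ω leaves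
  tetrad : IsNullTetrad g s l α n Ω
  geodesic : IsNullGeodesic g l Ω

/-- `leaves` is a null field sheet foliation of `Ω`, and `(s, l, α, n)` is a foliation-adapted
frame. -/
structure IsNullFieldSheetFoliation (s l α n : VField M) (Ω : Set M) (leaves : Set (Set M)) :
    Prop extends IsNullFoliation g s l α n Ω leaves where
  equipartition : Equipartition g s l α Ω

/-- The factor `κ = (α₃ l₄ - α₄ l₃)⁻¹`, where `α₃, α₄, l₃, l₄` are the components of
`α^♭` and `l^♭` along the differentials of the last two coordinates of the chart `e`. -/
def kappa (α l : VField M) (e : OpenPartialHomeomorph M E4) (x : M) : ℝ :=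
  (g.val x (α x) (coordVec e x 2) * g.val x (l x) (coordVec e x 3)
    - g.val x (α x) (coordVec e x 3) * g.val x (l x) (coordVec e x 2))⁻¹

/-- The 2-form `u · κ α^♭ ∧ l^♭`, where `u` is a function of the last two coordinates of `e`. -/
def sheetField (α l : VField M) (e : OpenPartialHomeomorph M E4) (u : ℝ × ℝ → ℝ) : DForm M 2 :=
  fun x => (u (e x 2, e x 3) * kappa g α l e x) • wedge (g.val x (α x)) (g.val x (l x))

end Spacetime

end NullFFE

end

/-!
Fix a tetrad `(s, l, α, n)` adapted to the null geodesic field `l`.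

*Involutivity and transport.* The scalar products within the tetrad are constant, so the Koszul
formula expresses `2 g(∇_X Y, Z)` by scalar products of brackets alone when `X, Y, Z` belong to
the tetrad (`koszul_of_const`). Read in this way, the geodesic equation says that `[l, s]` and
`[l, α]` stay in the null hyperplane `l^⊥`, and the two equipartition conditions say that the flow
of `l` acts conformally on the screen `l^⊥ / l` (`ConformalBrackets`, `conformalBrackets`). These
properties survive a rotation of the screen by `Θ`, and `g([l, ŝ], α̂) = l(Θ) + g([l, s], α)`
(`ConformalBrackets.rotate`). As `[l, ŝ]` is orthogonal to `l`, its scalar product with `α̂` is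
all that can prevent it from lying in `span(l, ŝ) = {l, α̂}^⊥`: this is
`involutive_iff_transport`.

*Adapted charts.* Mathlib has no smooth dependence of integral curves on initial data. It is
obtained from the implicit function theorem for the map `(T, x, γ) ↦ γ - x - T ∫ f(γ)` on the
Banach space of continuous curves, where smoothness of the superposition operator `γ ↦ f ∘ γ` is
the essential point (`contDiff_comp_left`, `exists_smooth_flow`). The flow box theorem follows
(`exists_flowBox`), and in a box with `l = ∂₀` the transport equation is solved by a primitive
`Θ₀`, unique up to functions of the other three coordinates (`exists_transport_chart`). If
`(l, ŝ)` is involutive and `l = ∂₀`, the section of `span(l, ŝ)` with components `(0, 1)` along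
`(∂₀, ∂₁)` does not depend on `x⁰`; straightening that field gives a chart whose slices are
tangent to `span(l, ŝ)` (`exists_straightening_plane`, `exists_foliatedChart`), which is the
Frobenius theorem here. The leaves are the classes of points joined by chains of plaques
(`exists_isFoliation`).

*Force-free fields.* In an adapted chart `α̂♭` and `l♭` vanish on the slices, so
`κ α̂♭ ∧ l♭ = dx² ∧ dx³` and `F = u(x², x³) dx² ∧ dx³` is closed. In a null frame the Hodge star
sends `α̂♭ ∧ l♭` to a multiple `± ŝ♭ ∧ l♭` (`IsNullFrame.star2_wedge`), hence `d * F` is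
`± d(φ ŝ♭ ∧ l♭)` when `F = φ α̂♭ ∧ l♭`. The current has to be orthogonal to `l` and `α̂`. The
first holds because `[l, α̂]` is orthogonal to `l`; the second is the vanishing of
`d(φ ŝ♭ ∧ l♭)(l, ŝ, n)`. By Cartan's formula for the exterior derivative and the conformality of
the flow of `l` on the screen, this equals `dF(l, α̂, n) = 0` (`coordCurrent_eq_zero`). Conversely
a field whose kernel contains `span(l, ŝ)` is `φ dx² ∧ dx³`, and closedness in a box makes `φ` a
function of `(x², x³)` (`exists_eq_sheetField`).
-/

noncomputable section

universe u

namespace NullFFE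

/-! ### Superposition operators on spaces of curves -/

section Nemytskii

variable {K : Type*} [TopologicalSpace K] [CompactSpace K]
  {E F : Type*} [NormedAddCommGroup E] [NormedSpace ℝ E] [NormedAddCommGroup F] [NormedSpace ℝ F]

variable (K E F) in
/-- Pointwise application of a continuous family of linear maps to a continuous family of
vectors, as a continuous bilinear map. -/
def pointwiseApply : C(K, E →L[ℝ] F) →L[ℝ] C(K, E) →L[ℝ] C(K, F) :=
  LinearMap.mkContinuous₂
    (LinearMap.mk₂ ℝ (fun (A : C(K, E →L[ℝ] F)) (γ : C(K, E)) =>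
        (⟨fun t => A t (γ t), by fun_prop⟩ : C(K, F)))
      (fun A B γ => by ext; simp) (fun c A γ => by ext; simp)
      (fun A γ δ => by ext; simp) (fun c A γ => by ext; simp)) 1 (fun A γ => by
        rw [one_mul]
        refine (ContinuousMap.norm_le _ (by positivity)).2 fun t => ?_
        exact (A t).le_opNorm_of_le (γ.norm_coe_le_norm t) |>.trans (by
          gcongr; exact A.norm_coe_le_norm t))

lemma pointwiseApply_apply (A : C(K, E →L[ℝ] F)) (γ : C(K, E)) (t : K) :
    pointwiseApply K E F A γ t = A t (γ t) := rfl

lemma hasFDerivAt_comp_left {v : E → F} (hv : ContDiff ℝ 1 v)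
    (huc : UniformContinuous (fderiv ℝ v)) (γ : C(K, E)) :
    HasFDerivAt (fun δ : C(K, E) => (⟨v, hv.continuous⟩ : C(E, F)).comp δ)
      (pointwiseApply K E F ((⟨fderiv ℝ v, huc.continuous⟩ : C(E, E →L[ℝ] F)).comp γ)) γ := by
  rw [hasFDerivAt_iff_isLittleO_nhds_zero, Asymptotics.isLittleO_iff]
  intro ε hε
  obtain ⟨δ, hδ, h⟩ := Metric.uniformContinuous_iff.1 huc ε hε
  filter_upwards [Metric.ball_mem_nhds (0 : C(K, E)) hδ] with k hk
  refine (ContinuousMap.norm_le _ (by positivity)).2 fun t => ?_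
  have hkt : ‖k t‖ < δ := (k.norm_coe_le_norm t).trans_lt (by simpa using hk)
  have key := (convex_ball (γ t) δ).norm_image_sub_le_of_norm_hasFDerivWithin_le'
    (f := v) (f' := fderiv ℝ v) (φ := fderiv ℝ v (γ t)) (C := ε) (x := γ t) (y := γ t + k t)
    (fun x _ => (hv.differentiable one_ne_zero x).hasFDerivAt.hasFDerivWithinAt)
    (fun x hx => by
      have := h (a := x) (b := γ t) hx
      rw [dist_eq_norm] at this
      exact this.le)
    (Metric.mem_ball_self hδ) (by simpa using hkt)
  simp only [add_sub_cancel_left] at key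
  refine le_trans key ?_
  gcongr
  exact k.norm_coe_le_norm t

/-- Composition with a smooth compactly supported map is a smooth operator between spaces of
continuous functions: its derivative is pointwise application of the composition with the
derivative, so smoothness of every finite order follows by induction. -/
theorem contDiff_comp_left_nat {E : Type u} [NormedAddCommGroup E] [NormedSpace ℝ E] (n : ℕ) :
    ∀ {F : Type u} [NormedAddCommGroup F] [NormedSpace ℝ F] {v : E → F} (hv : ContDiff ℝ ∞ v),
    HasCompactSupport v →
    ContDiff ℝ n (fun γ : C(K, E) => (⟨v, hv.continuous⟩ : C(E, F)).comp γ) := by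
  induction n with
  | zero =>
    intro F _ _ v hv _
    exact contDiff_zero.2 (ContinuousMap.continuous_postcomp _)
  | succ n ih =>
    intro F _ _ v hv hc
    have hD : ContDiff ℝ ∞ (fderiv ℝ v) := hv.fderiv_right (by simp)
    have huc : UniformContinuous (fderiv ℝ v) :=
      (hc.fderiv ℝ).uniformContinuous_of_continuous hD.continuous
    have h1 : ContDiff ℝ 1 v := hv.of_le (by exact_mod_cast le_top)
    refine contDiff_succ_iff_hasFDerivAt.2 ⟨_, ?_, fun γ => hasFDerivAt_comp_left h1 huc γ⟩
    exact (pointwiseApply K E F).contDiff.comp (ih hD (hc.fderiv ℝ))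

theorem contDiff_comp_left {E F : Type u} [NormedAddCommGroup E] [NormedSpace ℝ E]
    [NormedAddCommGroup F] [NormedSpace ℝ F] {v : E → F} (hv : ContDiff ℝ ∞ v)
    (hc : HasCompactSupport v) :
    ContDiff ℝ ∞ (fun γ : C(K, E) => (⟨v, hv.continuous⟩ : C(E, F)).comp γ) :=
  contDiff_infty.2 fun n => contDiff_comp_left_nat n hv hc

end Nemytskii

/-! ### Integration of curves -/

section Primitive

variable {E : Type*} [NormedAddCommGroup E] [NormedSpace ℝ E]

/-- The primitive vanishing at `0` of a curve on `[0, 1]`, as a bounded operator. -/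
def primitive (E : Type*) [NormedAddCommGroup E] [NormedSpace ℝ E] :
    C(unitInterval, E) →L[ℝ] C(unitInterval, E) :=
  LinearMap.mkContinuous
    { toFun := fun γ => ⟨fun t => ∫ s in (0 : ℝ)..t, γ (projIcc 0 1 zero_le_one s), by
        have h : Continuous fun s : ℝ => γ (projIcc 0 1 zero_le_one s) :=
          γ.continuous.comp continuous_projIcc
        exact (intervalIntegral.continuous_primitive
          (fun a b => h.intervalIntegrable a b) 0).comp continuous_subtype_val⟩
      map_add' := fun γ δ => by
        ext t
        simp only [ContinuousMap.coe_mk, ContinuousMap.add_apply]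
        exact intervalIntegral.integral_add
          ((γ.continuous.comp continuous_projIcc).intervalIntegrable _ _)
          ((δ.continuous.comp continuous_projIcc).intervalIntegrable _ _)
      map_smul' := fun c γ => by
        ext t
        simp only [ContinuousMap.coe_mk, ContinuousMap.smul_apply, RingHom.id_apply]
        exact intervalIntegral.integral_smul _ _ } 1 (fun γ => by
      rw [one_mul]
      refine (ContinuousMap.norm_le _ (by positivity)).2 fun t => ?_
      refine (intervalIntegral.norm_integral_le_of_norm_le_const (C := ‖γ‖)
        fun s _ => γ.norm_coe_le_norm _).trans ?_
      rw [sub_zero, abs_of_nonneg t.2.1]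
      exact mul_le_of_le_one_right (norm_nonneg _) t.2.2)

lemma primitive_apply (γ : C(unitInterval, E)) (t : unitInterval) :
    primitive E γ t = ∫ s in (0 : ℝ)..t, γ (projIcc 0 1 zero_le_one s) := rfl

end Primitive

/-! ### Smooth local flows -/

section Flow

variable {E : Type u} [NormedAddCommGroup E] [NormedSpace ℝ E]

/-- The integral equation `γ = x + T ∫ X(γ)` of the flow of `X`, run on the unit interval with
time rescaled by the parameter `T`; the parameters are `p = (T, x)`. At `T = 0` its derivative in
`γ` is the identity. -/
def flowEquation {X : E → E} (hX : Continuous X) (p : (ℝ × E) × C(unitInterval, E)) :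
    C(unitInterval, E) :=
  p.2 - ContinuousMap.const _ p.1.2 - p.1.1 • primitive E ((⟨X, hX⟩ : C(E, E)).comp p.2)

lemma contDiff_flowEquation {X : E → E} (hX : ContDiff ℝ ∞ X) (hc : HasCompactSupport X) :
    ContDiff ℝ ∞ (flowEquation hX.continuous) := by
  have h1 : ContDiff ℝ ∞ (fun p : (ℝ × E) × C(unitInterval, E) =>
      (⟨X, hX.continuous⟩ : C(E, E)).comp p.2) :=
    (contDiff_comp_left (K := unitInterval) hX hc).comp contDiff_snd
  have h2 : ContDiff ℝ ∞ (fun x : E => (ContinuousMap.const unitInterval x)) :=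
    (ContinuousLinearMap.const ℝ unitInterval (M := E)).contDiff
  unfold flowEquation
  have h3 := (primitive E).contDiff (n := ∞) |>.comp h1
  exact (contDiff_snd.sub (h2.comp (contDiff_snd.comp contDiff_fst))).sub
    ((contDiff_fst.comp contDiff_fst).smul h3)

lemma flowEquation_eq_zero_iff {X : E → E} (hX : Continuous X) {T : ℝ} {x : E}
    {γ : C(unitInterval, E)} : flowEquation hX ((T, x), γ) = 0 ↔
      ∀ t : unitInterval, γ t = x + T • ∫ s in (0 : ℝ)..t, X (γ (projIcc 0 1 zero_le_one s)) := by
  rw [ContinuousMap.ext_iff]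
  refine forall_congr' fun t => ?_
  simp only [flowEquation, ContinuousMap.sub_apply, ContinuousMap.smul_apply, primitive_apply,
    ContinuousMap.const_apply, ContinuousMap.comp_apply, ContinuousMap.coe_mk,
    ContinuousMap.zero_apply]
  rw [sub_sub, sub_eq_zero]

/-- Rescaling time in a solution of the flow equation. -/
lemma flowEquation_rescale {X : E → E} (hX : Continuous X) {T : ℝ} {x : E}
    {γ : C(unitInterval, E)} (h : flowEquation hX ((T, x), γ) = 0) (τ : unitInterval) :
    flowEquation hX ((τ * T, x), γ.comp ⟨fun t => τ * t, by fun_prop⟩) = 0 := by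
  rw [flowEquation_eq_zero_iff] at h ⊢
  intro t
  have h1 := h (τ * t)
  simp only [ContinuousMap.comp_apply, ContinuousMap.coe_mk]
  rw [h1, mul_comm (τ : ℝ) T, mul_smul]
  congr 2
  have h2 : ∀ s ∈ uIcc (0 : ℝ) t, X (γ (τ * projIcc 0 1 zero_le_one s)) =
      (fun r => X (γ (projIcc 0 1 zero_le_one r))) (τ * s) := by
    intro s hs
    rw [uIcc_of_le t.2.1] at hs
    have hs' : s ∈ Icc (0 : ℝ) 1 := ⟨hs.1, hs.2.trans t.2.2⟩
    have hτ : (τ : ℝ) * s ∈ Icc (0 : ℝ) 1 := unitInterval.mul_mem τ.2 hs'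
    simp only
    congr 2
    rw [projIcc_of_mem zero_le_one hs', projIcc_of_mem zero_le_one hτ]
    rfl
  have h3 := intervalIntegral.smul_integral_comp_mul_left (a := 0) (b := (t : ℝ))
    (fun r => X (γ (projIcc 0 1 zero_le_one r))) (τ : ℝ)
  rw [intervalIntegral.integral_congr h2, h3, mul_zero]
  rfl

/-- A smooth compactly supported vector field on a Banach space has, near each point, a local
flow which is smooth jointly in time and initial condition. -/
theorem exists_smooth_flow [CompleteSpace E] {X : E → E} (hX : ContDiff ℝ ∞ X)
    (hc : HasCompactSupport X) (x₀ : E) :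
    ∃ φ : ℝ × E → E, (∀ᶠ p in 𝓝 ((0 : ℝ), x₀), ContDiffAt ℝ ∞ φ p) ∧ (∀ᶠ x in 𝓝 x₀, φ (0, x) = x) ∧
      ∀ᶠ p in 𝓝 ((0 : ℝ), x₀), fderiv ℝ φ p (1, 0) = X (φ p) := by
  set c₀ : C(unitInterval, E) := ContinuousMap.const _ x₀ with hc₀
  set u : (ℝ × E) × C(unitInterval, E) := (((0 : ℝ), x₀), c₀) with hu
  set G := flowEquation hX.continuous with hG
  have hGu : G u = 0 := by
    rw [hG, hu, flowEquation_eq_zero_iff]; intro t; simp [hc₀]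
  have hGs : ContDiffAt ℝ ∞ G u := (contDiff_flowEquation hX hc).contDiffAt
  have hpar : fderiv ℝ G u ∘L .inr ℝ (ℝ × E) C(unitInterval, E) = .id ℝ _ := by
    have h1 : HasFDerivAt G (fderiv ℝ G u) u := (hGs.differentiableAt (by simp)).hasFDerivAt
    have h2 : HasFDerivAt (fun γ : C(unitInterval, E) => (((0 : ℝ), x₀), γ))
        (.inr ℝ (ℝ × E) C(unitInterval, E)) c₀ := hasFDerivAt_prodMk_right _ _
    have h3 := HasFDerivAt.comp c₀ h1 h2
    have h4 : (G ∘ fun γ : C(unitInterval, E) => (((0 : ℝ), x₀), γ)) =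
        fun γ => γ - ContinuousMap.const _ x₀ := by
      ext γ t
      simp [hG, flowEquation]
    rw [h4] at h3
    exact h3.unique ((hasFDerivAt_id _).sub_const _)
  have hinv : (fderiv ℝ G u ∘L .inr ℝ (ℝ × E) C(unitInterval, E)).IsInvertible := by
    rw [hpar]; exact ⟨.refl ℝ _, rfl⟩
  have hn : (∞ : WithTop ℕ∞) ≠ 0 := by simp
  set ψ := hGs.implicitFunction hn hinv with hψ
  have hψs : ContDiffAt ℝ ∞ ψ (0, x₀) := hGs.contDiffAt_implicitFunction hn hinv
  have hψc : ∀ᶠ p in 𝓝 ((0 : ℝ), x₀), ContinuousAt ψ p :=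
    ((hψs.of_le (m := 1) (by exact_mod_cast le_top)).eventually (by simp)).mono
      fun p hp => hp.continuousAt
  have hψ0 : ψ (0, x₀) = c₀ := hGs.implicitFunction_apply_self hn hinv
  have hψe : ∀ᶠ p in 𝓝 ((0 : ℝ), x₀), G (p, ψ p) = 0 := by
    have := hGs.eventually_apply_implicitFunction hn hinv
    rwa [hGu] at this
  have hψu : ∀ᶠ v in 𝓝 u, G v = 0 → ψ v.1 = v.2 := by
    have := hGs.eventually_apply_eq_iff_implicitFunction hn hinv
    rw [hGu] at this
    exact this.mono fun v hv => hv.1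
  -- near a nearby solution, `ψ` agrees with the implicit function based at that solution
  have hψS : ∀ᶠ p in 𝓝 ((0 : ℝ), x₀), ContDiffAt ℝ ∞ ψ p := by
    have hGd : ContDiff ℝ ∞ G := contDiff_flowEquation hX hc
    have hI : ∀ᶠ v in 𝓝 u, (fderiv ℝ G v ∘L .inr ℝ (ℝ × E) C(unitInterval, E)).IsInvertible := by
      have hcont : Continuous fun v => fderiv ℝ G v ∘L .inr ℝ (ℝ × E) C(unitInterval, E) :=
        (hGd.continuous_fderiv hn).clm_comp continuous_const
      have := ContinuousLinearEquiv.nhds (ContinuousLinearEquiv.refl ℝ C(unitInterval, E))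
      have h2 : Tendsto (fun v => fderiv ℝ G v ∘L .inr ℝ (ℝ × E) C(unitInterval, E)) (𝓝 u)
          (𝓝 ((ContinuousLinearEquiv.refl ℝ C(unitInterval, E) :
            C(unitInterval, E) →L[ℝ] C(unitInterval, E)))) := by
        have h3 := hcont.tendsto u
        rw [hpar] at h3
        exact h3
      exact h2 this
    have hpair : Tendsto (fun p => (p, ψ p)) (𝓝 ((0 : ℝ), x₀)) (𝓝 u) := by
      have := (continuousAt_id.prodMk hψs.continuousAt).tendsto
      simp only [hψ0, id] at this
      exact this
    filter_upwards [hpair.eventually hI, hψe.eventually_nhds, hψc] with p hp he hpc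
    have hGp : ContDiffAt ℝ ∞ G (p, ψ p) := hGd.contDiffAt
    refine (hGp.contDiffAt_implicitFunction hn hp).congr_of_eventuallyEq ?_
    have hpair' : Tendsto (fun p => (p, ψ p)) (𝓝 p) (𝓝 (p, ψ p)) :=
      (continuousAt_id.prodMk hpc).tendsto
    filter_upwards [hpair'.eventually (hGp.eventually_apply_eq_iff_implicitFunction hn hp), he]
      with q hq hq0
    exact (hq.1 (hq0.trans he.self_of_nhds.symm)).symm
  obtain ⟨ε, hε, hball⟩ := Metric.eventually_nhds_iff_ball.1 hψu
  let ev : C(unitInterval, E) →L[ℝ] E := ContinuousMap.evalCLM ℝ (1 : unitInterval)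
  have hφs : ContDiffAt ℝ ∞ (fun p => ev (ψ p)) (0, x₀) := ev.contDiff.contDiffAt.comp _ hψs
  -- near the base point, `ψ (T, x)` is the curve `t ↦ φ (t T, x)`
  have hscale : ∀ᶠ p in 𝓝 ((0 : ℝ), x₀), ∀ τ : unitInterval, ψ (τ * p.1, p.2) 1 = ψ p τ := by
    have hcl : ∀ᶠ p in 𝓝 ((0 : ℝ), x₀), dist (ψ p) c₀ < ε := by
      have := hψs.continuousAt.tendsto
      rw [hψ0] at this
      exact this (Metric.ball_mem_nhds _ hε)
    filter_upwards [hψe, hcl, Metric.ball_mem_nhds ((0 : ℝ), x₀) hε] with p hp hpε hpb τ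
    have h1 := flowEquation_rescale hX.continuous (T := p.1) (x := p.2) hp τ
    set γ : C(unitInterval, E) := (ψ p).comp ⟨fun t => τ * t, by fun_prop⟩ with hγ
    have hmem : (((τ : ℝ) * p.1, p.2), γ) ∈ Metric.ball u ε := by
      have hp1 : |p.1| < ε ∧ dist p.2 x₀ < ε := by
        simpa [Prod.dist_eq] using hpb
      simp only [Metric.mem_ball, Prod.dist_eq, hu, max_lt_iff]
      refine ⟨⟨?_, hp1.2⟩, ?_⟩
      · rw [Real.dist_eq, sub_zero, abs_mul, abs_of_nonneg τ.2.1]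
        exact (mul_le_of_le_one_left (abs_nonneg _) τ.2.2).trans_lt hp1.1
      · refine (ContinuousMap.dist_lt_iff hε).2 fun t => ?_
        exact (ContinuousMap.dist_apply_le_dist (f := ψ p) (g := c₀) (τ * t)).trans_lt hpε
    have h2 : ψ (τ * p.1, p.2) = γ := hball _ hmem h1
    rw [h2]
    simp [hγ]
  refine ⟨fun p => ev (ψ p), hψS.mono fun p hp => ev.contDiff.contDiffAt.comp _ hp, ?_, ?_⟩
  · have : ∀ᶠ x in 𝓝 x₀, G (((0 : ℝ), x), ψ (0, x)) = 0 :=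
      (Continuous.tendsto' (by fun_prop) _ _ rfl : Tendsto (fun x : E => ((0 : ℝ), x)) (𝓝 x₀)
        (𝓝 ((0 : ℝ), x₀))).eventually hψe
    filter_upwards [this] with x hx
    have := (flowEquation_eq_zero_iff hX.continuous).1 hx 1
    simpa [ev] using this
  · have hd1 : ∀ᶠ p in 𝓝 ((0 : ℝ), x₀), ContDiffAt ℝ 1 (fun p => ev (ψ p)) p :=
      (hφs.of_le (m := 1) (by exact_mod_cast le_top)).eventually (by simp)
    -- the equation holds at nonzero times, by differentiating at the midpoint of `ψ (2 T, x)`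
    have hne : ∀ᶠ p in 𝓝 ((0 : ℝ), x₀), p.1 ≠ 0 →
        fderiv ℝ (fun p => ev (ψ p)) p (1, 0) = X (ev (ψ p)) := by
      have hdbl : Tendsto (fun p : ℝ × E => (2 * p.1, p.2)) (𝓝 (0, x₀)) (𝓝 (0, x₀)) :=
        Continuous.tendsto' (by fun_prop) _ _ (by simp)
      filter_upwards [hdbl.eventually hψe, hdbl.eventually hscale, hd1] with p hp hsc hd hp0
      set q : ℝ × E := (2 * p.1, p.2) with hq
      have hγ := (flowEquation_eq_zero_iff hX.continuous (T := q.1) (x := q.2)).1 hp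
      have hcont : Continuous fun s : ℝ => X (ψ q (projIcc 0 1 zero_le_one s)) :=
        hX.continuous.comp ((ψ q).continuous.comp continuous_projIcc)
      have hder : HasDerivAt
          (fun τ : ℝ => q.2 + q.1 • ∫ s in (0 : ℝ)..τ, X (ψ q (projIcc 0 1 zero_le_one s)))
          (q.1 • X (ψ q (projIcc 0 1 zero_le_one (1 / 2 : ℝ)))) (1 / 2 : ℝ) := by
        have := (intervalIntegral.integral_hasDerivAt_right (hcont.intervalIntegrable 0 (1 / 2))
          hcont.aestronglyMeasurable.stronglyMeasurableAtFilter hcont.continuousAt)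
        exact (this.const_smul q.1).const_add q.2
      have heq : (fun τ : ℝ => ev (ψ (τ * q.1, q.2))) =ᶠ[𝓝 (1 / 2 : ℝ)]
          (fun τ : ℝ => q.2 + q.1 • ∫ s in (0 : ℝ)..τ, X (ψ q (projIcc 0 1 zero_le_one s))) := by
        filter_upwards [Icc_mem_nhds (show (0 : ℝ) < 1 / 2 by norm_num)
          (show (1 / 2 : ℝ) < 1 by norm_num)] with τ hτ
        have := hsc ⟨τ, hτ⟩
        rw [hγ ⟨τ, hτ⟩] at this
        exact this
      have hhalf : ((1 / 2 : ℝ) * q.1, q.2) = p := by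
        ext <;> simp [hq]
      have hpt : ψ q (projIcc 0 1 zero_le_one (1 / 2 : ℝ)) = ev (ψ p) := by
        have h12 : (1 / 2 : ℝ) ∈ Icc (0 : ℝ) 1 := by norm_num
        rw [projIcc_of_mem zero_le_one h12, ← hsc ⟨1 / 2, h12⟩]
        change ψ ((1 / 2 : ℝ) * q.1, q.2) 1 = ψ p 1
        rw [hhalf]
      have hder2 : HasDerivAt (fun τ : ℝ => ev (ψ (τ * q.1, q.2)))
          (fderiv ℝ (fun p => ev (ψ p)) p (q.1, 0)) (1 / 2 : ℝ) := by
        have h1 : HasFDerivAt (fun p => ev (ψ p)) (fderiv ℝ (fun p => ev (ψ p)) p)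
            ((1 / 2 : ℝ) * q.1, q.2) := by
          rw [hhalf]; exact (hd.differentiableAt one_ne_zero).hasFDerivAt
        have h2 : HasDerivAt (fun τ : ℝ => (τ * q.1, q.2)) (q.1, (0 : E)) (1 / 2 : ℝ) := by
          simpa using ((hasDerivAt_id (1 / 2 : ℝ)).mul_const q.1).prodMk
            (hasDerivAt_const (1 / 2 : ℝ) q.2)
        exact h1.comp_hasDerivAt (1 / 2 : ℝ) h2
      have := (hder2.congr_of_eventuallyEq heq.symm).unique hder
      rw [hpt] at this
      have hq0 : q.1 ≠ 0 := by simpa [hq] using hp0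
      have hs : (q.1, (0 : E)) = q.1 • ((1 : ℝ), (0 : E)) := by simp
      rw [hs, map_smul] at this
      exact smul_right_injective E hq0 this
    filter_upwards [hd1.eventually_nhds, hne.eventually_nhds] with p hd hp
    by_cases hp0 : p.1 = 0
    · have hcD : ContinuousAt
          (fun p => fderiv ℝ (fun p => ev (ψ p)) p (1, 0) - X (ev (ψ p))) p := by
        have h1 := hd.self_of_nhds
        have h2 : ContinuousAt (fderiv ℝ (fun p => ev (ψ p))) p :=
          (h1.fderiv_right (m := 0) (by simp)).continuousAt
        exact (h2.clm_apply continuousAt_const).sub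
          (hX.continuous.continuousAt.comp h1.continuousAt)
      have hline : Tendsto (fun t : ℝ => (t, p.2)) (𝓝[≠] 0) (𝓝 p) := by
        have : Tendsto (fun t : ℝ => (t, p.2)) (𝓝 0) (𝓝 p) :=
          Continuous.tendsto' (by fun_prop) _ _ (by rw [← hp0])
        exact this.mono_left nhdsWithin_le_nhds
      have hz : Tendsto (fun t : ℝ => fderiv ℝ (fun p => ev (ψ p)) (t, p.2) (1, 0)
          - X (ev (ψ (t, p.2)))) (𝓝[≠] 0) (𝓝 0) := by
        refine tendsto_const_nhds.congr' ?_
        filter_upwards [hline.eventually hp, self_mem_nhdsWithin] with t ht ht0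
        rw [ht ht0, sub_self]
      exact sub_eq_zero.1 (tendsto_nhds_unique (hcD.tendsto.comp hline) hz)
    · exact hp.self_of_nhds hp0

end Flow

/-! ### Straightening vector fields -/

section FlowBox

variable {E : Type u} [NormedAddCommGroup E] [NormedSpace ℝ E] [FiniteDimensional ℝ E]

/-- A map which is smooth near a point coincides near it with a smooth compactly supported one. -/
lemma exists_compactSupport_extension {F : Type*} [NormedAddCommGroup F] [NormedSpace ℝ F]
    {X : E → F} {x₀ : E} (hX : ∀ᶠ y in 𝓝 x₀, ContDiffAt ℝ ∞ X y) :
    ∃ Y : E → F, ContDiff ℝ ∞ Y ∧ HasCompactSupport Y ∧ Y =ᶠ[𝓝 x₀] X := by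
  obtain ⟨ε, hε, hb⟩ := Metric.eventually_nhds_iff_ball.1 hX
  let f : ContDiffBump x₀ := ⟨ε / 4, ε / 2, by positivity, by linarith⟩
  refine ⟨fun y => f y • X y, ?_, f.hasCompactSupport.smul_right, ?_⟩
  · rw [contDiff_iff_contDiffAt]
    intro y
    by_cases hy : y ∈ tsupport f
    · rw [f.tsupport_eq] at hy
      refine f.contDiff.contDiffAt.smul (hb y ?_)
      exact Metric.closedBall_subset_ball (show ε / 2 < ε by linarith) hy
    · have : (fun y => f y • X y) =ᶠ[𝓝 y] fun _ => 0 := by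
        filter_upwards [notMem_tsupport_iff_eventuallyEq.1 hy] with z hz
        rw [hz]; simp
      exact contDiffAt_const.congr_of_eventuallyEq this
  · filter_upwards [f.eventuallyEq_one] with y hy
    simp [hy]

/-- Flow box. A vector field `X` which is smooth near `0` and does not vanish there is the image of
the constant field `v = X 0` under a local diffeomorphism `Φ`. The projection `π` allows for the
case of a field independent of some of the directions: `Φ` straightens `X ∘ π`, and it preserves the
directions in `ker π`. -/
theorem exists_flowBox {X : E → E} (hX : ∀ᶠ y in 𝓝 0, ContDiffAt ℝ ∞ X y) {ℓ : E →L[ℝ] ℝ}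
    (hℓ : ℓ (X 0) = 1) {π : E →L[ℝ] E} (hππ : ∀ y, π (π y) = π y)
    (hπv : π (X 0) = X 0) :
    ∃ Φ : OpenPartialHomeomorph E E, (0 : E) ∈ Φ.source ∧ Φ 0 = 0 ∧
      ContDiffOn ℝ ∞ Φ Φ.source ∧ ContDiffOn ℝ ∞ Φ.symm Φ.target ∧
      (∀ y ∈ Φ.source, fderiv ℝ Φ y (X 0) = X (π (Φ y))) ∧
      (∀ y ∈ Φ.source, ∀ h, π h = 0 → ℓ h = 0 → fderiv ℝ Φ y h = h) ∧
      fderiv ℝ Φ 0 = .id ℝ E := by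
  have hπ0 : Tendsto π (𝓝 0) (𝓝 0) := π.continuous.tendsto' _ _ (map_zero π)
  obtain ⟨Y, hY, hYc, hYX⟩ := exists_compactSupport_extension (X := fun y => X (π y)) (x₀ := 0)
    ((hπ0.eventually hX).mono fun y hy => hy.comp y π.contDiff.contDiffAt)
  have : CompleteSpace E := FiniteDimensional.complete ℝ E
  obtain ⟨φ, hφs, hφ0, hφ⟩ := exists_smooth_flow hY hYc 0
  set v := X 0 with hv
  -- `Φ` flows for time `ℓ y` from the point of the hyperplane `ℓ = 0` in `range π` below `y`, and
  -- translates along `ker π`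
  let q : E →L[ℝ] ℝ × E := ℓ.prod (π - ℓ.smulRight v)
  let f : E → E := fun y => y - π y + φ (q y)
  have hq0 : Tendsto q (𝓝 0) (𝓝 (0, 0)) := q.continuous.tendsto' _ _ (map_zero q)
  have hφ00 : φ (0, 0) = 0 := hφ0.self_of_nhds
  have hf0 : f 0 = 0 := by simp only [f, map_zero, sub_zero, zero_add]; exact hφ00
  have hfs : ∀ᶠ y in 𝓝 0, ContDiffAt ℝ ∞ f y := by
    filter_upwards [hq0.eventually hφs] with y hy
    exact (contDiffAt_id.sub π.contDiff.contDiffAt).add (hy.comp y q.contDiff.contDiffAt)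
  have hfd : ∀ᶠ y in 𝓝 0, ∀ h, fderiv ℝ f y h = h - π h + fderiv ℝ φ (q y) (q h) := by
    filter_upwards [hq0.eventually hφs] with y hy h
    have h1 : HasFDerivAt f (.id ℝ E - π + fderiv ℝ φ (q y) ∘L q) y :=
      ((hasFDerivAt_id y).sub π.hasFDerivAt).add
        ((hy.differentiableAt (by simp)).hasFDerivAt.comp y q.hasFDerivAt)
    rw [h1.fderiv]
    simp
  have hqv : q v = (1, 0) := by simp [q, hℓ, hπv]
  have hflow : ∀ᶠ y in 𝓝 0, fderiv ℝ f y v = Y (φ (q y)) := by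
    filter_upwards [hfd, hq0.eventually hφ] with y hy hy'
    rw [hy, hqv, hy', hπv, sub_self, zero_add]
  have hkey : fderiv ℝ f 0 = .id ℝ E := by
    ext h
    have h1 := hfd.self_of_nhds h
    have h2 : fderiv ℝ φ ((0 : ℝ), (0 : E)) (1, 0) = v := by
      rw [hφ.self_of_nhds, hφ00, hYX.self_of_nhds]; simp only [map_zero, hv]
    have h3 : ∀ z : E, fderiv ℝ φ ((0 : ℝ), (0 : E)) (0, z) = z := by
      intro z
      have h4 : HasFDerivAt (fun x : E => φ (0, x)) (fderiv ℝ φ ((0 : ℝ), (0 : E)) ∘L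
          .inr ℝ ℝ E) 0 :=
        (hφs.self_of_nhds.differentiableAt (by simp)).hasFDerivAt.comp (0 : E)
          (hasFDerivAt_prodMk_right _ _)
      have h5 : HasFDerivAt (fun x : E => φ (0, x)) (.id ℝ E) 0 :=
        (hasFDerivAt_id (0 : E)).congr_of_eventuallyEq hφ0
      have := congrArg (fun L => L z) (h4.unique h5)
      simpa using this
    have h6 : q h = ℓ h • ((1 : ℝ), (0 : E)) + (0, π h - ℓ h • v) := by
      ext <;> simp [q]
    rw [h1, map_zero, h6, map_add, map_smul]
    have h00 : (0 : ℝ × E) = ((0 : ℝ), (0 : E)) := rfl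
    rw [h00, h2, h3]
    simp
  have hstr : ∀ᶠ y in 𝓝 0, fderiv ℝ f y v = X (π (f y)) := by
    have h1 : Tendsto (fun y => φ (q y)) (𝓝 0) (𝓝 0) := by
      have : Tendsto φ (𝓝 (0, 0)) (𝓝 (φ (0, 0))) := hφs.self_of_nhds.continuousAt
      rw [hφ00] at this
      exact this.comp hq0
    filter_upwards [hflow, h1.eventually hYX] with y hy hy'
    rw [hy, hy']
    simp [f, hππ]
  have hker : ∀ᶠ y in 𝓝 0, ∀ h, π h = 0 → ℓ h = 0 → fderiv ℝ f y h = h := by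
    filter_upwards [hfd] with y hy h h1 h2
    have : q h = 0 := by ext <;> simp [q, h1, h2]
    rw [hy, h1, this, map_zero, sub_zero, add_zero]
  have hinv : ∀ᶠ y in 𝓝 0, fderiv ℝ f y ∈ range ((↑) : (E ≃L[ℝ] E) → E →L[ℝ] E) := by
    have hc : Tendsto (fderiv ℝ f) (𝓝 0) (𝓝 (fderiv ℝ f 0)) :=
      (hfs.self_of_nhds.fderiv_right (m := 0) (by simp)).continuousAt
    rw [hkey] at hc
    exact hc (ContinuousLinearEquiv.nhds (ContinuousLinearEquiv.refl ℝ E))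
  obtain ⟨U, hU, hUo, hU0⟩ := eventually_nhds_iff.1
    (hfs.and (hstr.and (hker.and hinv)))
  have hf0s : ContDiffAt ℝ ∞ f 0 := hfs.self_of_nhds
  have hf0d : HasFDerivAt f ((ContinuousLinearEquiv.refl ℝ E : E ≃L[ℝ] E) : E →L[ℝ] E) 0 := by
    have := (hf0s.differentiableAt (by simp)).hasFDerivAt
    rw [hkey] at this
    exact this
  set Ψ := hf0s.toOpenPartialHomeomorph f hf0d (by simp) with hΨ
  have hΨf : (Ψ : E → E) = f := hf0s.toOpenPartialHomeomorph_coe hf0d (by simp)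
  have hΦf : (Ψ.restrOpen U hUo : E → E) = f := hΨf
  have hsrc : ∀ {y}, y ∈ (Ψ.restrOpen U hUo).source → y ∈ U := fun hy => hy.2
  refine ⟨Ψ.restrOpen U hUo, ⟨hf0s.mem_toOpenPartialHomeomorph_source hf0d (by simp), hU0⟩, ?_,
    ?_, ?_, ?_, ?_, ?_⟩
  · rw [hΦf, hf0]
  · rw [hΦf]
    exact fun y hy => (hU y (hsrc hy)).1.contDiffWithinAt
  · intro z hz
    have hy := (Ψ.restrOpen U hUo).map_target hz
    obtain ⟨A, hA⟩ := (hU _ (hsrc hy)).2.2.2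
    have hs := (hU _ (hsrc hy)).1
    refine ((Ψ.restrOpen U hUo).contDiffAt_symm (f₀' := A) hz ?_ ?_).contDiffWithinAt
    · rw [hA, hΦf]; exact (hs.differentiableAt (by simp)).hasFDerivAt
    · rw [hΦf]; exact hs
  · rw [hΦf]
    exact fun y hy => (hU y (hsrc hy)).2.1
  · rw [hΦf]
    exact fun y hy => (hU y (hsrc hy)).2.2.1
  · rw [hΦf, hkey]

/-- A smooth function has, near a given point, a smooth primitive along a direction `v`; here `ℓ` is
a linear coordinate with `ℓ v = 1`. -/
theorem exists_smooth_primitive {E : Type} [NormedAddCommGroup E] [NormedSpace ℝ E]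
    [FiniteDimensional ℝ E] {f : E → ℝ} {x₀ : E} (hf : ∀ᶠ y in 𝓝 x₀, ContDiffAt ℝ ∞ f y)
    {ℓ : E →L[ℝ] ℝ} {v : E} (hℓ : ℓ v = 1) :
    ∃ g : E → ℝ, ContDiff ℝ ∞ g ∧ ∀ᶠ y in 𝓝 x₀, fderiv ℝ g y v = f y := by
  obtain ⟨F, hF, hFc, hFf⟩ := exists_compactSupport_extension hf
  let c : C(unitInterval, E) := ⟨fun t => ((t : ℝ) - 1) • v, by fun_prop⟩
  let Γ : E → C(unitInterval, E) := fun y => ContinuousMap.const _ y + ℓ y • c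
  have hΓ : ContDiff ℝ ∞ Γ :=
    (ContinuousLinearMap.const ℝ unitInterval (M := E)).contDiff.add
      (ℓ.contDiff.smul contDiff_const)
  let g : E → ℝ := fun y => ℓ y *
    primitive ℝ ((⟨F, hF.continuous⟩ : C(E, ℝ)).comp (Γ y)) 1
  have hg : ContDiff ℝ ∞ g := by
    refine ℓ.contDiff.mul ?_
    exact ((ContinuousMap.evalCLM ℝ (1 : unitInterval)).comp (primitive ℝ)).contDiff.comp
      ((contDiff_comp_left hF hFc).comp hΓ)
  -- substituting in the integral, `g` is the integral of `F` along the line through `y`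
  have hline : ∀ y, g y = ∫ r in (0 : ℝ)..ℓ y, F (y - ℓ y • v + r • v) := by
    intro y
    have h1 := intervalIntegral.smul_integral_comp_mul_left (a := 0) (b := 1)
      (fun r => F (y - ℓ y • v + r • v)) (ℓ y)
    rw [mul_zero, mul_one, smul_eq_mul] at h1
    simp only [g, primitive_apply]
    rw [← h1]
    congr 1
    refine intervalIntegral.integral_congr fun t ht => ?_
    change t ∈ uIcc (0 : ℝ) 1 at ht
    rw [uIcc_of_le zero_le_one] at ht
    simp only [Γ, c, ContinuousMap.comp_apply, ContinuousMap.coe_mk, ContinuousMap.add_apply,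
      ContinuousMap.const_apply, ContinuousMap.smul_apply, projIcc_of_mem zero_le_one ht]
    congr 1
    module
  refine ⟨g, hg, hFf.mono fun y hy => ?_⟩
  have h1 : HasDerivAt (fun τ : ℝ => g (y + τ • v)) (fderiv ℝ g y v) 0 := by
    have h2 : HasDerivAt (fun τ : ℝ => y + τ • v) v 0 := by
      simpa using ((hasDerivAt_id (0 : ℝ)).smul_const v).const_add y
    have h3 : HasFDerivAt g (fderiv ℝ g y) (y + (0 : ℝ) • v) := by
      simpa using (hg.differentiable (by simp) y).hasFDerivAt
    exact h3.comp_hasDerivAt (0 : ℝ) h2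
  have h4 : HasDerivAt (fun τ : ℝ => g (y + τ • v)) (F y) 0 := by
    have h5 : (fun τ : ℝ => g (y + τ • v)) =
        fun τ => ∫ r in (0 : ℝ)..(ℓ y + τ), F (y - ℓ y • v + r • v) := by
      ext τ
      rw [hline, map_add, map_smul, hℓ, smul_eq_mul, mul_one]
      congr 1
      ext r
      congr 1
      module
    rw [h5]
    have hc : Continuous fun r : ℝ => F (y - ℓ y • v + r • v) :=
      hF.continuous.comp (by fun_prop)
    have h6 := intervalIntegral.integral_hasDerivAt_right (hc.intervalIntegrable 0 (ℓ y + 0))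
      hc.aestronglyMeasurable.stronglyMeasurableAtFilter hc.continuousAt
    have h7 : HasDerivAt (fun τ : ℝ => ℓ y + τ) 1 0 := (hasDerivAt_id (0 : ℝ)).const_add _
    have h8 := HasDerivAt.scomp (0 : ℝ) h6 h7
    simpa [Function.comp_def] using h8
  rw [h1.unique h4, hy]

/-- A differentiable function on a convex set whose derivative along the difference of two points
vanishes takes the same value at these points. -/
lemma eq_of_fderiv_sub_eq_zero {E F : Type*} [NormedAddCommGroup E] [NormedSpace ℝ E]
    [NormedAddCommGroup F] [NormedSpace ℝ F] {s : Set E} (hs : Convex ℝ s) {f : E → F}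
    (hf : ∀ z ∈ s, DifferentiableAt ℝ f z) {x y : E} (hx : x ∈ s) (hy : y ∈ s)
    (h : ∀ z ∈ s, fderiv ℝ f z (y - x) = 0) : f x = f y := by
  have hmem : ∀ t ∈ Icc (0 : ℝ) 1, x + t • (y - x) ∈ s := fun t ht =>
    hs.add_smul_sub_mem hx hy ht
  have hd : ∀ t ∈ Icc (0 : ℝ) 1, HasDerivAt (fun t : ℝ => f (x + t • (y - x))) 0 t := by
    intro t ht
    have h2 : HasDerivAt (fun t : ℝ => x + t • (y - x)) (y - x) t := by
      simpa using ((hasDerivAt_id t).smul_const (y - x)).const_add x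
    have h3 := (hf _ (hmem t ht)).hasFDerivAt.comp_hasDerivAt t h2
    rw [h _ (hmem t ht)] at h3
    exact h3
  have := constant_of_derivWithin_zero (f := fun t : ℝ => f (x + t • (y - x))) (a := 0) (b := 1)
    (fun t ht => (hd t ht).differentiableAt.differentiableWithinAt)
    (fun t ht => (hd t (Ico_subset_Icc_self ht)).hasDerivWithinAt.derivWithin
      (uniqueDiffOn_Icc zero_lt_one t (Ico_subset_Icc_self ht)))
  have h1 := this 1 (right_mem_Icc.2 zero_le_one)
  simpa using h1.symm

end FlowBox

/-! ### Boxes and straightening in `ℝ⁴` -/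

@[simp] lemma stdVec_apply (a i : Fin 4) : stdVec a i = if i = a then 1 else 0 := by
  simp [stdVec]

lemma eq_sum_stdVec (v : E4) : v = ∑ i, v i • stdVec i := by
  ext j
  simp

/-- The open box with opposite corners `a` and `b`. -/
def box (a b : Fin 4 → ℝ) : Set E4 := {v : E4 | ∀ i, a i < v i ∧ v i < b i}

lemma isOpen_box (a b : Fin 4 → ℝ) : IsOpen (box a b) := by
  have : box a b = ⋂ i, (fun v : E4 => v i) ⁻¹' Ioo (a i) (b i) := by
    ext v; simp [box]
  rw [this]
  exact isOpen_iInter_of_finite fun i => isOpen_Ioo.preimage (by fun_prop)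

lemma convex_box (a b : Fin 4 → ℝ) : Convex ℝ (box a b) := by
  have : box a b = ⋂ i, (EuclideanSpace.proj (𝕜 := ℝ) i : E4 →L[ℝ] ℝ) ⁻¹' Ioo (a i) (b i) := by
    ext v; simp [box]
  rw [this]
  exact convex_iInter fun i => (convex_Ioo _ _).linear_preimage _

lemma exists_box_subset {s : Set E4} {y : E4} (hs : s ∈ 𝓝 y) :
    ∃ ε : ℝ, 0 < ε ∧ box (fun i => y i - ε) (fun i => y i + ε) ⊆ s := by
  have h1 : Tendsto (WithLp.toLp 2 : (Fin 4 → ℝ) → E4) (𝓝 (WithLp.ofLp y)) (𝓝 y) :=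
    (PiLp.continuous_toLp 2 _).tendsto' _ _ rfl
  obtain ⟨ε, hε, hb⟩ := Metric.mem_nhds_iff.1 (h1 hs)
  refine ⟨ε, hε, fun v hv => ?_⟩
  have : WithLp.ofLp v ∈ Metric.ball (WithLp.ofLp y) ε := by
    rw [Metric.mem_ball, dist_pi_lt_iff hε]
    intro i
    rw [Real.dist_eq, abs_lt]
    have := hv i
    constructor <;> linarith
  exact hb this

section Diffeo

variable {E : Type*} [NormedAddCommGroup E] [NormedSpace ℝ E]

/-- A local diffeomorphism of class `C^∞` of a normed space. -/
structure IsSmoothEquiv (Φ : OpenPartialHomeomorph E E) : Prop where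
  contDiffOn : ContDiffOn ℝ ∞ Φ Φ.source
  contDiffOn_symm : ContDiffOn ℝ ∞ Φ.symm Φ.target

namespace IsSmoothEquiv

variable {Φ : OpenPartialHomeomorph E E}

lemma symm (h : IsSmoothEquiv Φ) : IsSmoothEquiv Φ.symm := ⟨h.contDiffOn_symm, h.contDiffOn⟩

lemma contDiffAt (h : IsSmoothEquiv Φ) {x : E} (hx : x ∈ Φ.source) : ContDiffAt ℝ ∞ Φ x :=
  h.contDiffOn.contDiffAt (Φ.open_source.mem_nhds hx)

lemma fderiv_symm_comp (h : IsSmoothEquiv Φ) {x : E} (hx : x ∈ Φ.source) :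
    (fderiv ℝ Φ.symm (Φ x)) ∘L (fderiv ℝ Φ x) = .id ℝ E := by
  have h1 := ((h.contDiffAt hx).differentiableAt (by simp)).hasFDerivAt
  have h2 := ((h.symm.contDiffAt (Φ.map_source hx)).differentiableAt (by simp)).hasFDerivAt
  refine (h2.comp x h1).unique ((hasFDerivAt_id x).congr_of_eventuallyEq ?_)
  filter_upwards [Φ.open_source.mem_nhds hx] with z hz
  exact Φ.left_inv hz

lemma fderiv_comp_symm (h : IsSmoothEquiv Φ) {x : E} (hx : x ∈ Φ.target) :
    (fderiv ℝ Φ (Φ.symm x)) ∘L (fderiv ℝ Φ.symm x) = .id ℝ E :=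
  h.symm.fderiv_symm_comp hx

lemma restrOpen (h : IsSmoothEquiv Φ) {s : Set E} (hs : IsOpen s) :
    IsSmoothEquiv (Φ.restrOpen s hs) :=
  ⟨h.contDiffOn.mono inter_subset_left, h.contDiffOn_symm.mono (fun x hx => by
    have := (Φ.restrOpen s hs).map_target hx
    rw [← (Φ.restrOpen s hs).right_inv hx]
    exact Φ.map_source this.1)⟩

end IsSmoothEquiv

end Diffeo

/-- The flow box theorem in the form used for charts: the inverse of a flow box map sends `X` to the
constant field `e₀`. -/
lemma exists_straightening {X : E4 → E4} (hX : ∀ᶠ y in 𝓝 0, ContDiffAt ℝ ∞ X y)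
    (hX0 : X 0 = stdVec 0) :
    ∃ Ψ : OpenPartialHomeomorph E4 E4, IsSmoothEquiv Ψ ∧ (0 : E4) ∈ Ψ.source ∧ Ψ 0 = 0 ∧
      (∀ y ∈ Ψ.source, fderiv ℝ Ψ y (X y) = stdVec 0) ∧ fderiv ℝ Ψ 0 = .id ℝ E4 := by
  obtain ⟨Φ, h0, h00, hs, hs', hv, -, hd⟩ := exists_flowBox hX
    (ℓ := stdCovec 0) (by simp [hX0, stdCovec]) (π := .id ℝ E4) (fun _ => rfl) rfl
  have hΦ : IsSmoothEquiv Φ := ⟨hs, hs'⟩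
  refine ⟨Φ.symm, hΦ.symm, ?_, ?_, ?_, ?_⟩
  · have := Φ.map_source h0; rwa [h00] at this
  · have := Φ.left_inv h0; rwa [h00] at this
  · intro y hy
    have h1 := hv _ (Φ.map_target hy)
    rw [Φ.right_inv hy, hX0] at h1
    have h2 := congrArg (fun A => A (stdVec 0)) (hΦ.fderiv_symm_comp (Φ.map_target hy))
    simpa [h1, Φ.right_inv hy] using h2
  · have := hΦ.fderiv_symm_comp h0
    rw [hd, h00] at this
    simpa using this

/-- The projection of `ℝ⁴` along `e₀`. -/
def dropZero : E4 →L[ℝ] E4 := .id ℝ E4 - (stdCovec 0).smulRight (stdVec 0)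

lemma dropZero_apply (y : E4) : dropZero y = y - y 0 • stdVec 0 := rfl

/-- Frobenius theorem for a plane field on `ℝ⁴` containing the direction `e₀`: if `∂₀ S` is a
section of the span of `e₀` and `S`, the plane field is straightened by a local diffeomorphism.
Normalising `S` to have components `(0, 1)` along `(e₀, e₁)` makes it independent of the coordinate
`y⁰`, and a flow box for the normalised field that respects the direction `e₀` straightens both. -/
theorem exists_straightening_plane {S : E4 → E4} (hS : ∀ᶠ y in 𝓝 0, ContDiffAt ℝ ∞ S y)
    (hS0 : S 0 = stdVec 1)
    (hinv : ∀ᶠ y in 𝓝 0, fderiv ℝ S y (stdVec 0) ∈ Submodule.span ℝ {stdVec 0, S y}) :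
    ∃ Ψ : OpenPartialHomeomorph E4 E4, IsSmoothEquiv Ψ ∧ (0 : E4) ∈ Ψ.source ∧ Ψ 0 = 0 ∧
      ∀ y ∈ Ψ.source, ∀ u, u ∈ Submodule.span ℝ {stdVec 0, S y} ↔
        fderiv ℝ Ψ y u 2 = 0 ∧ fderiv ℝ Ψ y u 3 = 0 := by
  set W : E4 → E4 := fun y => (S y 1)⁻¹ • (S y - S y 0 • stdVec 0) with hW
  have hS1 : ∀ᶠ y in 𝓝 0, S y 1 ≠ 0 := by
    have : ContinuousAt (fun y => S y 1) 0 :=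
      (EuclideanSpace.proj (𝕜 := ℝ) (1 : Fin 4)).continuous.continuousAt.comp
        hS.self_of_nhds.continuousAt
    exact this.eventually_ne (by simp [hS0])
  have hcoord : ∀ᶠ y in 𝓝 0, ∀ i, ContDiffAt ℝ ∞ (fun y => S y i) y := by
    filter_upwards [hS] with y hy i
    exact (EuclideanSpace.proj (𝕜 := ℝ) i : E4 →L[ℝ] ℝ).contDiff.contDiffAt.comp y hy
  have hWs : ∀ᶠ y in 𝓝 0, ContDiffAt ℝ ∞ W y := by
    filter_upwards [hS, hS1, hcoord] with y hy h1 hc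
    exact ((hc 1).inv h1).smul (hy.sub ((hc 0).smul contDiffAt_const))
  have hW0 : W 0 = stdVec 1 := by simp [hW, hS0]
  have hSW : ∀ y, S y 1 ≠ 0 → S y = S y 0 • stdVec 0 + S y 1 • W y := by
    intro y hy
    simp [hW, smul_smul, mul_inv_cancel₀ hy]
  have hdW : ∀ᶠ y in 𝓝 0, fderiv ℝ W y (stdVec 0) = 0 := by
    filter_upwards [hS, hS1, hcoord, hinv, hWs] with y hy h1 hc hi hws
    obtain ⟨a, b, hab⟩ := Submodule.mem_span_pair.1 hi
    have hSi : ∀ i, HasFDerivAt (fun y => S y i)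
        ((EuclideanSpace.proj (𝕜 := ℝ) i : E4 →L[ℝ] ℝ) ∘L fderiv ℝ S y) y := fun i =>
      (EuclideanSpace.proj (𝕜 := ℝ) i : E4 →L[ℝ] ℝ).hasFDerivAt.comp y
        (hy.differentiableAt (by simp)).hasFDerivAt
    have hinv1 : HasFDerivAt (fun y => (S y 1)⁻¹)
        (-((S y 1) ^ 2)⁻¹ • ((EuclideanSpace.proj (𝕜 := ℝ) 1 : E4 →L[ℝ] ℝ) ∘L fderiv ℝ S y)) y :=
      (hasDerivAt_inv h1).comp_hasFDerivAt y (hSi 1)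
    have h2 : HasFDerivAt W _ y := hinv1.smul ((hy.differentiableAt (by simp)).hasFDerivAt.sub
      ((hSi 0).smul_const (stdVec 0)))
    rw [h2.fderiv]
    ext i
    simp only [add_apply, smul_apply,
      sub_apply, ContinuousLinearMap.smulRight_apply,
      ContinuousLinearMap.comp_apply, ← hab]
    -- `∂₀ W` is a combination of `e₀` and `W` whose components `0` and `1` vanish
    fin_cases i <;> simp <;> field_simp <;> ring
  obtain ⟨ε, hε, hbox⟩ := exists_box_subset (hdW.and (hWs.and hS1))
  set B := box (fun i => (0 : E4) i - ε) (fun i => (0 : E4) i + ε) with hB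
  have hBmem : ∀ {y}, y ∈ B ↔ ∀ i, -ε < y i ∧ y i < ε := by intro y; simp [hB, box]
  have hWinv : ∀ y ∈ B, W (dropZero y) = W y := by
    intro y hy
    have hy' : dropZero y ∈ B := by
      rw [hBmem] at hy ⊢
      intro i
      by_cases hi : i = 0
      · simp [dropZero_apply, hi, hε]
      · simpa [dropZero_apply, hi] using hy i
    refine eq_of_fderiv_sub_eq_zero (convex_box _ _)
      (fun z hz => (hbox hz).2.1.differentiableAt (by simp)) hy' hy fun z hz => ?_
    have : y - dropZero y = y 0 • stdVec 0 := by simp [dropZero_apply]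
    rw [this, map_smul, (hbox hz).1, smul_zero]
  obtain ⟨Φ, h0, h00, hs, hs', hv, hk, -⟩ := exists_flowBox hWs
    (ℓ := stdCovec 1) (by simp [hW0, stdCovec]) (π := dropZero)
    (fun y => by simp [dropZero_apply]) (by simp [hW0, dropZero_apply])
  have hΦ : IsSmoothEquiv Φ := ⟨hs, hs'⟩
  have h0t : (0 : E4) ∈ Φ.target := by have := Φ.map_source h0; rwa [h00] at this
  refine ⟨Φ.symm.restrOpen B (isOpen_box _ _), hΦ.symm.restrOpen _, ⟨h0t, ?_⟩, ?_, ?_⟩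
  · exact hBmem.2 fun i => by simp [hε]
  · change Φ.symm 0 = 0
    have := Φ.left_inv h0; rwa [h00] at this
  · rintro y ⟨hyt, hyB⟩ u
    change u ∈ Submodule.span ℝ {stdVec 0, S y} ↔
      fderiv ℝ Φ.symm y u 2 = 0 ∧ fderiv ℝ Φ.symm y u 3 = 0
    have hz := Φ.map_target hyt
    have h1 := hv _ hz
    rw [Φ.right_inv hyt, hW0, hWinv y hyB] at h1
    have h2 := hk _ hz (stdVec 0) (by simp [dropZero_apply]) (by simp [stdCovec])
    have hinvl : ∀ w, fderiv ℝ Φ.symm y (fderiv ℝ Φ (Φ.symm y) w) = w := fun w => by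
      have := congrArg (fun A => A w) (hΦ.fderiv_symm_comp hz)
      simpa [Φ.right_inv hyt] using this
    have hinvr : ∀ w, fderiv ℝ Φ (Φ.symm y) (fderiv ℝ Φ.symm y w) = w := fun w =>
      congrArg (fun A => A w) (hΦ.fderiv_comp_symm hyt)
    have h1' : fderiv ℝ Φ.symm y (W y) = stdVec 1 := by rw [← h1, hinvl]
    have h2' : fderiv ℝ Φ.symm y (stdVec 0) = stdVec 0 := by
      conv_lhs => rw [← h2]
      rw [hinvl]
    have hSy := hSW y (hbox hyB).2.2
    rw [Submodule.mem_span_pair]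
    constructor
    · rintro ⟨a, b, rfl⟩
      rw [hSy]
      simp [h1', h2']
    · rintro ⟨hu2, hu3⟩
      set w := fderiv ℝ Φ.symm y u with hw
      have hwe : w = w 0 • stdVec 0 + w 1 • stdVec 1 := by
        ext i
        fin_cases i <;> simp [hu2, hu3]
      have hu : u = w 0 • stdVec 0 + w 1 • W y := by
        rw [← hinvr u, ← hw]
        conv_lhs => rw [hwe]
        rw [map_add, map_smul, map_smul, h1, h2]
      refine ⟨w 0 - w 1 * (S y 1)⁻¹ * S y 0, w 1 * (S y 1)⁻¹, ?_⟩
      rw [hu]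
      simp only [hW]
      module

/-! ### Vector fields, functions and forms in a chart -/

section Charts

variable {M : Type*} [TopologicalSpace M] [ChartedSpace E4 M]

/-- The differential of the inverse of a chart. -/
def symmDiff (c : OpenPartialHomeomorph M E4) (y : E4) : E4 →L[ℝ] TangentSpace (𝓡 4) (c.symm y) :=
  mfderiv 𝓘(ℝ, E4) (𝓡 4) c.symm y

/-- The representative of a vector field in a chart. -/
def fieldIn (c : OpenPartialHomeomorph M E4) (X : VField M) (y : E4) : E4 :=
  chartDiff c (c.symm y) (X (c.symm y))

/-- The representative of a differential form in a chart. -/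
def formIn {k : ℕ} (c : OpenPartialHomeomorph M E4) (η : DForm M k) (y : E4) :
    E4 [⋀^Fin k]→L[ℝ] ℝ :=
  (η (c.symm y)).compContinuousLinearMap (symmDiff c y)

variable {c : OpenPartialHomeomorph M E4}

lemma chart_mdifferentiable (hc : c ∈ IsManifold.maximalAtlas (𝓡 4) ∞ M) :
    c.MDifferentiable (𝓡 4) (𝓡 4) :=
  ⟨(contMDiffOn_of_mem_maximalAtlas hc).mdifferentiableOn (by simp),
    (contMDiffOn_symm_of_mem_maximalAtlas hc).mdifferentiableOn (by simp)⟩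

lemma chartDiff_symmDiff (hc : c ∈ IsManifold.maximalAtlas (𝓡 4) ∞ M) {y : E4}
    (hy : y ∈ c.target) (v : E4) : chartDiff c (c.symm y) (symmDiff c y v) = v :=
  congrArg (fun A => A v) ((chart_mdifferentiable hc).comp_symm_deriv hy)

lemma symmDiff_chartDiff (hc : c ∈ IsManifold.maximalAtlas (𝓡 4) ∞ M) {y : E4}
    (hy : y ∈ c.target) (v : TangentSpace (𝓡 4) (c.symm y)) :
    symmDiff c y (chartDiff c (c.symm y) v) = v := by
  have h := (chart_mdifferentiable hc).symm_comp_deriv (c.map_target hy)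
  rw [c.right_inv hy] at h
  exact congrArg (fun A => A v) h

lemma symmDiff_fieldIn (hc : c ∈ IsManifold.maximalAtlas (𝓡 4) ∞ M) (X : VField M) {y : E4}
    (hy : y ∈ c.target) : symmDiff c y (fieldIn c X y) = X (c.symm y) :=
  symmDiff_chartDiff hc hy _

lemma isInvertible_chartDiff (hc : c ∈ IsManifold.maximalAtlas (𝓡 4) ∞ M) {x : M}
    (hx : x ∈ c.source) : (chartDiff c x).IsInvertible :=
  ⟨(chart_mdifferentiable hc).mfderiv hx, rfl⟩

lemma isInvertible_symmDiff (hc : c ∈ IsManifold.maximalAtlas (𝓡 4) ∞ M) {y : E4}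
    (hy : y ∈ c.target) : (symmDiff c y).IsInvertible :=
  ⟨(chart_mdifferentiable hc).symm.mfderiv hy, rfl⟩

lemma inverse_symmDiff (hc : c ∈ IsManifold.maximalAtlas (𝓡 4) ∞ M) {y : E4}
    (hy : y ∈ c.target) (v : TangentSpace (𝓡 4) (c.symm y)) :
    (symmDiff c y).inverse v = chartDiff c (c.symm y) v := by
  conv_lhs => rw [← symmDiff_chartDiff hc hy v]
  exact (isInvertible_symmDiff hc hy).inverse_apply_self _

lemma fieldIn_apply_of_mem (X : VField M) {x : M} (hx : x ∈ c.source) :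
    fieldIn c X (c x) = chartDiff c x (X x) := by
  unfold fieldIn
  rw [c.left_inv hx]

lemma fieldIn_eventuallyEq_mpullback (hc : c ∈ IsManifold.maximalAtlas (𝓡 4) ∞ M) (X : VField M)
    {y : E4} (hy : y ∈ c.target) :
    fieldIn c X =ᶠ[𝓝 y] VectorField.mpullback 𝓘(ℝ, E4) (𝓡 4) c.symm X := by
  filter_upwards [c.open_target.mem_nhds hy] with z hz
  exact (inverse_symmDiff hc hz _).symm

lemma contDiffAt_comp_symm (hc : c ∈ IsManifold.maximalAtlas (𝓡 4) ∞ M) {f : M → ℝ} {y : E4}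
    (hy : y ∈ c.target) (hf : ContMDiffAt (𝓡 4) 𝓘(ℝ, ℝ) ∞ f (c.symm y)) :
    ContDiffAt ℝ ∞ (fun z => f (c.symm z)) y :=
  (hf.comp y (contMDiffAt_symm_of_mem_maximalAtlas hc hy)).contDiffAt

lemma dirDeriv_eq_fderiv (hc : c ∈ IsManifold.maximalAtlas (𝓡 4) ∞ M) (X : VField M) {f : M → ℝ}
    {y : E4} (hy : y ∈ c.target) (hf : MDifferentiableAt (𝓡 4) 𝓘(ℝ, ℝ) f (c.symm y)) :
    dirDeriv X f (c.symm y) = fderiv ℝ (fun z => f (c.symm z)) y (fieldIn c X y) := by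
  have h1 := (chart_mdifferentiable hc).mdifferentiableAt_symm hy
  have h2 := mfderiv_comp y hf h1
  have h3 : mfderiv 𝓘(ℝ, E4) 𝓘(ℝ, ℝ) (fun z => f (c.symm z)) y =
    (mfderiv (𝓡 4) 𝓘(ℝ, ℝ) f (c.symm y)).comp (symmDiff c y) := h2
  rw [← mfderiv_eq_fderiv, h3]
  exact (congrArg (mfderiv (𝓡 4) 𝓘(ℝ, ℝ) f (c.symm y)) (symmDiff_fieldIn hc X hy)).symm

variable [IsManifold (𝓡 4) ∞ M]

lemma contDiffAt_fieldIn (hc : c ∈ IsManifold.maximalAtlas (𝓡 4) ∞ M) {X : VField M} {y : E4}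
    (hy : y ∈ c.target) (hX : SmoothAt X (c.symm y)) : ContDiffAt ℝ ∞ (fieldIn c X) y := by
  have h := ContMDiffAt.mpullback_vectorField_preimage (I := 𝓘(ℝ, E4)) (I' := 𝓡 4) (n := ∞)
    (m := ∞) (f := c.symm) (V := X) (x₀ := y) hX
    (contMDiffAt_symm_of_mem_maximalAtlas hc hy) (isInvertible_symmDiff hc hy) (by simp)
  exact (contMDiffAt_vectorSpace_iff_contDiffAt.1 h).congr_of_eventuallyEq
    (fieldIn_eventuallyEq_mpullback hc X hy)

lemma SmoothAt.mdifferentiableAt {X : VField M} {x : M} (hX : SmoothAt X x) :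
    MDifferentiableAt (𝓡 4) (𝓡 4).tangent (fun x => (⟨x, X x⟩ : TangentBundle (𝓡 4) M)) x :=
  ContMDiffAt.mdifferentiableAt hX (by simp)

lemma chartDiff_bracket (hc : c ∈ IsManifold.maximalAtlas (𝓡 4) ∞ M) {X Y : VField M} {y : E4}
    (hy : y ∈ c.target) (hX : SmoothAt X (c.symm y)) (hY : SmoothAt Y (c.symm y)) :
    chartDiff c (c.symm y) (bracket X Y (c.symm y)) =
      VectorField.lieBracket ℝ (fieldIn c X) (fieldIn c Y) y := by
  have h2 : minSmoothness ℝ 2 ≤ ∞ := by simpa using ENat.LEInfty.out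
  have h3 : minSmoothness ℝ 3 ≤ ∞ := by simpa using ENat.LEInfty.out
  have : IsManifold (𝓡 4) (minSmoothness ℝ 3) M := IsManifold.of_le h3
  have h := VectorField.mpullback_mlieBracket (I := 𝓘(ℝ, E4)) (I' := 𝓡 4) (f := c.symm)
    (V := X) (W := Y) (x₀ := y) (n := ∞) hX.mdifferentiableAt hY.mdifferentiableAt
    (contMDiffAt_symm_of_mem_maximalAtlas hc hy) h2
  rw [← inverse_symmDiff hc hy]
  refine h.trans ?_
  refine Eq.trans ?_ (Filter.EventuallyEq.lieBracket_vectorField_eq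
    (fieldIn_eventuallyEq_mpullback hc X hy) (fieldIn_eventuallyEq_mpullback hc Y hy)).symm
  have h4 := congrFun (VectorField.mlieBracketWithin_eq_lieBracketWithin (s := univ)
    (V := VectorField.mpullback 𝓘(ℝ, E4) (𝓡 4) c.symm X)
    (W := VectorField.mpullback 𝓘(ℝ, E4) (𝓡 4) c.symm Y)) y
  exact h4.trans (congrFun VectorField.lieBracketWithin_univ y)

end Charts

/-! ### The exterior product and smoothness of 2-forms -/

lemma wedge_apply {V : Type*} [AddCommGroup V] [Module ℝ V] [TopologicalSpace V]
    (β γ : V →L[ℝ] ℝ) (v w : V) : wedge β γ ![v, w] = β v * γ w - β w * γ v := rfl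

lemma twoForm_ext {V : Type*} [AddCommGroup V] [Module ℝ V] [TopologicalSpace V]
    {η θ : V [⋀^Fin 2]→L[ℝ] ℝ} (h : ∀ v w, η ![v, w] = θ ![v, w]) : η = θ := by
  ext v
  have : v = ![v 0, v 1] := by ext i; fin_cases i <;> rfl
  rw [this]
  exact h _ _

section TwoForm

variable {V : Type*} [AddCommGroup V] [Module ℝ V] [TopologicalSpace V]
  (η : V [⋀^Fin 2]→L[ℝ] ℝ)

lemma twoForm_add_left (u v w : V) : η ![u + v, w] = η ![u, w] + η ![v, w] := by
  have h : ∀ z, Function.update ![u, w] 0 z = ![z, w] := by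
    intro z; ext1 i; fin_cases i <;> rfl
  have := η.map_update_add ![u, w] 0 u v
  rwa [h, h, h] at this

lemma twoForm_smul_left (c : ℝ) (v w : V) : η ![c • v, w] = c * η ![v, w] := by
  have h : ∀ z, Function.update ![v, w] 0 z = ![z, w] := by
    intro z; ext1 i; fin_cases i <;> rfl
  have := η.map_update_smul ![v, w] 0 c v
  rwa [h, h] at this

lemma twoForm_swap (v w : V) : η ![v, w] = -η ![w, v] := by
  have h := η.map_swap ![w, v] (i := 0) (j := 1) (by simp)
  have h2 : ![w, v] ∘ Equiv.swap (0 : Fin 2) 1 = ![v, w] := by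
    ext1 i; fin_cases i <;> rfl
  rw [h2] at h
  exact h

lemma twoForm_self (v : V) : η ![v, v] = 0 := by
  have := twoForm_swap η v v
  linarith

/-- Evaluation of a 2-form as a bilinear form. -/
def twoFormBilin : V →ₗ[ℝ] V →ₗ[ℝ] ℝ :=
  LinearMap.mk₂ ℝ (fun v w => η ![v, w]) (twoForm_add_left η) (twoForm_smul_left η)
    (fun v w w' => by
      rw [twoForm_swap η v, twoForm_add_left, twoForm_swap η w, twoForm_swap η w']; ring)
    (fun c v w => by
      rw [twoForm_swap η v, twoForm_smul_left, twoForm_swap η w, smul_eq_mul]; ring)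

lemma twoFormBilin_apply (v w : V) : twoFormBilin η v w = η ![v, w] := rfl

end TwoForm

lemma twoForm_eq_sum (η : E4 [⋀^Fin 2]→L[ℝ] ℝ) (v w : E4) :
    η ![v, w] = ∑ a, ∑ b, v a * w b * η ![stdVec a, stdVec b] := by
  conv_lhs => rw [← twoFormBilin_apply, eq_sum_stdVec v, eq_sum_stdVec w]
  simp only [map_sum, map_smul, LinearMap.sum_apply, LinearMap.smul_apply, smul_eq_mul,
    twoFormBilin_apply, Finset.mul_sum]
  rw [Finset.sum_comm]
  exact Finset.sum_congr rfl fun a _ => Finset.sum_congr rfl fun b _ => by ring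

lemma twoForm_eq_sum_wedge (η : E4 [⋀^Fin 2]→L[ℝ] ℝ) :
    η = ∑ a, ∑ b, η ![stdVec a, stdVec b] • ((1 / 2 : ℝ) • wedge (stdCovec a) (stdCovec b)) := by
  refine twoForm_ext fun v w => ?_
  simp only [ContinuousAlternatingMap.sum_apply, ContinuousAlternatingMap.smul_apply, wedge_apply,
    smul_eq_mul]
  have h1 := twoForm_eq_sum η v w
  have h2 : η ![v, w] = -∑ a, ∑ b, w a * v b * η ![stdVec a, stdVec b] := by
    rw [← twoForm_eq_sum η w v, twoForm_swap]
  have h3 : η ![v, w] = (1 / 2) * (η ![v, w] + η ![v, w]) := by ring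
  rw [h3]
  nth_rewrite 1 [h1]
  rw [h2, ← sub_eq_add_neg, ← Finset.sum_sub_distrib, Finset.mul_sum]
  refine Finset.sum_congr rfl fun a _ => ?_
  rw [← Finset.sum_sub_distrib, Finset.mul_sum]
  refine Finset.sum_congr rfl fun b _ => ?_
  simp [stdCovec]
  ring

/-- A field of 2-forms is smooth as soon as its components are. -/
lemma contDiffAt_twoForm {E : Type*} [NormedAddCommGroup E] [NormedSpace ℝ E] {n : WithTop ℕ∞}
    {F : E → E4 [⋀^Fin 2]→L[ℝ] ℝ} {y : E}
    (h : ∀ a b, ContDiffAt ℝ n (fun z => F z ![stdVec a, stdVec b]) y) : ContDiffAt ℝ n F y := by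
  have : F = fun z => ∑ a, ∑ b, F z ![stdVec a, stdVec b] •
      ((1 / 2 : ℝ) • wedge (stdCovec a) (stdCovec b)) := by
    ext1 z; exact twoForm_eq_sum_wedge (F z)
  rw [this]
  exact ContDiffAt.sum fun a _ => ContDiffAt.sum fun b _ => (h a b).smul contDiffAt_const

lemma contDiffAt_twoForm_apply_const {E : Type*} [NormedAddCommGroup E] [NormedSpace ℝ E]
    {n : WithTop ℕ∞} {F : E → E4 [⋀^Fin 2]→L[ℝ] ℝ} {y : E} (h : ContDiffAt ℝ n F y)
    (v : Fin 2 → E4) : ContDiffAt ℝ n (fun z => F z v) y :=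
  (ContinuousAlternatingMap.apply ℝ E4 ℝ v).contDiff.contDiffAt.comp y h

lemma contDiffAt_twoForm_apply {E : Type*} [NormedAddCommGroup E] [NormedSpace ℝ E]
    {n : WithTop ℕ∞} {F : E → E4 [⋀^Fin 2]→L[ℝ] ℝ} {V W : E → E4} {y : E}
    (h : ContDiffAt ℝ n F y) (hV : ContDiffAt ℝ n V y) (hW : ContDiffAt ℝ n W y) :
    ContDiffAt ℝ n (fun z => F z ![V z, W z]) y := by
  have hc : ∀ {U : E → E4}, ContDiffAt ℝ n U y → ∀ a, ContDiffAt ℝ n (fun z => U z a) y :=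
    fun hU a => (EuclideanSpace.proj (𝕜 := ℝ) a : E4 →L[ℝ] ℝ).contDiff.contDiffAt.comp y hU
  simp only [twoForm_eq_sum _ (V _)]
  exact ContDiffAt.sum fun a _ => ContDiffAt.sum fun b _ =>
    ((hc hV a).mul (hc hW b)).mul (contDiffAt_twoForm_apply_const h _)

lemma contDiffAt_wedge {E : Type*} [NormedAddCommGroup E] [NormedSpace ℝ E] {n : WithTop ℕ∞}
    {β γ : E → E4 →L[ℝ] ℝ} {y : E} (hβ : ContDiffAt ℝ n β y) (hγ : ContDiffAt ℝ n γ y) :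
    ContDiffAt ℝ n (fun z => wedge (β z) (γ z)) y :=
  contDiffAt_twoForm fun a b => by
    simp only [wedge_apply]
    exact ((hβ.clm_apply contDiffAt_const).mul (hγ.clm_apply contDiffAt_const)).sub
      ((hβ.clm_apply contDiffAt_const).mul (hγ.clm_apply contDiffAt_const))

lemma contDiffAt_twoForm_pullback {E : Type*} [NormedAddCommGroup E] [NormedSpace ℝ E]
    {n : WithTop ℕ∞} {F : E → E4 [⋀^Fin 2]→L[ℝ] ℝ} {A : E → E4 →L[ℝ] E4} {y : E}
    (hF : ContDiffAt ℝ n F y) (hA : ContDiffAt ℝ n A y) :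
    ContDiffAt ℝ n (fun z => (F z).compContinuousLinearMap (A z)) y := by
  refine contDiffAt_twoForm fun a b => ?_
  have : ∀ z, (F z).compContinuousLinearMap (A z) ![stdVec a, stdVec b] =
      F z ![A z (stdVec a), A z (stdVec b)] := by
    intro z
    rw [ContinuousAlternatingMap.compContinuousLinearMap_apply]
    congr 1
    ext1 i; fin_cases i <;> rfl
  simp only [this]
  exact contDiffAt_twoForm_apply hF (hA.clm_apply contDiffAt_const) (hA.clm_apply contDiffAt_const)

/-! ### Change of charts -/

section Charts

variable {M : Type*} [TopologicalSpace M] [ChartedSpace E4 M]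
  {c c' : OpenPartialHomeomorph M E4}

lemma formIn_apply_chartDiff {k : ℕ} (hc : c ∈ IsManifold.maximalAtlas (𝓡 4) ∞ M) (η : DForm M k)
    {x : M} (hx : x ∈ c.source) (u : Fin k → TangentSpace (𝓡 4) x) :
    formIn c η (c x) (fun i => chartDiff c x (u i)) = η x u := by
  have h : ∀ y ∈ c.target, ∀ u : Fin k → TangentSpace (𝓡 4) (c.symm y),
      formIn c η y (fun i => chartDiff c (c.symm y) (u i)) = η (c.symm y) u := by
    intro y hy u
    unfold formIn
    rw [ContinuousAlternatingMap.compContinuousLinearMap_apply]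
    congr 1
    ext1 i
    exact symmDiff_chartDiff hc hy (u i)
  have h1 := h (c x) (c.map_source hx)
  rw [c.left_inv hx] at h1
  exact h1 u

/-- The transition map between two charts. -/
def transition (c c' : OpenPartialHomeomorph M E4) (y : E4) : E4 := c' (c.symm y)

lemma contDiffAt_transition (hc : c ∈ IsManifold.maximalAtlas (𝓡 4) ∞ M)
    (hc' : c' ∈ IsManifold.maximalAtlas (𝓡 4) ∞ M) {y : E4} (hy : y ∈ c.target)
    (hy' : c.symm y ∈ c'.source) : ContDiffAt ℝ ∞ (transition c c') y :=
  ((contMDiffAt_of_mem_maximalAtlas hc' hy').comp y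
    (contMDiffAt_symm_of_mem_maximalAtlas hc hy)).contDiffAt

lemma fderiv_transition (hc : c ∈ IsManifold.maximalAtlas (𝓡 4) ∞ M)
    (hc' : c' ∈ IsManifold.maximalAtlas (𝓡 4) ∞ M) {y : E4} (hy : y ∈ c.target)
    (hy' : c.symm y ∈ c'.source) (v : E4) :
    fderiv ℝ (transition c c') y v = chartDiff c' (c.symm y) (symmDiff c y v) := by
  have h := mfderiv_comp y ((chart_mdifferentiable hc').mdifferentiableAt hy')
    ((chart_mdifferentiable hc).mdifferentiableAt_symm hy)
  have h2 : mfderiv 𝓘(ℝ, E4) 𝓘(ℝ, E4) (transition c c') y =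
    (chartDiff c' (c.symm y)).comp (symmDiff c y) := h
  rw [← mfderiv_eq_fderiv, h2]
  rfl

lemma formIn_eventuallyEq {k : ℕ} (hc : c ∈ IsManifold.maximalAtlas (𝓡 4) ∞ M)
    (hc' : c' ∈ IsManifold.maximalAtlas (𝓡 4) ∞ M) (η : DForm M k) {y : E4} (hy : y ∈ c.target)
    (hy' : c.symm y ∈ c'.source) :
    formIn c η =ᶠ[𝓝 y] fun z => (formIn c' η (transition c c' z)).compContinuousLinearMap
      (fderiv ℝ (transition c c') z) := by
  filter_upwards [(c.isOpen_inter_preimage_symm c'.open_source).mem_nhds ⟨hy, hy'⟩] with z hz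
  ext v
  rw [ContinuousAlternatingMap.compContinuousLinearMap_apply]
  have h : (⇑(fderiv ℝ (transition c c') z) ∘ v) =
      fun i => chartDiff c' (c.symm z) (symmDiff c z (v i)) := by
    ext1 i
    exact fderiv_transition hc hc' hz.1 hz.2 (v i)
  rw [h]
  exact (formIn_apply_chartDiff hc' η hz.2 (fun i => symmDiff c z (v i))).symm

lemma contDiffAt_formIn_of_chart (hc : c ∈ IsManifold.maximalAtlas (𝓡 4) ∞ M)
    (hc' : c' ∈ IsManifold.maximalAtlas (𝓡 4) ∞ M) (η : DForm M 2) {y : E4} (hy : y ∈ c.target)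
    (hy' : c.symm y ∈ c'.source) (h : ContDiffAt ℝ ∞ (formIn c' η) (c' (c.symm y))) :
    ContDiffAt ℝ ∞ (formIn c η) y := by
  refine ContDiffAt.congr_of_eventuallyEq ?_ (formIn_eventuallyEq hc hc' η hy hy')
  have ht := contDiffAt_transition hc hc' hy hy'
  exact contDiffAt_twoForm_pullback (ContDiffAt.comp (g := formIn c' η) y h ht)
    (ht.fderiv_right (by simp))

lemma extDeriv_formIn_of_chart {k : ℕ} (hc : c ∈ IsManifold.maximalAtlas (𝓡 4) ∞ M)
    (hc' : c' ∈ IsManifold.maximalAtlas (𝓡 4) ∞ M) (η : DForm M k) {y : E4} (hy : y ∈ c.target)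
    (hy' : c.symm y ∈ c'.source) (h : ContDiffAt ℝ ∞ (formIn c' η) (c' (c.symm y)))
    (h0 : extDeriv (formIn c' η) (c' (c.symm y)) = 0) : extDeriv (formIn c η) y = 0 := by
  rw [(formIn_eventuallyEq hc hc' η hy hy').extDeriv_eq]
  rw [extDeriv_pullback (f := transition c c') (r := ∞) (h.differentiableAt (by simp))
    (contDiffAt_transition hc hc' hy hy')
    (by simpa using ENat.LEInfty.out)]
  have h1 : extDeriv (formIn c' η) (transition c c' y) = 0 := h0
  rw [h1]
  ext v
  simp

variable [IsManifold (𝓡 4) ∞ M]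

lemma contDiffAt_formIn {η : DForm M 2} {Ω : Set M} (h : SmoothFormOn η Ω)
    (hc : c ∈ IsManifold.maximalAtlas (𝓡 4) ∞ M) {x : M} (hx : x ∈ c.source) (hΩ : x ∈ Ω) :
    ContDiffAt ℝ ∞ (formIn c η) (c x) := by
  refine contDiffAt_formIn_of_chart hc (IsManifold.chart_mem_maximalAtlas x) η (c.map_source hx)
    (c' := chartAt E4 x) ?_ ?_
  · rw [c.left_inv hx]; exact mem_chart_source E4 x
  · rw [c.left_inv hx]; exact h x hΩ

lemma contDiffAt_formInChart (hc : c ∈ IsManifold.maximalAtlas (𝓡 4) ∞ M) {η : DForm M 2} {x : M}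
    (hx : x ∈ c.source) (h : ContDiffAt ℝ ∞ (formIn c η) (c x)) :
    ContDiffAt ℝ ∞ (formInChart x η) (extChartAt (𝓡 4) x x) := by
  have hxs := mem_chart_source E4 x
  refine contDiffAt_formIn_of_chart (IsManifold.chart_mem_maximalAtlas x) hc η
    (c := chartAt E4 x) (mem_chart_target E4 x) ?_ ?_
  · exact ((chartAt E4 x).left_inv hxs).symm ▸ hx
  · exact ((chartAt E4 x).left_inv hxs).symm ▸ h

lemma extD_eq_zero_iff {k : ℕ} (η : DForm M k) (x : M) :
    extD η x = 0 ↔ extDeriv (formIn (chartAt E4 x) η) (chartAt E4 x x) = 0 := by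
  constructor
  · intro h
    ext v
    have h2 := congrArg (fun θ => θ (v : Fin (k + 1) → TangentSpace (𝓡 4) x)) h
    have h3 : (extDeriv (formInChart x η) (extChartAt (𝓡 4) x x))
        (fun i => mfderiv (𝓡 4) 𝓘(ℝ, E4) (extChartAt (𝓡 4) x) x (v i)) = 0 := h2
    rw [mfderiv_extChartAt_self] at h3
    exact h3
  · intro h
    unfold extD
    have h1 : extDeriv (formInChart x η) (extChartAt (𝓡 4) x x) = 0 := h
    rw [h1]
    rfl

lemma extDeriv_formIn_eq_zero {η : DForm M 2} {Ω : Set M} (h : SmoothFormOn η Ω)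
    (hc : c ∈ IsManifold.maximalAtlas (𝓡 4) ∞ M) {x : M} (hx : x ∈ c.source) (hΩ : x ∈ Ω)
    (h0 : extD η x = 0) : extDeriv (formIn c η) (c x) = 0 := by
  refine extDeriv_formIn_of_chart hc (IsManifold.chart_mem_maximalAtlas x) η (c.map_source hx)
    (c' := chartAt E4 x) ?_ ?_ ?_
  · rw [c.left_inv hx]; exact mem_chart_source E4 x
  · rw [c.left_inv hx]; exact h x hΩ
  · rw [c.left_inv hx]; exact (extD_eq_zero_iff η x).1 h0

lemma extD_eq_zero_of_formIn (hc : c ∈ IsManifold.maximalAtlas (𝓡 4) ∞ M) {η : DForm M 2} {x : M}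
    (hx : x ∈ c.source) (h : ContDiffAt ℝ ∞ (formIn c η) (c x))
    (h0 : extDeriv (formIn c η) (c x) = 0) : extD η x = 0 := by
  have hxs := mem_chart_source E4 x
  rw [extD_eq_zero_iff]
  refine extDeriv_formIn_of_chart (IsManifold.chart_mem_maximalAtlas x) hc η
    (c := chartAt E4 x) (mem_chart_target E4 x) ?_ ?_ ?_
  · exact ((chartAt E4 x).left_inv hxs).symm ▸ hx
  · exact ((chartAt E4 x).left_inv hxs).symm ▸ h
  · exact ((chartAt E4 x).left_inv hxs).symm ▸ h0

end Charts

/-! ### Linear algebra of null frames -/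

section NullFrame

variable {V : Type*} [AddCommGroup V] [Module ℝ V] [TopologicalSpace V]

/-- `(s, l, α, n)` is a null frame for the symmetric bilinear form `B`: `s` and `α` are
orthonormal and orthogonal to the null vectors `l` and `n`, which satisfy `B(n, l) = -1`. -/
structure IsNullFrame (B : V →L[ℝ] V →L[ℝ] ℝ) (s l α n : V) : Prop where
  symm : ∀ v w, B v w = B w v
  ss : B s s = 1
  αα : B α α = 1
  nl : B n l = -1
  ll : B l l = 0
  nn : B n n = 0
  ns : B n s = 0
  nα : B n α = 0
  αs : B α s = 0
  αl : B α l = 0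
  sl : B s l = 0

variable {B : V →L[ℝ] V →L[ℝ] ℝ} {s l α n : V}

namespace IsNullFrame

lemma ln (h : IsNullFrame B s l α n) : B l n = -1 := by rw [h.symm, h.nl]
lemma sn (h : IsNullFrame B s l α n) : B s n = 0 := by rw [h.symm, h.ns]
lemma αn (h : IsNullFrame B s l α n) : B α n = 0 := by rw [h.symm, h.nα]
lemma sα (h : IsNullFrame B s l α n) : B s α = 0 := by rw [h.symm, h.αs]
lemma lα (h : IsNullFrame B s l α n) : B l α = 0 := by rw [h.symm, h.αl]
lemma ls (h : IsNullFrame B s l α n) : B l s = 0 := by rw [h.symm, h.sl]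

lemma expand (h : IsNullFrame B s l α n) (hV : Module.finrank ℝ V = 4) (v : V) :
    v = B v s • s - B v n • l + B v α • α - B v l • n := by
  have hli : LinearIndependent ℝ ![s, l, α, n] := by
    rw [Fintype.linearIndependent_iff]
    intro c hc
    simp only [Fin.sum_univ_four] at hc
    have e : ∀ w, c 0 * B s w + c 1 * B l w + c 2 * B α w + c 3 * B n w = 0 := by
      intro w
      have := congrArg (fun v => B v w) hc
      simpa using this
    have h0 := e s
    have h1 := e n
    have h2 := e α
    have h3 := e l
    simp only [h.ss, h.ls, h.αs, h.ns, h.sn, h.ln, h.αn, h.nn, h.sα, h.lα, h.αα, h.nα, h.sl,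
      h.ll, h.αl, h.nl] at h0 h1 h2 h3
    intro i
    fin_cases i <;> simp <;> linarith
  have hspan : v ∈ Submodule.span ℝ (range ![s, l, α, n]) := by
    have : FiniteDimensional ℝ V := Module.finite_of_finrank_pos (by rw [hV]; norm_num)
    rw [hli.span_eq_top_of_card_eq_finrank' (by simp [hV])]
    trivial
  obtain ⟨c, rfl⟩ := (Submodule.mem_span_range_iff_exists_fun ℝ).1 hspan
  have e : ∀ w, B (∑ i, c i • ![s, l, α, n] i) w =
      c 0 * B s w + c 1 * B l w + c 2 * B α w + c 3 * B n w := by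
    intro w
    simp [Fin.sum_univ_four]
  simp only [e, h.ss, h.ls, h.αs, h.ns, h.sn, h.ln, h.αn, h.nn, h.sα, h.lα, h.αα, h.nα, h.sl,
      h.ll, h.αl, h.nl]
  simp only [Fin.sum_univ_four]
  simp only [Fin.isValue, Matrix.cons_val_zero, Matrix.cons_val_one, Matrix.cons_val]
  module

/-- The plane `span(l, s)` is the orthogonal complement of `span(l, α)`. -/
lemma mem_span_iff (h : IsNullFrame B s l α n) (hV : Module.finrank ℝ V = 4) {v : V} :
    v ∈ Submodule.span ℝ {l, s} ↔ B v l = 0 ∧ B v α = 0 := by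
  constructor
  · intro hv
    obtain ⟨a, b, rfl⟩ := Submodule.mem_span_pair.1 hv
    simp [h.ll, h.sl, h.lα, h.sα]
  · rintro ⟨h1, h2⟩
    rw [h.expand hV v, h1, h2]
    exact Submodule.mem_span_pair.2 ⟨-B v n, B v s, by module⟩

/-- Rotations of the spacelike pair preserve null frames. -/
lemma rotate (h : IsNullFrame B s l α n) (t : ℝ) :
    IsNullFrame B (Real.cos t • s + Real.sin t • α) l
      (-(Real.sin t • s) + Real.cos t • α) n := by
  have := Real.sin_sq_add_cos_sq t
  constructor
  · exact h.symm
  all_goals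
    simp [h.ss, h.αs, h.ns, h.nn, h.sα, h.αα, h.nα, h.sl, h.ll, h.αl, h.nl]
  all_goals linarith

end IsNullFrame

end NullFrame

/-! ### Derivatives, brackets and the Koszul formula -/

section Koszul

variable {M : Type*} [TopologicalSpace M] [ChartedSpace E4 M]

lemma dirDeriv_add {f h : M → ℝ} {x : M} (hf : MDifferentiableAt (𝓡 4) 𝓘(ℝ, ℝ) f x)
    (hh : MDifferentiableAt (𝓡 4) 𝓘(ℝ, ℝ) h x) (X : VField M) :
    dirDeriv X (fun y => f y + h y) x = dirDeriv X f x + dirDeriv X h x := by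
  unfold dirDeriv
  have := (hf.hasMFDerivAt.add hh.hasMFDerivAt).mfderiv
  exact congrArg (fun A => A (X x)) this

lemma dirDeriv_mul {f h : M → ℝ} {x : M} (hf : MDifferentiableAt (𝓡 4) 𝓘(ℝ, ℝ) f x)
    (hh : MDifferentiableAt (𝓡 4) 𝓘(ℝ, ℝ) h x) (X : VField M) :
    dirDeriv X (fun y => f y * h y) x = dirDeriv X f x * h x + f x * dirDeriv X h x := by
  unfold dirDeriv
  have := (hf.hasMFDerivAt.mul hh.hasMFDerivAt).mfderiv
  refine (congrArg (fun A => A (X x)) this).trans ?_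
  let a : ℝ := mfderiv (𝓡 4) 𝓘(ℝ, ℝ) f x (X x)
  let b : ℝ := mfderiv (𝓡 4) 𝓘(ℝ, ℝ) h x (X x)
  change f x * b + h x * a = a * h x + f x * b
  ring

lemma dirDeriv_const (X : VField M) {f : M → ℝ} {x : M} {a : ℝ} (hf : f =ᶠ[𝓝 x] fun _ => a) :
    dirDeriv X f x = 0 := by
  unfold dirDeriv
  rw [hf.mfderiv_eq, mfderiv_const]
  rfl

lemma bracket_swap (X Y : VField M) (x : M) : bracket X Y x = -bracket Y X x :=
  VectorField.mlieBracket_swap_apply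

lemma bracket_self (X : VField M) (x : M) : bracket X X x = 0 := by
  have := VectorField.mlieBracket_self (I := 𝓡 4) (V := X)
  exact congrFun this x

variable [IsManifold (𝓡 4) ∞ M]

lemma bracket_add_right {X Y Z : VField M} {x : M} (hY : SmoothAt Y x) (hZ : SmoothAt Z x) :
    bracket X (fun y => Y y + Z y) x = bracket X Y x + bracket X Z x := by
  have : IsManifold (𝓡 4) 1 M := IsManifold.of_le (n := ∞) (by simp)
  exact VectorField.mlieBracket_add_right hY.mdifferentiableAt hZ.mdifferentiableAt

lemma bracket_smul_right {X Y : VField M} {f : M → ℝ} {x : M}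
    (hf : MDifferentiableAt (𝓡 4) 𝓘(ℝ, ℝ) f x) (hY : SmoothAt Y x) :
    bracket X (fun y => f y • Y y) x = dirDeriv X f x • Y x + f x • bracket X Y x := by
  have : IsManifold (𝓡 4) 1 M := IsManifold.of_le (n := ∞) (by simp)
  exact VectorField.mlieBracket_smul_right hf hY.mdifferentiableAt

lemma smoothAt_bracket {X Y : VField M} {x : M} (hX : SmoothAt X x) (hY : SmoothAt Y x) :
    SmoothAt (bracket X Y) x := by
  have h3 : minSmoothness ℝ 3 ≤ ∞ := by simpa using ENat.LEInfty.out
  have : IsManifold (𝓡 4) (minSmoothness ℝ 3) M := IsManifold.of_le h3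
  have : IsManifold (𝓡 4) (∞ + 1) M := by simpa
  exact ContMDiffAt.mlieBracket_vectorField (n := ⊤) (m := ⊤) hX hY (by simp)

variable (g : LorentzMetric M)

lemma smoothAt_ip {X Y : VField M} {x : M} (hX : SmoothAt X x) (hY : SmoothAt Y x) :
    ContMDiffAt (𝓡 4) 𝓘(ℝ, ℝ) ∞ (g.ip X Y) x := by
  have h := ContMDiffAt.clm_bundle_apply₂ (IB := 𝓡 4) (F₁ := E4) (F₂ := E4) (F₃ := ℝ)
    (n := ∞) (E₁ := fun x : M => TangentSpace (𝓡 4) x) (E₂ := fun x : M => TangentSpace (𝓡 4) x)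
    (E₃ := Bundle.Trivial M ℝ) (b := fun x : M => x) (x := x) (IM := 𝓡 4)
    (ψ := fun x => g.val x) (v := X) (w := Y) (g.contMDiff x) hX hY
  simp only [Bundle.contMDiffAt_totalSpace] at h
  exact h.2

lemma ip_symm (X Y : VField M) : g.ip X Y = g.ip Y X := funext fun x => g.symm x _ _

lemma koszul_add {X Y Z Z' : VField M} {x : M} (hX : SmoothAt X x) (hY : SmoothAt Y x)
    (hZ : SmoothAt Z x) (hZ' : SmoothAt Z' x) :
    koszul g X Y (fun y => Z y + Z' y) x = koszul g X Y Z x + koszul g X Y Z' x := by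
  have d : ∀ {U W : VField M}, SmoothAt U x → SmoothAt W x →
      MDifferentiableAt (𝓡 4) 𝓘(ℝ, ℝ) (g.ip U W) x :=
    fun hU hW => (smoothAt_ip g hU hW).mdifferentiableAt (by simp)
  have e : ∀ U : VField M, g.ip U (fun y => Z y + Z' y) = fun y => g.ip U Z y + g.ip U Z' y :=
    fun U => funext fun y => map_add _ _ _
  have e1 : g.ip (bracket X fun y => Z y + Z' y) Y x =
      g.ip (bracket X Z) Y x + g.ip (bracket X Z') Y x := by
    simp only [LorentzMetric.ip, bracket_add_right hZ hZ', map_add]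
    rfl
  have e2 : g.ip (bracket Y fun y => Z y + Z' y) X x =
      g.ip (bracket Y Z) X x + g.ip (bracket Y Z') X x := by
    simp only [LorentzMetric.ip, bracket_add_right hZ hZ', map_add]
    rfl
  have e3 : dirDeriv (fun y => Z y + Z' y) (g.ip X Y) x =
      dirDeriv Z (g.ip X Y) x + dirDeriv Z' (g.ip X Y) x := map_add _ _ _
  simp only [koszul, e, e1, e2, e3, dirDeriv_add (d hY hZ) (d hY hZ'),
    dirDeriv_add (d hX hZ) (d hX hZ')]
  ring

lemma koszul_smul {X Y Z : VField M} {f : M → ℝ} {x : M} (hX : SmoothAt X x) (hY : SmoothAt Y x)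
    (hZ : SmoothAt Z x) (hf : MDifferentiableAt (𝓡 4) 𝓘(ℝ, ℝ) f x) :
    koszul g X Y (fun y => f y • Z y) x = f x * koszul g X Y Z x := by
  have d : ∀ {U W : VField M}, SmoothAt U x → SmoothAt W x →
      MDifferentiableAt (𝓡 4) 𝓘(ℝ, ℝ) (g.ip U W) x :=
    fun hU hW => (smoothAt_ip g hU hW).mdifferentiableAt (by simp)
  have e : ∀ U : VField M, g.ip U (fun y => f y • Z y) = fun y => f y * g.ip U Z y :=
    fun U => funext fun y => map_smul _ _ _
  have e1 : ∀ U W : VField M, g.ip (bracket U fun y => f y • Z y) W x =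
      dirDeriv U f x * g.ip Z W x + f x * g.ip (bracket U Z) W x := by
    intro U W
    simp only [LorentzMetric.ip, bracket_smul_right hf hZ, map_add, map_smul]
    rfl
  have e3 : dirDeriv (fun y => f y • Z y) (g.ip X Y) x =
      f x * dirDeriv Z (g.ip X Y) x := map_smul _ _ _
  simp only [koszul, e, e1, e3, dirDeriv_mul hf (d hY hZ), dirDeriv_mul hf (d hX hZ)]
  rw [ip_symm g Z Y, ip_symm g Z X]
  ring

end Koszul

/-! ### The Levi-Civita connection tested on a tetrad -/

section Tetrad

variable {M : Type*} [TopologicalSpace M] [ChartedSpace E4 M]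

lemma finrank_tangentSpace (x : M) : Module.finrank ℝ (TangentSpace (𝓡 4) x) = 4 :=
  finrank_euclideanSpace_fin (𝕜 := ℝ) (n := 4)

section Rotate

variable {Θ : M → ℝ} {x : M}

lemma contMDiffAt_cos (hΘ : ContMDiffAt (𝓡 4) 𝓘(ℝ, ℝ) ∞ Θ x) :
    ContMDiffAt (𝓡 4) 𝓘(ℝ, ℝ) ∞ (fun y => Real.cos (Θ y)) x :=
  (Real.contDiff_cos.contDiffAt (x := Θ x)).contMDiffAt.comp x hΘ

lemma contMDiffAt_sin (hΘ : ContMDiffAt (𝓡 4) 𝓘(ℝ, ℝ) ∞ Θ x) :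
    ContMDiffAt (𝓡 4) 𝓘(ℝ, ℝ) ∞ (fun y => Real.sin (Θ y)) x :=
  (Real.contDiff_sin.contDiffAt (x := Θ x)).contMDiffAt.comp x hΘ

lemma dirDeriv_comp_real (hΘ : MDifferentiableAt (𝓡 4) 𝓘(ℝ, ℝ) Θ x) {φ : ℝ → ℝ} {φ' : ℝ}
    (hφ : HasDerivAt φ φ' (Θ x)) (X : VField M) :
    dirDeriv X (fun y => φ (Θ y)) x = dirDeriv X Θ x * φ' := by
  have h1 : HasMFDerivAt (𝓡 4) 𝓘(ℝ, ℝ) (fun y => φ (Θ y)) x _ :=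
    HasMFDerivAt.comp x hφ.hasFDerivAt.hasMFDerivAt hΘ.hasMFDerivAt
  unfold dirDeriv
  rw [h1.mfderiv]
  rfl

lemma rotα_eq (Θ : M → ℝ) (s α : VField M) :
    rotα Θ s α = fun y => (-Real.sin (Θ y)) • s y + Real.cos (Θ y) • α y := by
  funext y; simp [rotα]

end Rotate

variable [IsManifold (𝓡 4) ∞ M] {g : LorentzMetric M} {s l α n : VField M} {Ω : Set M}

lemma SmoothOn.smoothAt {X : VField M} (hX : SmoothOn X Ω) (hΩ : IsOpen Ω) {x : M} (hx : x ∈ Ω) :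
    SmoothAt X x :=
  ContMDiffOn.contMDiffAt hX (hΩ.mem_nhds hx)

lemma SmoothAt.smul {f : M → ℝ} {X : VField M} {x : M} (hf : ContMDiffAt (𝓡 4) 𝓘(ℝ, ℝ) ∞ f x)
    (hX : SmoothAt X x) : SmoothAt (fun y => f y • X y) x :=
  ContMDiffAt.smul_section hf hX

lemma SmoothAt.add {X Y : VField M} {x : M} (hX : SmoothAt X x) (hY : SmoothAt Y x) :
    SmoothAt (fun y => X y + Y y) x :=
  ContMDiffAt.add_section hX hY

lemma IsNullTetrad.isNullFrame (h : IsNullTetrad g s l α n Ω) {x : M} (hx : x ∈ Ω) :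
    IsNullFrame (g.val x) (s x) (l x) (α x) (n x) where
  symm := g.symm x
  ss := h.ss x hx
  αα := h.αα x hx
  nl := h.nl x hx
  ll := h.ll x hx
  nn := h.nn x hx
  ns := h.ns x hx
  nα := h.nα x hx
  αs := h.αs x hx
  αl := h.αl x hx
  sl := h.sl x hx

/-- The Koszul expression is tensorial in its last argument. Expanding this argument in a tetrad
shows that a vector satisfying the Koszul formula exists, so that `nabla` has its defining
property. -/
lemma ip_nabla (h : IsNullTetrad g s l α n univ) {X Y Z : VField M} {x : M} (hX : SmoothAt X x)
    (hY : SmoothAt Y x) (hZ : SmoothAt Z x) : g.ip (nabla g X Y) Z x = koszul g X Y Z x := by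
  have hs := h.smooth_s.smoothAt isOpen_univ (mem_univ x)
  have hl := h.smooth_l.smoothAt isOpen_univ (mem_univ x)
  have hα := h.smooth_α.smoothAt isOpen_univ (mem_univ x)
  have hn := h.smooth_n.smoothAt isOpen_univ (mem_univ x)
  have key : ∃ v : TangentSpace (𝓡 4) x,
      ∀ Z : VField M, SmoothAt Z x → g.val x v (Z x) = koszul g X Y Z x := by
    have hF := h.isNullFrame (mem_univ x)
    obtain ⟨v, hv⟩ : ∃ v, ∀ w, g.val x v w = g.val x w (s x) * koszul g X Y s x
        - g.val x w (n x) * koszul g X Y l x + g.val x w (α x) * koszul g X Y α x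
        - g.val x w (l x) * koszul g X Y n x :=
      ⟨koszul g X Y s x • s x - koszul g X Y l x • n x + koszul g X Y α x • α x
        - koszul g X Y n x • l x, fun w => by simp [hF.symm w]; ring⟩
    refine ⟨v, fun Z hZ => ?_⟩
    rw [hv]
    have hZe : Z = fun y => ((g.ip Z s y • s y + (-g.ip Z n y) • l y) + g.ip Z α y • α y) +
        (-g.ip Z l y) • n y := by
      funext y
      have := (h.isNullFrame (mem_univ y)).expand (finrank_tangentSpace y) (Z y)
      refine this.trans ?_
      simp only [LorentzMetric.ip]
      module
    have cs := smoothAt_ip g hZ hs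
    have cl := (smoothAt_ip g hZ hl).neg
    have cα := smoothAt_ip g hZ hα
    have cn := (smoothAt_ip g hZ hn).neg
    have e : koszul g X Y Z x = g.ip Z s x * koszul g X Y s x + (-g.ip Z n x) * koszul g X Y l x +
        g.ip Z α x * koszul g X Y α x + (-g.ip Z l x) * koszul g X Y n x := by
      conv_lhs => rw [hZe]
      rw [koszul_add g hX hY (((hs.smul cs).add (hl.smul cn)).add (hα.smul cα)) (hn.smul cl),
        koszul_add g hX hY ((hs.smul cs).add (hl.smul cn)) (hα.smul cα),
        koszul_add g hX hY (hs.smul cs) (hl.smul cn),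
        koszul_smul g hX hY hs (cs.mdifferentiableAt (by simp)),
        koszul_smul g hX hY hl (cn.mdifferentiableAt (by simp)),
        koszul_smul g hX hY hα (cα.mdifferentiableAt (by simp)),
        koszul_smul g hX hY hn (cl.mdifferentiableAt (by simp))]
    rw [e]
    simp only [LorentzMetric.ip]
    ring
  exact Classical.epsilon_spec key Z hZ

/-- When the three fields have constant scalar products, only brackets remain in the Koszul
expression. -/
lemma koszul_of_const {X Y Z : VField M} {x : M} {a b c : ℝ} (hYZ : g.ip Y Z =ᶠ[𝓝 x] fun _ => a)
    (hXZ : g.ip X Z =ᶠ[𝓝 x] fun _ => b) (hXY : g.ip X Y =ᶠ[𝓝 x] fun _ => c) :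
    koszul g X Y Z x = (1 / 2 : ℝ) * (g.ip (bracket X Y) Z x - g.ip (bracket X Z) Y x
      - g.ip (bracket Y Z) X x) := by
  simp only [koszul, dirDeriv_const X hYZ, dirDeriv_const Y hXZ, dirDeriv_const Z hXY]
  ring

lemma ip_bracket_swap (X Y Z : VField M) (x : M) :
    g.ip (bracket X Y) Z x = -g.ip (bracket Y X) Z x := by
  simp only [LorentzMetric.ip, bracket_swap X Y]
  rw [map_neg]
  rfl

lemma ip_bracket_self (X Z : VField M) (x : M) : g.ip (bracket X X) Z x = 0 := by
  simp only [LorentzMetric.ip, bracket_self X]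
  rw [map_zero]
  rfl

section Reduce

variable {S : VField M}

/-- For a null geodesic field `l` and a field `Y` orthogonal to `l` of constant length, `[l, Y]`
is orthogonal to `l`. -/
lemma ip_bracket_of_geodesic (h₀ : IsNullTetrad g s l α n univ) {Y : VField M} {x : M}
    (hY : SmoothAt Y x) (hlY : g.ip l Y =ᶠ[𝓝 x] fun _ => 0)
    (hgeo : ∃ c : ℝ, nabla g l l x = c • l x) : g.ip (bracket l Y) l x = 0 := by
  have hl := h₀.smooth_l.smoothAt isOpen_univ (mem_univ x)
  obtain ⟨c, hc⟩ := hgeo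
  have h1 := ip_nabla h₀ hl hl hY
  have hll : g.ip l l =ᶠ[𝓝 x] fun _ => 0 := Eventually.of_forall fun y => h₀.ll y (mem_univ y)
  rw [koszul_of_const hlY hlY hll, ip_bracket_self] at h1
  have h2 : g.ip (nabla g l l) Y x = c * g.ip l Y x := by
    simp only [LorentzMetric.ip, hc, map_smul]
    rfl
  rw [h2, hlY.eq_of_nhds] at h1
  linarith

/-- For a unit field `S` orthogonal to `l`, `g(∇_S l, S) = g([S, l], S)`. -/
lemma ip_nabla_self (h₀ : IsNullTetrad g s l α n univ) {x : M}
    (hS : SmoothAt S x) (hSS : g.ip S S =ᶠ[𝓝 x] fun _ => 1) (hSl : g.ip S l =ᶠ[𝓝 x] fun _ => 0) :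
    g.ip (nabla g S l) S x = -g.ip (bracket l S) S x := by
  have hl := h₀.smooth_l.smoothAt isOpen_univ (mem_univ x)
  have hlS : g.ip l S =ᶠ[𝓝 x] fun _ => 0 := by rwa [ip_symm g l S]
  rw [ip_nabla h₀ hS hl hS, koszul_of_const hlS hSS hSl, ip_bracket_self,
    ip_bracket_swap S l S]
  ring

/-- The symmetrized shear component of `l` in terms of brackets. -/
lemma ip_nabla_add_ip_nabla (h₀ : IsNullTetrad g s l α n univ) (x : M) :
    g.ip (nabla g s l) α x + g.ip (nabla g α l) s x =
      -(g.ip (bracket l s) α x + g.ip (bracket l α) s x) := by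
  have hs := h₀.smooth_s.smoothAt isOpen_univ (mem_univ x)
  have hl := h₀.smooth_l.smoothAt isOpen_univ (mem_univ x)
  have hα := h₀.smooth_α.smoothAt isOpen_univ (mem_univ x)
  have e1 : g.ip s l =ᶠ[𝓝 x] fun _ => 0 := Eventually.of_forall fun y => h₀.sl y (mem_univ y)
  have e2 : g.ip α l =ᶠ[𝓝 x] fun _ => 0 := Eventually.of_forall fun y => h₀.αl y (mem_univ y)
  have e3 : g.ip α s =ᶠ[𝓝 x] fun _ => 0 := Eventually.of_forall fun y => h₀.αs y (mem_univ y)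
  have e1' : g.ip l s =ᶠ[𝓝 x] fun _ => 0 := by rwa [ip_symm g l s]
  have e2' : g.ip l α =ᶠ[𝓝 x] fun _ => 0 := by rwa [ip_symm g l α]
  have e3' : g.ip s α =ᶠ[𝓝 x] fun _ => 0 := by rwa [ip_symm g s α]
  rw [ip_nabla h₀ hs hl hα, ip_nabla h₀ hα hl hs, koszul_of_const e2' e3' e1,
    koszul_of_const e1' e3 e2, ip_bracket_swap α s l, ip_bracket_swap s l α,
    ip_bracket_swap α l s]
  ring

end Reduce

/-! ### Rotated tetrads -/

section Rotate

variable {Θ : M → ℝ} {x : M}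

lemma smoothAt_rotS (hΘ : ContMDiffAt (𝓡 4) 𝓘(ℝ, ℝ) ∞ Θ x) (hs : SmoothAt s x)
    (hα : SmoothAt α x) : SmoothAt (rotS Θ s α) x :=
  (hs.smul (contMDiffAt_cos hΘ)).add (hα.smul (contMDiffAt_sin hΘ))

lemma smoothAt_rotα (hΘ : ContMDiffAt (𝓡 4) 𝓘(ℝ, ℝ) ∞ Θ x) (hs : SmoothAt s x)
    (hα : SmoothAt α x) : SmoothAt (rotα Θ s α) x := by
  rw [rotα_eq]
  exact (hs.smul (contMDiffAt_sin hΘ).neg).add (hα.smul (contMDiffAt_cos hΘ))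

lemma bracket_rotS (hΘ : ContMDiffAt (𝓡 4) 𝓘(ℝ, ℝ) ∞ Θ x) (hs : SmoothAt s x)
    (hα : SmoothAt α x) (l : VField M) :
    bracket l (rotS Θ s α) x = dirDeriv l Θ x • rotα Θ s α x
      + Real.cos (Θ x) • bracket l s x + Real.sin (Θ x) • bracket l α x := by
  have hd := hΘ.mdifferentiableAt (n := ∞) (by simp)
  have hc := contMDiffAt_cos hΘ
  have hsn := contMDiffAt_sin hΘ
  refine (bracket_add_right (hs.smul hc) (hα.smul hsn)).trans ?_
  rw [bracket_smul_right (hc.mdifferentiableAt (by simp)) hs,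
    bracket_smul_right (hsn.mdifferentiableAt (by simp)) hα,
    dirDeriv_comp_real hd (Real.hasDerivAt_cos _), dirDeriv_comp_real hd (Real.hasDerivAt_sin _)]
  simp only [rotα]
  module

lemma bracket_rotα (hΘ : ContMDiffAt (𝓡 4) 𝓘(ℝ, ℝ) ∞ Θ x) (hs : SmoothAt s x)
    (hα : SmoothAt α x) (l : VField M) :
    bracket l (rotα Θ s α) x = -(dirDeriv l Θ x • rotS Θ s α x)
      - Real.sin (Θ x) • bracket l s x + Real.cos (Θ x) • bracket l α x := by
  have hd := hΘ.mdifferentiableAt (n := ∞) (by simp)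
  have hc := contMDiffAt_cos hΘ
  have hsn := (contMDiffAt_sin hΘ).neg
  rw [rotα_eq]
  refine (bracket_add_right (hs.smul hsn) (hα.smul hc)).trans ?_
  rw [bracket_smul_right (hsn.mdifferentiableAt (by simp)) hs,
    bracket_smul_right (hc.mdifferentiableAt (by simp)) hα,
    dirDeriv_comp_real hd (Real.hasDerivAt_cos _),
    dirDeriv_comp_real (φ := fun t => -Real.sin t) hd (Real.hasDerivAt_sin _).neg]
  simp only [rotS]
  module

lemma IsNullTetrad.rotate (h : IsNullTetrad g s l α n univ) (hΩ : IsOpen Ω)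
    (hΘ : ContMDiffOn (𝓡 4) 𝓘(ℝ, ℝ) ∞ Θ Ω) :
    IsNullTetrad g (rotS Θ s α) l (rotα Θ s α) n Ω := by
  have hF : ∀ x, IsNullFrame (g.val x) (rotS Θ s α x) (l x) (rotα Θ s α x) (n x) :=
    fun x => (h.isNullFrame (mem_univ x)).rotate (Θ x)
  have sm : ∀ {X : VField M}, SmoothOn X univ → SmoothOn X Ω := fun hX => hX.mono (subset_univ _)
  exact
    { smooth_s := fun x hx => (smoothAt_rotS (hΘ.contMDiffAt (hΩ.mem_nhds hx))
        (h.smooth_s.smoothAt isOpen_univ (mem_univ x))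
        (h.smooth_α.smoothAt isOpen_univ (mem_univ x))).contMDiffWithinAt
      smooth_l := sm h.smooth_l
      smooth_α := fun x hx => (smoothAt_rotα (hΘ.contMDiffAt (hΩ.mem_nhds hx))
        (h.smooth_s.smoothAt isOpen_univ (mem_univ x))
        (h.smooth_α.smoothAt isOpen_univ (mem_univ x))).contMDiffWithinAt
      smooth_n := sm h.smooth_n
      ss := fun x _ => (hF x).ss
      αα := fun x _ => (hF x).αα
      nl := fun x _ => (hF x).nl
      ll := fun x _ => (hF x).ll
      nn := fun x _ => (hF x).nn
      ns := fun x _ => (hF x).ns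
      nα := fun x _ => (hF x).nα
      αs := fun x _ => (hF x).αs
      αl := fun x _ => (hF x).αl
      sl := fun x _ => (hF x).sl }

/-- What the hypotheses on the congruence say about the brackets with the given frame: the flow of
`l` preserves `l^⊥` and acts conformally on `l^⊥ / l`. -/
structure ConformalBrackets (g : LorentzMetric M) (s l α : VField M) (x : M) : Prop where
  sl : g.ip (bracket l s) l x = 0
  αl : g.ip (bracket l α) l x = 0
  diag : g.ip (bracket l s) s x = g.ip (bracket l α) α x
  off : g.ip (bracket l s) α x + g.ip (bracket l α) s x = 0

/-- The hypotheses on the congruence, translated into brackets by the Koszul formula: the geodesic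
equation gives the components along `l`, the two equipartition conditions give the screen part. -/
lemma conformalBrackets (h : IsNullTetrad g s l α n univ) (hl : IsNullGeodesic g l univ)
    (hequi : Equipartition g s l α univ) (hunif : UniformEquipartition g s l α univ) (x : M) :
    ConformalBrackets g s l α x := by
  have hs := h.smooth_s.smoothAt isOpen_univ (mem_univ x)
  have hα := h.smooth_α.smoothAt isOpen_univ (mem_univ x)
  have hF := fun y => h.isNullFrame (mem_univ y)
  constructor
  · exact ip_bracket_of_geodesic h hs (.of_forall fun y => (hF y).ls) (hl.geodesic x (mem_univ x))
  · exact ip_bracket_of_geodesic h hα (.of_forall fun y => (hF y).lα) (hl.geodesic x (mem_univ x))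
  · have := hequi x (mem_univ x)
    rw [ip_nabla_self h hs (.of_forall fun y => (hF y).ss) (.of_forall fun y => (hF y).sl),
      ip_nabla_self h hα (.of_forall fun y => (hF y).αα) (.of_forall fun y => (hF y).αl)] at this
    linarith
  · have := hunif x (mem_univ x)
    rw [ip_nabla_add_ip_nabla h] at this
    linarith

/-- The conformal bracket relations are invariant under rotations of the frame, because the matrix
of `[l, ·]` on the screen is a multiple of the identity plus a skew matrix; its off-diagonal entry
in the rotated frame measures the failure of the transport equation. -/
lemma ConformalBrackets.rotate (hC : ConformalBrackets g s l α x)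
    (h : IsNullTetrad g s l α n univ) (hΘ : ContMDiffAt (𝓡 4) 𝓘(ℝ, ℝ) ∞ Θ x) :
    ConformalBrackets g (rotS Θ s α) l (rotα Θ s α) x ∧
      g.ip (bracket l (rotS Θ s α)) (rotα Θ s α) x =
        dirDeriv l Θ x + g.ip (bracket l s) α x := by
  have hs := h.smooth_s.smoothAt isOpen_univ (mem_univ x)
  have hα := h.smooth_α.smoothAt isOpen_univ (mem_univ x)
  have hF := h.isNullFrame (mem_univ x)
  obtain ⟨h1, h2, h3, h4⟩ := hC
  have hsc := Real.sin_sq_add_cos_sq (Θ x)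
  have hR := hF.rotate (Θ x)
  simp only [LorentzMetric.ip] at h1 h2 h3 h4
  have e1 : ∀ v, g.val x (bracket l (rotS Θ s α) x) v = dirDeriv l Θ x * g.val x (rotα Θ s α x) v
      + Real.cos (Θ x) * g.val x (bracket l s x) v
      + Real.sin (Θ x) * g.val x (bracket l α x) v := by
    intro v
    rw [bracket_rotS hΘ hs hα]
    simp
  have e2 : ∀ v, g.val x (bracket l (rotα Θ s α) x) v =
      -(dirDeriv l Θ x * g.val x (rotS Θ s α x) v)
      - Real.sin (Θ x) * g.val x (bracket l s x) v
      + Real.cos (Θ x) * g.val x (bracket l α x) v := by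
    intro v
    rw [bracket_rotα hΘ hs hα]
    simp
  have r1 : ∀ v, g.val x v (rotS Θ s α x) =
      Real.cos (Θ x) * g.val x v (s x) + Real.sin (Θ x) * g.val x v (α x) := by
    intro v; simp [rotS]
  have r2 : ∀ v, g.val x v (rotα Θ s α x) =
      -Real.sin (Θ x) * g.val x v (s x) + Real.cos (Θ x) * g.val x v (α x) := by
    intro v; simp [rotα]
  have q1 : g.val x (rotS Θ s α x) (rotS Θ s α x) = 1 := hR.ss
  have q2 : g.val x (rotα Θ s α x) (rotα Θ s α x) = 1 := hR.αα
  have q3 : g.val x (rotα Θ s α x) (rotS Θ s α x) = 0 := hR.αs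
  have q4 : g.val x (rotS Θ s α x) (rotα Θ s α x) = 0 := hR.sα
  have q5 : g.val x (rotS Θ s α x) (l x) = 0 := hR.sl
  have q6 : g.val x (rotα Θ s α x) (l x) = 0 := hR.αl
  have hoff : g.val x (bracket l α x) (s x) = -g.val x (bracket l s x) (α x) := by linarith
  refine ⟨⟨?_, ?_, ?_, ?_⟩, ?_⟩ <;>
    simp only [LorentzMetric.ip, e1, e2, q1, q2, q3, q4, q5, q6, h1, h2]
  · ring
  · ring
  · simp only [r1, r2, hoff, h3]
    ring
  · simp only [r1, r2, hoff, h3]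
    ring
  · simp only [r2, hoff, h3]
    linear_combination g.val x (bracket l s x) (α x) * hsc

/-- The rotated pair is involutive exactly when the angle solves the transport equation. -/
lemma involutive_iff_transport (hC : ∀ x, ConformalBrackets g s l α x)
    (h : IsNullTetrad g s l α n univ) (hΩ : IsOpen Ω) (hΘ : ContMDiffOn (𝓡 4) 𝓘(ℝ, ℝ) ∞ Θ Ω) :
    Involutive l (rotS Θ s α) Ω ↔ Transport g s l α Θ Ω := by
  refine forall₂_congr fun x hx => ?_
  obtain ⟨h1, h2⟩ := (hC x).rotate h (hΘ.contMDiffAt (hΩ.mem_nhds hx))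
  have hR := (h.rotate hΩ hΘ).isNullFrame hx
  have h3 : g.val x (bracket l (rotS Θ s α) x) (rotα Θ s α x) =
        dirDeriv l Θ x + g.ip (bracket l s) α x := h2
  have h4 : g.val x (bracket l (rotS Θ s α) x) (l x) = 0 := h1.sl
  rw [spanDist, hR.mem_span_iff (finrank_tangentSpace x), h3, h4]
  constructor
  · rintro ⟨-, h⟩; linarith
  · intro h; exact ⟨rfl, by linarith⟩

lemma equipartition_rotate (hC : ∀ x, ConformalBrackets g s l α x)
    (h : IsNullTetrad g s l α n univ) (hΩ : IsOpen Ω) (hΘ : ContMDiffOn (𝓡 4) 𝓘(ℝ, ℝ) ∞ Θ Ω) :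
    Equipartition g (rotS Θ s α) l (rotα Θ s α) Ω := by
  intro x hx
  have hT := h.rotate hΩ hΘ
  have hF := fun y hy => hT.isNullFrame (x := y) hy
  have ev : ∀ {P : M → Prop}, (∀ y ∈ Ω, P y) → ∀ᶠ y in 𝓝 x, P y :=
    fun hP => (hΩ.mem_nhds hx |> Filter.eventually_of_mem) hP
  rw [ip_nabla_self h (hT.smooth_s.smoothAt hΩ hx) (ev hT.ss) (ev hT.sl),
    ip_nabla_self h (hT.smooth_α.smoothAt hΩ hx) (ev hT.αα) (ev hT.αl),
    ((hC x).rotate h (hΘ.contMDiffAt (hΩ.mem_nhds hx))).1.diag]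

end Rotate

end Tetrad

/-! ### Construction of adapted charts -/

section Charts

variable {M : Type*} [TopologicalSpace M] [ChartedSpace E4 M] {c : OpenPartialHomeomorph M E4}
  {Ψ : OpenPartialHomeomorph E4 E4}

lemma isSmoothEquiv_ofSet {U : Set E4} (hU : IsOpen U) :
    IsSmoothEquiv (OpenPartialHomeomorph.ofSet U hU) :=
  ⟨contDiffOn_id, contDiffOn_id⟩

lemma chartDiff_trans (hc : c ∈ IsManifold.maximalAtlas (𝓡 4) ∞ M) (hΨ : IsSmoothEquiv Ψ) {x : M}
    (hx : x ∈ (c.trans Ψ).source) (v : TangentSpace (𝓡 4) x) :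
    chartDiff (c.trans Ψ) x v = fderiv ℝ Ψ (c x) (chartDiff c x v) := by
  rw [OpenPartialHomeomorph.trans_source] at hx
  have h1 := (chart_mdifferentiable hc).mdifferentiableAt hx.1
  have h2 := ((hΨ.contDiffAt hx.2).differentiableAt (by simp)).mdifferentiableAt
  have h3 := mfderiv_comp x h2 h1
  rw [mfderiv_eq_fderiv] at h3
  exact congrArg (fun A => A v) h3

lemma fieldIn_mem_span (hc : c ∈ IsManifold.maximalAtlas (𝓡 4) ∞ M) {x : M} (hx : x ∈ c.source)
    (u v w : TangentSpace (𝓡 4) x) :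
    chartDiff c x w ∈ Submodule.span ℝ {chartDiff c x u, chartDiff c x v} ↔
      w ∈ Submodule.span ℝ {u, v} := by
  have hinj : Function.Injective (chartDiff c x) := (isInvertible_chartDiff hc hx).injective
  simp only [Submodule.mem_span_pair]
  refine exists₂_congr fun a b => ?_
  rw [← map_smul, ← map_smul, ← map_add]
  exact hinj.eq_iff

/-- A distribution with adapted charts around each point of `Ω` has a foliation: the leaves are the
sets of points that can be joined by finite chains of plaques. -/
lemma exists_isFoliation {D : (x : M) → Submodule ℝ (TangentSpace (𝓡 4) x)} {Ω : Set M}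
    (h : ∀ x ∈ Ω, ∃ e, IsFoliatedChart D e ∧ x ∈ e.source ∧ e.source ⊆ Ω) :
    ∃ leaves, IsFoliation D Ω leaves := by
  let R : M → M → Prop := fun p q =>
    ∃ e, IsFoliatedChart D e ∧ e.source ⊆ Ω ∧ p ∈ e.source ∧ q ∈ plaque e p
  have hR : Std.Symm R := ⟨by
    rintro p q ⟨e, he, hes, hp, hq, h2, h3⟩
    exact ⟨e, he, hes, hq, hp, h2.symm, h3.symm⟩⟩
  have hsymm : ∀ {p q}, Relation.ReflTransGen R p q → Relation.ReflTransGen R q p :=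
    fun h => (Relation.ReflTransGen.stdSymm (r := R)).symm _ _ h
  have hmem : ∀ {p q}, p ∈ Ω → Relation.ReflTransGen R p q → q ∈ Ω := by
    intro p q hp hpq
    induction hpq with
    | refl => exact hp
    | tail _ hbc _ =>
      obtain ⟨e, -, hes, -, hq⟩ := hbc
      exact hes hq.1
  refine ⟨{L | ∃ p ∈ Ω, L = {q | Relation.ReflTransGen R p q}}, ?_, ?_, ?_, h, ?_, ?_⟩
  · rintro L ⟨p, -, rfl⟩
    exact ⟨p, .refl⟩
  · rintro L ⟨p, hp, rfl⟩ L' ⟨p', hp', rfl⟩ hne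
    refine Set.disjoint_left.2 fun q hq hq' => hne ?_
    have hpp' : Relation.ReflTransGen R p p' := Relation.ReflTransGen.trans hq (hsymm hq')
    ext z
    exact ⟨fun hz => (hsymm hpp').trans hz, fun hz => hpp'.trans hz⟩
  · ext q
    constructor
    · rintro ⟨L, ⟨p, hp, rfl⟩, hq⟩
      exact hmem hp hq
    · intro hq
      exact ⟨_, ⟨q, hq, rfl⟩, .refl⟩
  · rintro e he hes x hx L ⟨p, hp, rfl⟩ hxL y hy
    exact Relation.ReflTransGen.tail hxL ⟨e, he, hes, hx, hy⟩
  · rintro L ⟨p, hp, rfl⟩ x hx y hy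
    exact (hsymm hx).trans hy

variable [IsManifold (𝓡 4) ∞ M]

lemma trans_mem_maximalAtlas (hc : c ∈ IsManifold.maximalAtlas (𝓡 4) ∞ M)
    (hΨ : IsSmoothEquiv Ψ) : c.trans Ψ ∈ IsManifold.maximalAtlas (𝓡 4) ∞ M := by
  refine OpenPartialHomeomorph.mem_maximalAtlas_of_contMDiffOn _ ?_ ?_
  · exact hΨ.contDiffOn.contMDiffOn.comp
      ((contMDiffOn_of_mem_maximalAtlas hc).mono (by
        rw [OpenPartialHomeomorph.trans_source]; exact inter_subset_left))
      (by rw [OpenPartialHomeomorph.trans_source]; exact inter_subset_right)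
  · refine (contMDiffOn_symm_of_mem_maximalAtlas hc).comp
      (hΨ.contDiffOn_symm.contMDiffOn.mono ?_) ?_
    · rw [OpenPartialHomeomorph.trans_target]
      exact inter_subset_left
    · change (c.trans Ψ).target ⊆ Ψ.symm ⁻¹' c.target
      rw [OpenPartialHomeomorph.trans_target]
      exact inter_subset_right

/-- Every chart restricts to box charts around each of its points. -/
lemma exists_box_restriction (hc : c ∈ IsManifold.maximalAtlas (𝓡 4) ∞ M) {p : M}
    (hp : p ∈ c.source) {U : Set E4} (hU : U ∈ 𝓝 (c p)) :
    ∃ e : OpenPartialHomeomorph M E4, IsBoxChart e ∧ p ∈ e.source ∧ e.source ⊆ c.source ∧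
      e.target ⊆ U ∧ (∀ x, e x = c x) ∧ ∀ x, chartDiff e x = chartDiff c x := by
  obtain ⟨ε, hε, hbox⟩ := exists_box_subset
    (inter_mem hU (c.open_target.mem_nhds (c.map_source hp)))
  set a : Fin 4 → ℝ := fun i => c p i - ε with ha
  set b : Fin 4 → ℝ := fun i => c p i + ε with hb
  refine ⟨c.trans (.ofSet _ (isOpen_box a b)), ⟨trans_mem_maximalAtlas hc
    (isSmoothEquiv_ofSet _), ?_⟩, ?_, ?_, ?_, fun _ => rfl, fun _ => rfl⟩
  · exact ⟨_, _, by
      rw [OpenPartialHomeomorph.trans_target]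
      exact inter_eq_left.2 fun z hz => (hbox hz).2⟩
  · rw [OpenPartialHomeomorph.trans_source]
    refine ⟨hp, fun i => ⟨?_, ?_⟩⟩ <;> simp only [ha, hb] <;> linarith
  · rw [OpenPartialHomeomorph.trans_source]; exact inter_subset_left
  · rw [OpenPartialHomeomorph.trans_target]
    exact fun z hz => (hbox hz.1).1

lemma exists_linearEquiv_of_isNullFrame {B : E4 →L[ℝ] E4 →L[ℝ] ℝ} {s l α n : E4}
    (h : IsNullFrame B s l α n) :
    ∃ A : E4 ≃L[ℝ] E4, A l = stdVec 0 ∧ A s = stdVec 1 := by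
  have hV : Module.finrank ℝ E4 = 4 := finrank_euclideanSpace_fin
  let A : E4 →ₗ[ℝ] E4 := (-(B.flip n).toLinearMap).smulRight (stdVec 0)
    + (B.flip s).toLinearMap.smulRight (stdVec 1) + (B.flip α).toLinearMap.smulRight (stdVec 2)
    + (B.flip l).toLinearMap.smulRight (stdVec 3)
  have hA : ∀ v, A v = (-B v n) • stdVec 0 + B v s • stdVec 1 + B v α • stdVec 2
      + B v l • stdVec 3 := fun v => rfl
  have hinj : Function.Injective A := by
    rw [← LinearMap.ker_eq_bot, LinearMap.ker_eq_bot']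
    intro v hv
    rw [hA] at hv
    have hi := fun i : Fin 4 => congrArg (fun u : E4 => u i) hv
    have h0 := hi 0
    have h1 := hi 1
    have h2 := hi 2
    have h3 := hi 3
    simp at h0 h1 h2 h3
    rw [h.expand hV v, h0, h1, h2, h3]
    simp
  refine ⟨(LinearEquiv.ofInjectiveEndo A hinj).toContinuousLinearEquiv, ?_, ?_⟩
  · exact (hA l).trans (by simp [h.ln, h.ls, h.lα, h.ll])
  · exact (hA s).trans (by simp [h.sn, h.ss, h.sα, h.sl])

/-- Around each point there is a chart, centred there, in which `l` is the first coordinate vector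
field, and in which a given vector completing `l` to a null frame is the second one at the centre.
-/
lemma exists_straightened_chart {g : LorentzMetric M} {l : VField M} {p : M}
    (hl : ∀ᶠ x in 𝓝 p, SmoothAt l x)
    {s α n : TangentSpace (𝓡 4) p} (h : IsNullFrame (g.val p) s (l p) α n) :
    ∃ c ∈ IsManifold.maximalAtlas (𝓡 4) ∞ M, p ∈ c.source ∧ c p = 0 ∧
      (∀ x ∈ c.source, chartDiff c x (l x) = stdVec 0) ∧ chartDiff c p s = stdVec 1 := by
  obtain ⟨A, hA0, hA1⟩ := exists_linearEquiv_of_isNullFrame (B := g.val p) (s := s) (l := l p)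
    (α := α) (n := n) ⟨h.symm, h.ss, h.αα, h.nl, h.ll, h.nn, h.ns, h.nα, h.αs, h.αl, h.sl⟩
  let c₀ := chartAt E4 p
  have hp : p ∈ c₀.source := mem_chart_source E4 p
  have hc₀ : c₀ ∈ IsManifold.maximalAtlas (𝓡 4) ∞ M := IsManifold.chart_mem_maximalAtlas p
  let Φ : OpenPartialHomeomorph E4 E4 :=
    ((Homeomorph.addRight (-c₀ p)).trans A.toHomeomorph).toOpenPartialHomeomorph
  have hΦv : ∀ y, Φ y = A (y + -c₀ p) := fun y => rfl
  have hΦ : IsSmoothEquiv Φ := by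
    constructor
    · exact (A.contDiff.comp (contDiff_id.add contDiff_const)).contDiffOn
    · exact (A.symm.contDiff.add contDiff_const).contDiffOn
  have hdΦ : ∀ v, fderiv ℝ Φ (c₀ p) v = A v := by
    intro v
    have : HasFDerivAt Φ (A : E4 →L[ℝ] E4) (c₀ p) :=
      A.hasFDerivAt.comp (c₀ p) ((hasFDerivAt_id (c₀ p)).add_const (-c₀ p))
    rw [this.fderiv]
    rfl
  let c₁ := c₀.trans Φ
  have hc₁ : c₁ ∈ IsManifold.maximalAtlas (𝓡 4) ∞ M := trans_mem_maximalAtlas hc₀ hΦ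
  have hp₁ : p ∈ c₁.source := by
    rw [OpenPartialHomeomorph.trans_source]; exact ⟨hp, mem_univ _⟩
  have hc₁p : c₁ p = 0 := by
    change Φ (c₀ p) = 0
    simp [hΦv]
  have hd₀ : ∀ v : TangentSpace (𝓡 4) p, chartDiff c₀ p v = (v : E4) := by
    intro v
    have := mfderiv_extChartAt_self (I := 𝓡 4) (x := p)
    exact congrArg (fun A => A v) this
  have hd₁ : ∀ v : TangentSpace (𝓡 4) p, chartDiff c₁ p v = A (v : E4) := by
    intro v
    rw [chartDiff_trans hc₀ hΦ hp₁, hd₀]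
    exact hdΦ v
  have h0t : (0 : E4) ∈ c₁.target := hc₁p ▸ c₁.map_source hp₁
  have hp0 : c₁.symm 0 = p := by rw [← hc₁p, c₁.left_inv hp₁]
  have hX : ∀ᶠ y in 𝓝 0, ContDiffAt ℝ ∞ (fieldIn c₁ l) y := by
    have h1 : Tendsto c₁.symm (𝓝 0) (𝓝 p) := by
      have := c₁.continuousAt_symm h0t
      rwa [ContinuousAt, hp0] at this
    filter_upwards [c₁.open_target.mem_nhds h0t, h1.eventually hl] with y hy hly
    exact contDiffAt_fieldIn hc₁ hy hly
  have hX0 : fieldIn c₁ l 0 = stdVec 0 := by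
    rw [← hc₁p, fieldIn_apply_of_mem l hp₁, hd₁]
    exact hA0
  obtain ⟨Ψ, hΨ, hΨ0, hΨ00, hΨl, hΨd⟩ := exists_straightening hX hX0
  have hp₂ : p ∈ (c₁.trans Ψ).source := by
    rw [OpenPartialHomeomorph.trans_source]
    refine ⟨hp₁, ?_⟩
    change c₁ p ∈ Ψ.source
    rwa [hc₁p]
  refine ⟨c₁.trans Ψ, trans_mem_maximalAtlas hc₁ hΨ, hp₂, ?_, ?_, ?_⟩
  · change Ψ (c₁ p) = 0
    rw [hc₁p, hΨ00]
  · intro x hx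
    rw [chartDiff_trans hc₁ hΨ hx]
    rw [OpenPartialHomeomorph.trans_source] at hx
    rw [← fieldIn_apply_of_mem l hx.1]
    exact hΨl _ hx.2
  · rw [chartDiff_trans hc₁ hΨ hp₂, hc₁p, hΨd, hd₁]
    exact hA1

/-- Around each point of `Ω` there is a chart adapted to the span of `l` and `S`, provided that
the pair is involutive. -/
lemma exists_foliatedChart {g : LorentzMetric M} {S l A n : VField M} {Ω : Set M} (hΩ : IsOpen Ω)
    (hT : IsNullTetrad g S l A n Ω) (hinv : Involutive l S Ω) {p : M} (hp : p ∈ Ω) :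
    ∃ e, IsFoliatedChart (spanDist l S) e ∧ p ∈ e.source ∧ e.source ⊆ Ω := by
  obtain ⟨c, hc, hpc, hcp, hcl, hcs⟩ := exists_straightened_chart (g := g) (l := l) (p := p)
    (by filter_upwards [hΩ.mem_nhds hp] with x hx using hT.smooth_l.smoothAt hΩ hx)
    (hT.isNullFrame hp)
  have h0t : (0 : E4) ∈ c.target := hcp ▸ c.map_source hpc
  have hp0 : c.symm 0 = p := by rw [← hcp, c.left_inv hpc]
  have hnear : ∀ᶠ y in 𝓝 (0 : E4), y ∈ c.target ∧ c.symm y ∈ Ω := by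
    have h1 : Tendsto c.symm (𝓝 0) (𝓝 p) := by
      have := c.continuousAt_symm h0t
      rwa [ContinuousAt, hp0] at this
    exact (c.open_target.mem_nhds h0t |> eventually_mem_set.2).and (h1.eventually (hΩ.mem_nhds hp))
  have hS : ∀ᶠ y in 𝓝 0, ContDiffAt ℝ ∞ (fieldIn c S) y := by
    filter_upwards [hnear] with y hy
    exact contDiffAt_fieldIn hc hy.1 (hT.smooth_s.smoothAt hΩ hy.2)
  have hS0 : fieldIn c S 0 = stdVec 1 := by
    rw [← hcp, fieldIn_apply_of_mem S hpc]
    exact hcs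
  have hspan : ∀ y, y ∈ c.target ∧ c.symm y ∈ Ω →
      fderiv ℝ (fieldIn c S) y (stdVec 0) ∈ Submodule.span ℝ {stdVec 0, fieldIn c S y} := by
    intro y hy
    have h1 := chartDiff_bracket hc hy.1 (hT.smooth_l.smoothAt hΩ hy.2)
      (hT.smooth_s.smoothAt hΩ hy.2)
    have h2 : fieldIn c l =ᶠ[𝓝 y] fun _ => stdVec 0 := by
      filter_upwards [c.open_target.mem_nhds hy.1] with z hz
      exact hcl _ (c.map_target hz)
    have h3 : VectorField.lieBracket ℝ (fieldIn c l) (fieldIn c S) y =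
        fderiv ℝ (fieldIn c S) y (stdVec 0) := by
      rw [h2.lieBracket_vectorField_eq EventuallyEq.rfl]
      simp [VectorField.lieBracket]
    rw [← h3, ← h1]
    have h4 := (fieldIn_mem_span hc (c.map_target hy.1) _ _ _).2 (hinv _ hy.2)
    rwa [hcl _ (c.map_target hy.1)] at h4
  obtain ⟨Ψ, hΨ, hΨ0, hΨ00, hΨs⟩ := exists_straightening_plane hS hS0 (hnear.mono hspan)
  have hc₂ := trans_mem_maximalAtlas hc hΨ
  have hp₂ : p ∈ (c.trans Ψ).source := by
    rw [OpenPartialHomeomorph.trans_source]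
    refine ⟨hpc, ?_⟩
    change c p ∈ Ψ.source
    rwa [hcp]
  have hU : (c.trans Ψ).symm ⁻¹' Ω ∈ 𝓝 ((c.trans Ψ) p) := by
    refine ((c.trans Ψ).continuousAt_symm ((c.trans Ψ).map_source hp₂)).preimage_mem_nhds ?_
    rw [(c.trans Ψ).left_inv hp₂]
    exact hΩ.mem_nhds hp
  obtain ⟨e, he, hpe, hec, het, hex, hed⟩ := exists_box_restriction hc₂ hp₂ hU
  refine ⟨e, ⟨he, fun x hx v => ?_⟩, hpe, fun x hx => ?_⟩
  · have hx' := hec hx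
    rw [hed, chartDiff_trans hc hΨ hx']
    rw [OpenPartialHomeomorph.trans_source] at hx'
    rw [← hΨs _ hx'.2, fieldIn_apply_of_mem S hx'.1, ← hcl x hx'.1]
    exact (fieldIn_mem_span hc hx'.1 _ _ _).symm
  · have h1 := het (e.map_source hx)
    rw [hex] at h1
    have h2 : (c.trans Ψ).symm ((c.trans Ψ) x) ∈ Ω := h1
    rwa [(c.trans Ψ).left_inv (hec hx)] at h2

end Charts

/-! ### Functions that are constant along some coordinates -/

lemma fderiv_comp_clm_eq_zero {E F G : Type*} [NormedAddCommGroup E] [NormedSpace ℝ E]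
    [NormedAddCommGroup F] [NormedSpace ℝ F] [NormedAddCommGroup G] [NormedSpace ℝ G]
    {T : E →L[ℝ] F} {h : F → G} {f : E → G} {y v : E} (hf : f =ᶠ[𝓝 y] fun z => h (T z))
    (hd : DifferentiableAt ℝ f y) (hv : T v = 0) : fderiv ℝ f y v = 0 := by
  rw [← hd.lineDeriv_eq_fderiv, hf.lineDeriv_eq]
  simp [lineDeriv, hv]

/-! ### Solutions of the transport equation -/

section Transport

variable {M : Type*} [TopologicalSpace M] [ChartedSpace E4 M]

lemma contMDiffOn_iff_contDiffOn_symm {e : OpenPartialHomeomorph M E4}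
    (he : e ∈ IsManifold.maximalAtlas (𝓡 4) ∞ M) {f : M → ℝ} :
    ContMDiffOn (𝓡 4) 𝓘(ℝ, ℝ) ∞ f e.source ↔ ContDiffOn ℝ ∞ (fun y => f (e.symm y)) e.target := by
  constructor
  · intro hf y hy
    exact (contDiffAt_comp_symm he hy
      (hf.contMDiffAt (e.open_source.mem_nhds (e.map_target hy)))).contDiffWithinAt
  · intro hf
    refine (hf.contMDiffOn.comp (contMDiffOn_of_mem_maximalAtlas he) e.mapsTo).congr ?_
    intro x hx
    simp [e.left_inv hx]

variable [IsManifold (𝓡 4) ∞ M]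

/-- Solving the transport equation in a chart that straightens `l`: the solutions differ by
functions of the last three coordinates. -/
theorem exists_transport_chart {g : LorentzMetric M} {s l α n : VField M}
    (h : IsNullTetrad g s l α n univ) (p : M) :
    ∃ (e : OpenPartialHomeomorph M E4) (Θ₀ : M → ℝ),
      IsBoxChart e ∧ p ∈ e.source ∧ (∀ x ∈ e.source, chartDiff e x (l x) = stdVec 0) ∧
      ∀ Θ : M → ℝ,
        (ContMDiffOn (𝓡 4) 𝓘(ℝ, ℝ) ∞ Θ e.source ∧ Transport g s l α Θ e.source) ↔
        ∃ h : ℝ × ℝ × ℝ → ℝ,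
          ContDiffOn ℝ ∞ h ((fun x => (e x 1, e x 2, e x 3)) '' e.source) ∧
          ∀ x ∈ e.source, Θ x = Θ₀ x + h (e x 1, e x 2, e x 3) := by
  have hs := fun x => h.smooth_s.smoothAt isOpen_univ (mem_univ x)
  have hl := fun x => h.smooth_l.smoothAt isOpen_univ (mem_univ x)
  have hα := fun x => h.smooth_α.smoothAt isOpen_univ (mem_univ x)
  obtain ⟨c, hc, hpc, hcp, hcl, -⟩ := exists_straightened_chart (g := g) (l := l) (p := p)
    (.of_forall hl) (h.isNullFrame (mem_univ p))
  have hf : ∀ᶠ y in 𝓝 (c p),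
      ContDiffAt ℝ ∞ (fun y => -g.ip (bracket l s) α (c.symm y)) y := by
    filter_upwards [c.open_target.mem_nhds (c.map_source hpc)] with y hy
    exact (contDiffAt_comp_symm hc hy
      (smoothAt_ip g (smoothAt_bracket (hl _) (hs _)) (hα _))).neg
  obtain ⟨θ₀, hθ₀, hθ₀f⟩ := exists_smooth_primitive hf (ℓ := stdCovec 0) (v := stdVec 0)
    (by simp [stdCovec])
  obtain ⟨e, he, hpe, hec, het, hex, hed⟩ := exists_box_restriction hc hpc
    (inter_mem hθ₀f (c.open_target.mem_nhds (c.map_source hpc)))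
  have hel : ∀ x ∈ e.source, chartDiff e x (l x) = stdVec 0 := by
    intro x hx
    rw [hed, hcl x (hec hx)]
  -- in the chart, the transport equation prescribes the derivative along the first coordinate
  have hsymm : ∀ y ∈ e.target, c.symm y = e.symm y := by
    intro y hy
    have h1 := hex (e.symm y)
    rw [e.right_inv hy] at h1
    conv_lhs => rw [h1]
    exact c.left_inv (hec (e.map_target hy))
  have hθ₀' : ∀ y ∈ e.target, fderiv ℝ θ₀ y (stdVec 0) = -g.ip (bracket l s) α (e.symm y) := by
    intro y hy
    rw [← hsymm y hy]
    exact (het hy).1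
  have htr : ∀ Θ : M → ℝ, ContMDiffOn (𝓡 4) 𝓘(ℝ, ℝ) ∞ Θ e.source →
      (Transport g s l α Θ e.source ↔ ∀ y ∈ e.target,
        fderiv ℝ (fun y => Θ (e.symm y) - θ₀ y) y (stdVec 0) = 0) := by
    intro Θ hΘ
    have key : ∀ y ∈ e.target, (dirDeriv l Θ (e.symm y) = -g.ip (bracket l s) α (e.symm y) ↔
        fderiv ℝ (fun y => Θ (e.symm y) - θ₀ y) y (stdVec 0) = 0) := by
      intro y hy
      have hm := hΘ.contMDiffAt (e.open_source.mem_nhds (e.map_target hy))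
      have hd := (contDiffAt_comp_symm he.mem_atlas hy hm).differentiableAt (by simp)
      have hd₀ := hθ₀.contDiffAt (x := y).differentiableAt (by simp)
      rw [dirDeriv_eq_fderiv he.mem_atlas l hy (hm.mdifferentiableAt (by simp)),
        fderiv_fun_sub hd hd₀, sub_apply, hθ₀' y hy, sub_eq_zero]
      have : fieldIn e l y = stdVec 0 := hel _ (e.map_target hy)
      rw [this]
    constructor
    · intro hT y hy
      exact (key y hy).1 (hT _ (e.map_target hy))
    · intro hT x hx
      have := (key (e x) (e.map_source hx)).2 (hT _ (e.map_source hx))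
      rwa [e.left_inv hx] at this
  refine ⟨e, fun x => θ₀ (e x), he, hpe, hel, fun Θ => ?_⟩
  obtain ⟨a, b, hbox⟩ := he.box
  have hbox : e.target = box a b := hbox
  have hy₀ : e p ∈ e.target := e.map_source hpe
  set q := e p with hq
  constructor
  · rintro ⟨hΘ, hT⟩
    have hT := (htr Θ hΘ).1 hT
    have hd : ContDiffOn ℝ ∞ (fun y => Θ (e.symm y) - θ₀ y) e.target :=
      ((contMDiffOn_iff_contDiffOn_symm he.mem_atlas).1 hΘ).sub hθ₀.contDiffOn
    set d : E4 → ℝ := fun y => Θ (e.symm y) - θ₀ y with hd_def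
    -- restrict the difference to the slice of the box through `p`, where `y⁰` is constant
    let J : ℝ × ℝ × ℝ → E4 := fun z => !₂[q 0, z.1, z.2.1, z.2.2]
    have hJs : ContDiff ℝ ∞ J := by
      rw [contDiff_euclidean]
      intro i
      fin_cases i
      · exact contDiff_const
      · exact contDiff_fst
      · exact contDiff_fst.comp contDiff_snd
      · exact contDiff_snd.comp contDiff_snd
    have hJ : ∀ y ∈ e.target, J (y 1, y 2, y 3) ∈ e.target := by
      intro y hy
      rw [hbox] at hy hy₀ ⊢
      intro i
      fin_cases i
      · exact hy₀ 0
      · exact hy 1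
      · exact hy 2
      · exact hy 3
    refine ⟨fun z => d (J z), ?_, ?_⟩
    · refine hd.comp hJs.contDiffOn ?_
      rintro _ ⟨x, hx, rfl⟩
      exact hJ _ (e.map_source hx)
    · intro x hx
      have hy := e.map_source hx
      have h1 : d (e x) = d (J (e x 1, e x 2, e x 3)) := by
        refine eq_of_fderiv_sub_eq_zero (s := e.target) (hbox ▸ convex_box a b)
          (fun z hz => (hd.contDiffAt (e.open_target.mem_nhds hz)).differentiableAt (by simp))
          hy (hJ _ hy) (fun z hz => ?_)
        have : J (e x 1, e x 2, e x 3) - e x = (q 0 - e x 0) • stdVec 0 := by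
          ext i
          fin_cases i <;> simp [J]
        rw [this, map_smul, hT z hz, smul_zero]
      have h2 : d (e x) = Θ x - θ₀ (e x) := by simp [hd_def, e.left_inv hx]
      simp only
      rw [← h1, h2]
      ring
  · rintro ⟨k, hk, hΘ⟩
    let T : E4 →L[ℝ] ℝ × ℝ × ℝ := (stdCovec 1).prod ((stdCovec 2).prod (stdCovec 3))
    have hT : ∀ y : E4, T y = (y 1, y 2, y 3) := fun y => rfl
    have hkT : ContDiffOn ℝ ∞ (fun y => k (T y)) e.target := by
      refine hk.comp T.contDiff.contDiffOn fun y hy => ⟨e.symm y, e.map_target hy, ?_⟩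
      simp [e.right_inv hy, hT]
    have heq : ∀ y ∈ e.target, Θ (e.symm y) = θ₀ y + k (T y) := by
      intro y hy
      rw [hΘ _ (e.map_target hy), hT]
      simp only [e.right_inv hy]
    have hs : ContMDiffOn (𝓡 4) 𝓘(ℝ, ℝ) ∞ Θ e.source := by
      rw [contMDiffOn_iff_contDiffOn_symm he.mem_atlas]
      exact (hθ₀.contDiffOn.add hkT).congr heq
    refine ⟨hs, (htr Θ hs).2 fun y hy => ?_⟩
    have hev : (fun y => Θ (e.symm y) - θ₀ y) =ᶠ[𝓝 y] fun y => k (T y) := by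
      filter_upwards [e.open_target.mem_nhds hy] with z hz
      simp [heq z hz]
    refine fderiv_comp_clm_eq_zero hev ?_ (by simp [hT])
    exact ((hkT.contDiffAt (e.open_target.mem_nhds hy)).congr_of_eventuallyEq
      hev).differentiableAt (by simp)

end Transport

/-! ### The Hodge star in a null frame -/

lemma finrank_E4 : Module.finrank ℝ E4 = 4 := finrank_euclideanSpace_fin

lemma stdCovec_apply (a : Fin 4) (v : E4) : stdCovec a v = v a := rfl

lemma clm_eq_sum_stdVec {F : Type*} [AddCommGroup F] [Module ℝ F]
    (L : E4 →ₗ[ℝ] F) (v : E4) : L v = ∑ a, v a • L (stdVec a) := by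
  conv_lhs => rw [eq_sum_stdVec v]
  simp only [map_sum, map_smul]

/-- A permutation of the arguments does not affect whether an alternating form vanishes, nor does a
repetition. -/
lemma alternating_eq_zero_comp {E : Type*} [AddCommGroup E] [Module ℝ E] [TopologicalSpace E]
    {k : ℕ} {H : E [⋀^Fin k]→L[ℝ] ℝ} {v : Fin k → E} (h : H v = 0) (r : Fin k → Fin k) :
    H (v ∘ r) = 0 := by
  by_cases hr : Function.Injective r
  · have := H.toAlternatingMap.map_perm v
      (Equiv.ofBijective r (Finite.injective_iff_bijective.1 hr))
    have h2 : H (v ∘ r) = _ := this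
    rw [h2]
    have h3 : H.toAlternatingMap v = 0 := h
    rw [h3, smul_zero]
  · simp only [Function.Injective, not_forall] at hr
    obtain ⟨i, j, hij, hne⟩ := hr
    exact H.map_eq_zero_of_eq (v ∘ r) (by simp [hij]) hne

namespace IsNullFrame

variable {G : E4 →L[ℝ] E4 →L[ℝ] ℝ} {s l α n : E4}

/-- The musical isomorphism in a null frame. -/
lemma inverse_apply (h : IsNullFrame G s l α n) (β : E4 →L[ℝ] ℝ) :
    G.inverse β = β s • s - β n • l + β α • α - β l • n := by
  let R : (E4 →L[ℝ] ℝ) →L[ℝ] E4 :=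
    (ContinuousLinearMap.apply ℝ ℝ s).smulRight s - (ContinuousLinearMap.apply ℝ ℝ n).smulRight l +
      (ContinuousLinearMap.apply ℝ ℝ α).smulRight α - (ContinuousLinearMap.apply ℝ ℝ l).smulRight n
  have hR : ∀ β, R β = β s • s - β n • l + β α • α - β l • n := fun β => rfl
  have h1 : G ∘L R = .id ℝ _ := by
    ext β w
    simp only [ContinuousLinearMap.comp_apply, hR, ContinuousLinearMap.id_apply]
    conv_rhs => rw [h.expand finrank_E4 w]
    simp [h.symm w]
    ring
  have h2 : R ∘L G = .id ℝ _ := by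
    ext1 v
    simp only [ContinuousLinearMap.comp_apply, hR, ContinuousLinearMap.id_apply]
    exact (h.expand finrank_E4 v).symm
  rw [ContinuousLinearMap.inverse_eq h1 h2, hR]

lemma apply_inverse (h : IsNullFrame G s l α n) (β : E4 →L[ℝ] ℝ) (w : E4) :
    G w (G.inverse β) = β w := by
  rw [h.inverse_apply]
  conv_rhs => rw [h.expand finrank_E4 w]
  simp
  ring

/-- The vectors `(s, -n, α, -l)` are the dual frame of `(s, l, α, n)` for the scalar product. -/
lemma inverse_eq_sum (h : IsNullFrame G s l α n) (β : E4 →L[ℝ] ℝ) :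
    G.inverse β = ∑ i, β (![s, l, α, n] i) • ![s, -n, α, -l] i := by
  rw [h.inverse_apply, Fin.sum_univ_four]
  simp
  module

/-- Contraction of two covectors, in coordinates and in a null frame. -/
lemma contraction (h : IsNullFrame G s l α n) (L₁ L₂ : E4 →ₗ[ℝ] ℝ) :
    ∑ a, L₁ (G.inverse (stdCovec a)) * L₂ (stdVec a) =
      ∑ i, L₁ (![s, -n, α, -l] i) * L₂ (![s, l, α, n] i) := by
  simp only [h.inverse_eq_sum, map_sum, map_smul, smul_eq_mul, Finset.sum_mul]
  rw [Finset.sum_comm]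
  refine Finset.sum_congr rfl fun i _ => ?_
  rw [clm_eq_sum_stdVec L₂ (![s, l, α, n] i), Finset.mul_sum]
  refine Finset.sum_congr rfl fun a _ => ?_
  simp [stdCovec]
  ring

/-- A 2-form annihilated by `α` and `l` is a multiple of `s^♭ ∧ l^♭`. -/
lemma twoForm_eq_smul_wedge (h : IsNullFrame G s l α n) {θ : E4 [⋀^Fin 2]→L[ℝ] ℝ}
    (hα : ∀ w, θ ![α, w] = 0) (hl : ∀ w, θ ![l, w] = 0) :
    θ = (-θ ![s, n]) • wedge (G s) (G l) := by
  have hα' : ∀ w, θ ![w, α] = 0 := fun w => by rw [twoForm_swap, hα, neg_zero]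
  have hl' : ∀ w, θ ![w, l] = 0 := fun w => by rw [twoForm_swap, hl, neg_zero]
  refine twoForm_ext fun v w => ?_
  rw [ContinuousAlternatingMap.smul_apply, wedge_apply]
  conv_lhs => rw [← twoFormBilin_apply, h.expand finrank_E4 v, h.expand finrank_E4 w]
  simp only [map_add, map_sub, map_smul, LinearMap.add_apply, LinearMap.sub_apply,
    LinearMap.smul_apply, twoFormBilin_apply, hα, hl, hα', hl', twoForm_self, smul_eq_mul]
  rw [twoForm_swap θ n s, h.symm s v, h.symm l w, h.symm s w, h.symm l v]
  ring

/-- The null frame with the roles of the two spacelike vectors exchanged. -/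
lemma swap (h : IsNullFrame G s l α n) : IsNullFrame G α l s n :=
  ⟨h.symm, h.αα, h.ss, h.nl, h.ll, h.nn, h.nα, h.ns, h.sα, h.sl, h.αl⟩

end IsNullFrame

/-! ### The volume form -/

lemma curryLeft_curryLeft_apply (v : E4 [⋀^Fin 4]→L[ℝ] ℝ) (a b : E4) (u : Fin 2 → E4) :
    ((v.curryLeft a).curryLeft b) u = v ![a, b, u 0, u 1] := by
  have : v ![a, b, u 0, u 1] = v (Matrix.vecCons a (Matrix.vecCons b u)) := by
    congr 1
    ext1 i; fin_cases i <;> rfl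
  rw [this]
  rfl

/-- The volume of a null frame, in the order `(α, l, s, n)`, for the volume form of the scalar
product. -/
def frameVolume (G : E4 →L[ℝ] E4 →L[ℝ] ℝ) (s l α n : E4) : ℝ := volForm G ![α, l, s, n]

/-- A null frame has volume `±1`, since its Gram matrix has determinant `-1`. -/
lemma frameVolume_sq {G : E4 →L[ℝ] E4 →L[ℝ] ℝ} {s l α n : E4} (h : IsNullFrame G s l α n) :
    frameVolume G s l α n ^ 2 = 1 := by
  let f : Fin 4 → E4 := ![α, l, s, n]
  let P : Matrix (Fin 4) (Fin 4) ℝ := Matrix.of fun a i => f i a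
  let Γ : Matrix (Fin 4) (Fin 4) ℝ := Matrix.of fun a b => G (stdVec a) (stdVec b)
  have hdet : detForm f = P.det := by
    change (EuclideanSpace.basisFun (Fin 4) ℝ).toBasis.det f = _
    rw [Module.Basis.det_apply]
    rfl
  have hgram : Matrix.of (fun i j => G (f i) (f j)) = P.transpose * Γ * P := by
    ext i j
    simp only [Matrix.of_apply, Matrix.mul_apply, Matrix.transpose_apply, P, Γ]
    conv_lhs => rw [eq_sum_stdVec (f i), eq_sum_stdVec (f j)]
    simp only [map_sum, map_smul, sum_apply, smul_apply, smul_eq_mul, Finset.sum_mul,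
      Finset.mul_sum]
    exact Finset.sum_congr rfl fun a _ => Finset.sum_congr rfl fun b _ => by ring
  have hgd : (Matrix.of (fun i j => G (f i) (f j))).det = -1 := by
    have : Matrix.of (fun i j => G (f i) (f j)) =
        !![1, 0, 0, 0; 0, 0, 0, -1; 0, 0, 1, 0; 0, -1, 0, 0] := by
      ext i j
      fin_cases i <;> fin_cases j <;>
        simp [f, h.ss, h.ls, h.αs, h.ns, h.sn, h.ln, h.αn, h.nn, h.sα, h.lα, h.αα, h.nα, h.sl,
          h.ll, h.αl, h.nl]
    rw [this]
    simp [Matrix.det_succ_row_zero, Fin.sum_univ_succ]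
  rw [hgram, Matrix.det_mul, Matrix.det_mul, Matrix.det_transpose] at hgd
  have hv : frameVolume G s l α n = Real.sqrt |Γ.det| * P.det := by
    rw [← hdet]; rfl
  rw [hv, mul_pow, Real.sq_sqrt (abs_nonneg _), ← abs_of_nonneg (sq_nonneg P.det), ← abs_mul]
  rw [show Γ.det * P.det ^ 2 = -1 by linarith]
  norm_num

namespace IsNullFrame

variable {G : E4 →L[ℝ] E4 →L[ℝ] ℝ} {s l α n : E4}

/-- The Hodge star maps `α^♭ ∧ l^♭` to a multiple of `s^♭ ∧ l^♭`: it is the volume form with `α` and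
`l` inserted, hence annihilated by `α` and `l`. -/
lemma star2_wedge (h : IsNullFrame G s l α n) (φ : ℝ) :
    star2 G (φ • wedge (G α) (G l)) = (-(φ * frameVolume G s l α n)) • wedge (G s) (G l) := by
  have key : star2 G (φ • wedge (G α) (G l)) = φ • ((volForm G).curryLeft α).curryLeft l := by
    refine twoForm_ext fun x y => ?_
    simp only [star2, ContinuousAlternatingMap.smul_apply, ContinuousAlternatingMap.sum_apply,
      wedge_apply, smul_eq_mul, curryLeft_curryLeft_apply, Matrix.cons_val_zero,
      Matrix.cons_val_one]
    have e1 : ∀ v w : E4, volForm G ![v, w, x, y] =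
        ((volForm G).curryLeft x).curryLeft y ![v, w] := by
      intro v w
      rw [curryLeft_curryLeft_apply]
      have hp := (volForm G).toAlternatingMap.map_perm ![x, y, v, w]
        (Equiv.swap 0 2 * Equiv.swap 1 3)
      have hs : Equiv.Perm.sign (Equiv.swap (0 : Fin 4) 2 * Equiv.swap 1 3) = 1 := by decide
      rw [hs, one_smul] at hp
      have hv : ![x, y, v, w] ∘ (Equiv.swap (0 : Fin 4) 2 * Equiv.swap 1 3 : Equiv.Perm (Fin 4)) =
          ![v, w, x, y] := by
        ext1 i; fin_cases i <;> rfl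
      rw [hv] at hp
      exact hp
    simp only [h.apply_inverse, e1]
    rw [twoForm_eq_sum _ α l]
    have e2 := twoForm_eq_sum (((volForm G).curryLeft x).curryLeft y) l α
    rw [twoForm_swap, twoForm_eq_sum _ α l] at e2
    have e3 : ∀ a b : Fin 4, φ * (stdCovec a α * stdCovec b l - stdCovec b α * stdCovec a l) *
        ((volForm G).curryLeft x).curryLeft y ![stdVec a, stdVec b] =
        φ * (α a * l b * ((volForm G).curryLeft x).curryLeft y ![stdVec a, stdVec b]) -
        φ * (l a * α b * ((volForm G).curryLeft x).curryLeft y ![stdVec a, stdVec b]) := by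
      intro a b
      simp only [stdCovec_apply]
      ring
    simp only [e3, Finset.sum_sub_distrib, ← Finset.mul_sum]
    rw [← e2]
    ring
  have h2 := h.twoForm_eq_smul_wedge (θ := ((volForm G).curryLeft α).curryLeft l)
    (fun w => by
      rw [curryLeft_curryLeft_apply]
      exact (volForm G).map_eq_zero_of_eq _ (i := 0) (j := 2) rfl (by decide))
    (fun w => by
      rw [curryLeft_curryLeft_apply]
      exact (volForm G).map_eq_zero_of_eq _ (i := 1) (j := 2) rfl (by decide))
  have h3 : ((volForm G).curryLeft α).curryLeft l ![s, n] = frameVolume G s l α n := by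
    rw [curryLeft_curryLeft_apply]; rfl
  rw [key, h2, h3, smul_smul]
  congr 1
  ring

/-- The invariant `F_{ab} F^{ab}` of `φ α^♭ ∧ l^♭` vanishes because `l` is null and orthogonal to
`α`. -/
lemma normSq2_wedge (h : IsNullFrame G s l α n) (φ : ℝ) :
    normSq2 G (φ • wedge (G α) (G l)) = 0 := by
  have e1 : ∀ a b : Fin 4, (φ • wedge (G α) (G l)) ![stdVec a, stdVec b] *
      (φ • wedge (G α) (G l)) ![G.inverse (stdCovec a), G.inverse (stdCovec b)] =
      φ * (α a * l b * (φ • wedge (G α) (G l)) ![stdVec a, stdVec b])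
      - φ * (l a * α b * (φ • wedge (G α) (G l)) ![stdVec a, stdVec b]) := by
    intro a b
    have : (φ • wedge (G α) (G l)) ![G.inverse (stdCovec a), G.inverse (stdCovec b)] =
        φ * (α a * l b - α b * l a) := by
      rw [ContinuousAlternatingMap.smul_apply, wedge_apply]
      simp only [h.apply_inverse, stdCovec_apply, smul_eq_mul]
    rw [this]
    ring
  unfold normSq2
  simp only [e1, Finset.sum_sub_distrib, ← Finset.mul_sum, ← twoForm_eq_sum]
  simp [wedge_apply, h.ll, h.αl, h.lα]

/-- Contraction of a 3-form with the first three arguments of a 4-form, in coordinates and in a null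
frame. -/
lemma contraction₃ (h : IsNullFrame G s l α n) (H : E4 [⋀^Fin 3]→L[ℝ] ℝ)
    (η : E4 [⋀^Fin 4]→L[ℝ] ℝ) (d : E4) :
    ∑ a, ∑ b, ∑ c, H ![G.inverse (stdCovec a), G.inverse (stdCovec b), G.inverse (stdCovec c)] *
      η ![stdVec a, stdVec b, stdVec c, d] =
    ∑ i, ∑ j, ∑ k, H ![![s, -n, α, -l] i, ![s, -n, α, -l] j, ![s, -n, α, -l] k] *
      η ![![s, l, α, n] i, ![s, l, α, n] j, ![s, l, α, n] k, d] := by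
  set f := ![s, l, α, n]
  set f' := ![s, -n, α, -l]
  have lin3 : ∀ (i : Fin 3) (u : Fin 3 → E4), ∃ L : E4 →ₗ[ℝ] ℝ,
      ∀ v, L v = H (Function.update u i v) := fun i u =>
    ⟨H.toMultilinearMap.toLinearMap u i, fun v => rfl⟩
  have lin4 : ∀ (i : Fin 4) (u : Fin 4 → E4), ∃ L : E4 →ₗ[ℝ] ℝ,
      ∀ v, L v = η (Function.update u i v) := fun i u =>
    ⟨η.toMultilinearMap.toLinearMap u i, fun v => rfl⟩
  have u30 : ∀ x y z v : E4, Function.update ![x, y, z] 0 v = ![v, y, z] := by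
    intro x y z v; ext1 i; fin_cases i <;> rfl
  have u31 : ∀ x y z v : E4, Function.update ![x, y, z] 1 v = ![x, v, z] := by
    intro x y z v; ext1 i; fin_cases i <;> rfl
  have u32 : ∀ x y z v : E4, Function.update ![x, y, z] 2 v = ![x, y, v] := by
    intro x y z v; ext1 i; fin_cases i <;> rfl
  have u40 : ∀ x y z t v : E4, Function.update ![x, y, z, t] 0 v = ![v, y, z, t] := by
    intro x y z t v; ext1 i; fin_cases i <;> rfl
  have u41 : ∀ x y z t v : E4, Function.update ![x, y, z, t] 1 v = ![x, v, z, t] := by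
    intro x y z t v; ext1 i; fin_cases i <;> rfl
  have u42 : ∀ x y z t v : E4, Function.update ![x, y, z, t] 2 v = ![x, y, v, t] := by
    intro x y z t v; ext1 i; fin_cases i <;> rfl
  have c2 : ∀ x y x' y' : E4, ∑ c, H ![x, y, G.inverse (stdCovec c)] * η ![x', y', stdVec c, d] =
      ∑ k, H ![x, y, f' k] * η ![x', y', f k, d] := by
    intro x y x' y'
    obtain ⟨L, hL⟩ := lin3 2 ![x, y, 0]
    obtain ⟨L', hL'⟩ := lin4 2 ![x', y', 0, d]
    simpa only [hL, hL', u32, u42] using h.contraction L L'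
  have c1 : ∀ x z x' z' : E4, ∑ c, H ![x, G.inverse (stdCovec c), z] * η ![x', stdVec c, z', d] =
      ∑ k, H ![x, f' k, z] * η ![x', f k, z', d] := by
    intro x z x' z'
    obtain ⟨L, hL⟩ := lin3 1 ![x, 0, z]
    obtain ⟨L', hL'⟩ := lin4 1 ![x', 0, z', d]
    simpa only [hL, hL', u31, u41] using h.contraction L L'
  have c0 : ∀ y z y' z' : E4, ∑ c, H ![G.inverse (stdCovec c), y, z] * η ![stdVec c, y', z', d] =
      ∑ k, H ![f' k, y, z] * η ![f k, y', z', d] := by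
    intro y z y' z'
    obtain ⟨L, hL⟩ := lin3 0 ![0, y, z]
    obtain ⟨L', hL'⟩ := lin4 0 ![0, y', z', d]
    simpa only [hL, hL', u30, u40] using h.contraction L L'
  simp only [c2]
  simp only [fun a : Fin 4 => Finset.sum_comm (s := Finset.univ) (t := Finset.univ)
    (f := fun b k => H ![G.inverse (stdCovec a), G.inverse (stdCovec b), f' k] *
      η ![stdVec a, stdVec b, f k, d])]
  simp only [c1]
  rw [Finset.sum_comm]
  simp only [fun k : Fin 4 => Finset.sum_comm (s := Finset.univ) (t := Finset.univ)
    (f := fun a j => H ![G.inverse (stdCovec a), f' j, f' k] * η ![stdVec a, f j, f k, d])]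
  simp only [c0]
  rw [Finset.sum_comm]
  exact (Finset.sum_congr rfl fun y _ => Finset.sum_comm).trans Finset.sum_comm

/-- The component of `*H` along a frame vector is, up to a factor, the component of `H` along the
duals of the other three frame vectors. -/
lemma star3_eq_zero (h : IsNullFrame G s l α n) {H : E4 [⋀^Fin 3]→L[ℝ] ℝ} (m : Fin 4)
    (hH : H (fun r => ![s, -n, α, -l] (m.succAbove r)) = 0) :
    star3 G H (![s, l, α, n] m) = 0 := by
  have e : star3 G H (![s, l, α, n] m) = (1 / 6 : ℝ) * ∑ a, ∑ b, ∑ c,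
      H ![G.inverse (stdCovec a), G.inverse (stdCovec b), G.inverse (stdCovec c)] *
      volForm G ![stdVec a, stdVec b, stdVec c, ![s, l, α, n] m] := by
    simp only [star3, smul_apply, sum_apply, smul_eq_mul]
    congr 1
  rw [e, h.contraction₃]
  refine mul_eq_zero_of_right _ (Finset.sum_eq_zero fun i _ => Finset.sum_eq_zero fun j _ =>
    Finset.sum_eq_zero fun k _ => ?_)
  by_cases hi : i = m
  · exact mul_eq_zero_of_right _ ((volForm G).map_eq_zero_of_eq _ (i := 0) (j := 3)
      (by simp [hi]) (by decide))
  by_cases hj : j = m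
  · exact mul_eq_zero_of_right _ ((volForm G).map_eq_zero_of_eq _ (i := 1) (j := 3)
      (by simp [hj]) (by decide))
  by_cases hk : k = m
  · exact mul_eq_zero_of_right _ ((volForm G).map_eq_zero_of_eq _ (i := 2) (j := 3)
      (by simp [hk]) (by decide))
  obtain ⟨i, rfl⟩ := Fin.exists_succAbove_eq hi
  obtain ⟨j, rfl⟩ := Fin.exists_succAbove_eq hj
  obtain ⟨k, rfl⟩ := Fin.exists_succAbove_eq hk
  refine mul_eq_zero_of_left ?_ _
  have h2 := alternating_eq_zero_comp hH ![i, j, k]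
  convert h2 using 2
  ext1 r
  fin_cases r <;> rfl

end IsNullFrame

/-! ### The current of a field with involutive kernel, in coordinates -/

open VectorField in
/-- Cartan's formula for the exterior derivative of a 2-form. -/
lemma extDeriv_twoForm_apply {F : E4 → E4 [⋀^Fin 2]→L[ℝ] ℝ} {U V W : E4 → E4} {y : E4}
    (hF : DifferentiableAt ℝ F y) (hU : DifferentiableAt ℝ U y) (hV : DifferentiableAt ℝ V y)
    (hW : DifferentiableAt ℝ W y) :
    extDeriv F y ![U y, V y, W y] =
      fderiv ℝ (fun z => F z ![V z, W z]) y (U y) - fderiv ℝ (fun z => F z ![U z, W z]) y (V y)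
        + fderiv ℝ (fun z => F z ![U z, V z]) y (W y) - F y ![lieBracket ℝ U V y, W y]
        + F y ![lieBracket ℝ U W y, V y] - F y ![lieBracket ℝ V W y, U y] := by
  have h := extDeriv_apply_vectorField (V := ![U, V, W]) hF (by
    intro i; fin_cases i
    · exact hU
    · exact hV
    · exact hW)
  have e : (fun i => (![U, V, W] : Fin 3 → E4 → E4) i y) = ![U y, V y, W y] := by
    ext1 i; fin_cases i <;> rfl
  have r0 : ∀ z, (0 : Fin 3).removeNth (fun i => (![U, V, W] : Fin 3 → E4 → E4) i z) =
      ![V z, W z] := by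
    intro z; ext1 i; fin_cases i <;> rfl
  have r1 : ∀ z, (1 : Fin 3).removeNth (fun i => (![U, V, W] : Fin 3 → E4 → E4) i z) =
      ![U z, W z] := by
    intro z; ext1 i; fin_cases i <;> rfl
  have r2 : ∀ z, (2 : Fin 3).removeNth (fun i => (![U, V, W] : Fin 3 → E4 → E4) i z) =
      ![U z, V z] := by
    intro z; ext1 i; fin_cases i <;> rfl
  rw [e] at h
  rw [h]
  have i0 : (Finset.Ici (0 : Fin 2)) = {0, 1} := by decide
  have i1 : (Finset.Ici (1 : Fin 2)) = {1} := by decide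
  have s0 : ∀ v w : E4, (0 : Fin 2).removeNth ![v, w] = ![w] := by
    intro v w; ext1 i; fin_cases i; rfl
  have s1 : ∀ v w : E4, (1 : Fin 2).removeNth ![v, w] = ![v] := by
    intro v w; ext1 i; fin_cases i; rfl
  refine (congrArg₂ (· - ·) (Fin.sum_univ_three _) (Fin.sum_univ_two _)).trans ?_
  have t0 : Fin.removeNth (Fin.castSucc (0 : Fin 2)) ![U y, V y, W y] = ![V y, W y] :=
    r0 y ▸ e ▸ rfl
  have t1 : Fin.removeNth (Fin.castSucc (1 : Fin 2)) ![U y, V y, W y] = ![U y, W y] :=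
    r1 y ▸ e ▸ rfl
  simp only [r0, r1, r2, t0, t1, i0, i1, Finset.sum_pair (zero_ne_one (α := Fin 2)),
    Finset.sum_singleton, s0, s1]
  simp
  ring

section Local

variable {G : E4 → E4 →L[ℝ] E4 →L[ℝ] ℝ} {S L A N : E4 → E4} {φ : E4 → ℝ} {y : E4}

/-- A smooth field of null frames near `y`. -/
structure IsSmoothNullFrameAt (G : E4 → E4 →L[ℝ] E4 →L[ℝ] ℝ) (S L A N : E4 → E4) (y : E4) :
    Prop where
  frame : ∀ᶠ z in 𝓝 y, IsNullFrame (G z) (S z) (L z) (A z) (N z)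
  metric : ContDiffAt ℝ ∞ G y
  s : ContDiffAt ℝ ∞ S y
  l : ContDiffAt ℝ ∞ L y
  α : ContDiffAt ℝ ∞ A y
  n : ContDiffAt ℝ ∞ N y

lemma IsSmoothNullFrameAt.swap (h : IsSmoothNullFrameAt G S L A N y) :
    IsSmoothNullFrameAt G A L S N y :=
  ⟨h.frame.mono fun _ hz => hz.swap, h.metric, h.α, h.l, h.s, h.n⟩

lemma IsSmoothNullFrameAt.contDiffAt_wedge (h : IsSmoothNullFrameAt G S L A N y)
    (hφ : ContDiffAt ℝ ∞ φ y) :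
    ContDiffAt ℝ ∞ (fun z => φ z • wedge (G z (S z)) (G z (L z))) y :=
  hφ.smul (NullFFE.contDiffAt_wedge (h.metric.clm_apply h.s) (h.metric.clm_apply h.l))

open VectorField in
/-- Only the term with `[L, A]` survives in Cartan's formula, and it is a multiple of
`g([L, A], L)`. -/
lemma IsSmoothNullFrameAt.extDeriv_wedge_lsα (h : IsSmoothNullFrameAt G S L A N y)
    (hφ : ContDiffAt ℝ ∞ φ y) (hgeo : G y (lieBracket ℝ L A y) (L y) = 0) :
    extDeriv (fun z => φ z • wedge (G z (S z)) (G z (L z))) y ![L y, S y, A y] = 0 := by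
  have d : ∀ {X : E4 → E4}, ContDiffAt ℝ ∞ X y → DifferentiableAt ℝ X y :=
    fun hX => hX.differentiableAt (by simp)
  have hy := h.frame.self_of_nhds
  rw [extDeriv_twoForm_apply ((h.contDiffAt_wedge hφ).differentiableAt (by simp)) (d h.l) (d h.s)
    (d h.α)]
  have z1 : (fun z => (φ z • wedge (G z (S z)) (G z (L z))) ![S z, A z]) =ᶠ[𝓝 y] fun _ => 0 := by
    filter_upwards [h.frame] with z hz
    simp [wedge_apply, hz.lα, hz.ls, hz.sα]
  have z2 : (fun z => (φ z • wedge (G z (S z)) (G z (L z))) ![L z, A z]) =ᶠ[𝓝 y] fun _ => 0 := by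
    filter_upwards [h.frame] with z hz
    simp [wedge_apply, hz.lα, hz.ll, hz.sα]
  have z3 : (fun z => (φ z • wedge (G z (S z)) (G z (L z))) ![L z, S z]) =ᶠ[𝓝 y] fun _ => 0 := by
    filter_upwards [h.frame] with z hz
    simp [wedge_apply, hz.ls, hz.ll, hz.sl]
  rw [z1.fderiv_eq, z2.fderiv_eq, z3.fderiv_eq]
  rw [hy.symm] at hgeo
  simp [wedge_apply, hy.lα, hy.ll, hy.sα, hy.ls, hy.sl, hgeo]

open VectorField in
/-- This component depends on `S` only through `g([L, S], S)`, so that for a conformal flow it is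
the same for `S^♭ ∧ L^♭` and `A^♭ ∧ L^♭`. -/
lemma IsSmoothNullFrameAt.extDeriv_wedge_lsn (h : IsSmoothNullFrameAt G S L A N y)
    (hφ : ContDiffAt ℝ ∞ φ y) :
    extDeriv (fun z => φ z • wedge (G z (S z)) (G z (L z))) y ![L y, S y, N y] =
      -fderiv ℝ φ y (L y) + φ y * G y (lieBracket ℝ L S y) (S y)
        - φ y * G y (lieBracket ℝ L N y) (L y) := by
  have d : ∀ {X : E4 → E4}, ContDiffAt ℝ ∞ X y → DifferentiableAt ℝ X y :=
    fun hX => hX.differentiableAt (by simp)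
  have hy := h.frame.self_of_nhds
  rw [extDeriv_twoForm_apply ((h.contDiffAt_wedge hφ).differentiableAt (by simp)) (d h.l) (d h.s)
    (d h.n)]
  have z1 : (fun z => (φ z • wedge (G z (S z)) (G z (L z))) ![S z, N z]) =ᶠ[𝓝 y]
      fun z => -φ z := by
    filter_upwards [h.frame] with z hz
    simp [wedge_apply, hz.sn, hz.ln, hz.ss]
  have z2 : (fun z => (φ z • wedge (G z (S z)) (G z (L z))) ![L z, N z]) =ᶠ[𝓝 y] fun _ => 0 := by
    filter_upwards [h.frame] with z hz
    simp [wedge_apply, hz.sn, hz.ll, hz.sl]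
  have z3 : (fun z => (φ z • wedge (G z (S z)) (G z (L z))) ![L z, S z]) =ᶠ[𝓝 y] fun _ => 0 := by
    filter_upwards [h.frame] with z hz
    simp [wedge_apply, hz.ls, hz.ll, hz.sl]
  rw [z1.fderiv_eq, z2.fderiv_eq, z3.fderiv_eq, hy.symm (lieBracket ℝ L S y),
    hy.symm (lieBracket ℝ L N y)]
  simp [wedge_apply, hy.ln, hy.sn, hy.ll, hy.ss, hy.ls, hy.sl, fderiv_fun_neg]
  ring

lemma continuousAt_frameVolume (h : IsSmoothNullFrameAt G S L A N y) :
    ContinuousAt (fun z => frameVolume (G z) (S z) (L z) (A z) (N z)) y := by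
  unfold frameVolume volForm
  simp only [ContinuousAlternatingMap.smul_apply, smul_eq_mul]
  refine ContinuousAt.mul ?_ ?_
  · have : ContinuousAt (fun z => Matrix.of fun a b => G z (stdVec a) (stdVec b)) y := by
      refine continuousAt_pi.2 fun a => continuousAt_pi.2 fun b => ?_
      exact ((h.metric.clm_apply contDiffAt_const).clm_apply contDiffAt_const).continuousAt
    have hd : Continuous fun Γ : Matrix (Fin 4) (Fin 4) ℝ => Real.sqrt |Γ.det| :=
      Real.continuous_sqrt.comp (continuous_abs.comp (continuous_id.matrix_det))
    exact hd.continuousAt.comp this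
  · refine detForm.cont.continuousAt.comp (continuousAt_pi.2 fun i => ?_)
    fin_cases i
    · exact h.α.continuousAt
    · exact h.l.continuousAt
    · exact h.s.continuousAt
    · exact h.n.continuousAt

/-- The orientation of a continuous null frame is locally constant. -/
lemma frameVolume_eventuallyEq (h : IsSmoothNullFrameAt G S L A N y) :
    (fun z => frameVolume (G z) (S z) (L z) (A z) (N z)) =ᶠ[𝓝 y]
      fun _ => frameVolume (G y) (S y) (L y) (A y) (N y) := by
  have h1 := frameVolume_sq h.frame.self_of_nhds
  have h2 := (continuousAt_frameVolume h).eventually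
    (Metric.ball_mem_nhds _ one_pos)
  filter_upwards [h2, h.frame] with z hz hz'
  have h3 := frameVolume_sq hz'
  rw [Real.dist_eq, abs_lt] at hz
  rcases sq_eq_one_iff.1 h1 with h4 | h4 <;>
    rcases sq_eq_one_iff.1 h3 with h5 | h5 <;> simp only [h4, h5] at hz ⊢ <;> linarith

open VectorField in
/-- The current of a closed 2-form `φ A^♭ ∧ L^♭` has no components along `L` and `A`, if the flow of
`L` is conformal on `L^⊥ / L`: the component along `A` is `d(φ S^♭ ∧ L^♭)(L, S, N)`, which equals
`dF(L, A, N) = 0`. -/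
theorem coordCurrent_eq_zero (h : IsSmoothNullFrameAt G S L A N y) (hφ : ContDiffAt ℝ ∞ φ y)
    {F : E4 → E4 [⋀^Fin 2]→L[ℝ] ℝ}
    (hF : F =ᶠ[𝓝 y] fun z => φ z • wedge (G z (A z)) (G z (L z))) (hd : extDeriv F y = 0)
    (hgeo : G y (lieBracket ℝ L A y) (L y) = 0)
    (hequi : G y (lieBracket ℝ L S y) (S y) = G y (lieBracket ℝ L A y) (A y)) :
    coordCurrent G F y (L y) = 0 ∧ coordCurrent G F y (A y) = 0 := by
  have hy := h.frame.self_of_nhds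
  set k := frameVolume (G y) (S y) (L y) (A y) (N y) with hk
  have hstar : (fun z => star2 (G z) (F z)) =ᶠ[𝓝 y]
      (-k) • fun z => φ z • wedge (G z (S z)) (G z (L z)) := by
    filter_upwards [hF, h.frame, frameVolume_eventuallyEq h] with z hz hzf hzk
    rw [hz, hzf.star2_wedge, hzk, ← hk, Pi.smul_apply, smul_smul]
    congr 1
    ring
  have e : extDeriv (fun z => star2 (G z) (F z)) y =
      (-k) • extDeriv (fun z => φ z • wedge (G z (S z)) (G z (L z))) y := by
    rw [hstar.extDeriv_eq, extDeriv_smul]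
  rw [hF.extDeriv_eq] at hd
  have h1 := h.extDeriv_wedge_lsα hφ hgeo
  have h2 := h.extDeriv_wedge_lsn hφ
  -- exchanging `S` and `A` turns the component in `h2` into a component of `dF`
  have h3 := h.swap.extDeriv_wedge_lsn hφ
  rw [hd] at h3
  rw [hequi, ← h3] at h2
  replace h2 : extDeriv (fun z => φ z • wedge (G z (S z)) (G z (L z))) y ![L y, S y, N y] = 0 := h2
  unfold coordCurrent
  rw [e]
  set H := extDeriv (fun z => φ z • wedge (G z (S z)) (G z (L z))) y
  have u30 : ∀ x y z v : E4, Function.update ![x, y, z] 0 v = ![v, y, z] := by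
    intro x y z v; ext1 i; fin_cases i <;> rfl
  have u31 : ∀ x y z v : E4, Function.update ![x, y, z] 1 v = ![x, v, z] := by
    intro x y z v; ext1 i; fin_cases i <;> rfl
  have neg0 : ∀ a b c : E4, H ![-a, b, c] = -H ![a, b, c] := by
    intro a b c
    have := H.map_update_smul ![a, b, c] 0 (-1) a
    simpa [u30] using this
  have neg1 : ∀ a b c : E4, H ![a, -b, c] = -H ![a, b, c] := by
    intro a b c
    have := H.map_update_smul ![a, b, c] 1 (-1) b
    simpa [u31] using this
  constructor
  -- the duals of `S`, `A`, `N` are `S`, `A`, `-L`, and those of `S`, `L`, `N` are `S`, `-N`, `-L`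
  · refine hy.star3_eq_zero 1 ?_
    have h4 : H ![-L y, S y, A y] = 0 := by rw [neg0, h1, neg_zero]
    have h5 := alternating_eq_zero_comp h4 ![1, 2, 0]
    rw [ContinuousAlternatingMap.smul_apply]
    refine smul_eq_zero_of_right _ ?_
    convert h5 using 2
    ext1 r; fin_cases r <;> rfl
  · refine hy.star3_eq_zero 2 ?_
    have h4 : H ![-L y, -(-S y), -N y] = 0 := by
      have h5 := alternating_eq_zero_comp h2 ![2, 0, 1]
      have h6 : H ![N y, L y, S y] = 0 := by
        convert h5 using 2
        ext1 r; fin_cases r <;> rfl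
      have h7 : H ![-N y, -L y, S y] = 0 := by rw [neg0, neg1, h6]; simp
      have h8 := alternating_eq_zero_comp h7 ![1, 2, 0]
      rw [neg_neg]
      convert h8 using 2
      ext1 r; fin_cases r <;> rfl
    rw [neg_neg] at h4
    have h5 := alternating_eq_zero_comp h4 ![1, 2, 0]
    rw [ContinuousAlternatingMap.smul_apply]
    refine smul_eq_zero_of_right _ ?_
    convert h5 using 2
    ext1 r; fin_cases r <;> rfl

end Local

/-! ### 2-forms in the last two coordinates -/

lemma twoForm_eq_smul_wedge_of_kernel {θ : E4 [⋀^Fin 2]→L[ℝ] ℝ} (h0 : ∀ w, θ ![stdVec 0, w] = 0)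
    (h1 : ∀ w, θ ![stdVec 1, w] = 0) :
    θ = θ ![stdVec 2, stdVec 3] • wedge (stdCovec 2) (stdCovec 3) := by
  have h0' : ∀ w, θ ![w, stdVec 0] = 0 := fun w => by rw [twoForm_swap, h0, neg_zero]
  have h1' : ∀ w, θ ![w, stdVec 1] = 0 := fun w => by rw [twoForm_swap, h1, neg_zero]
  refine twoForm_ext fun v w => ?_
  rw [twoForm_eq_sum, ContinuousAlternatingMap.smul_apply, wedge_apply]
  simp only [Fin.sum_univ_four, h0, h1, h0', h1', twoForm_self, stdCovec_apply, smul_eq_mul]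
  rw [twoForm_swap θ (stdVec 3)]
  ring

lemma extDeriv_smul_wedge {f : E4 → ℝ} {y : E4} (hf : DifferentiableAt ℝ f y) (β γ : E4 →L[ℝ] ℝ)
    (u v w : E4) :
    extDeriv (fun z => f z • wedge β γ) y ![u, v, w] =
      fderiv ℝ f y u * wedge β γ ![v, w] - fderiv ℝ f y v * wedge β γ ![u, w]
        + fderiv ℝ f y w * wedge β γ ![u, v] := by
  have hc : ∀ v : E4, DifferentiableAt ℝ (fun _ : E4 => v) y := fun v => differentiableAt_const v
  have hF : DifferentiableAt ℝ (fun z => f z • wedge β γ) y := hf.smul_const _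
  have h := extDeriv_twoForm_apply hF (hc u) (hc v) (hc w)
  have e : ∀ a b : E4, fderiv ℝ (fun z => (f z • wedge β γ) ![a, b]) y =
      (wedge β γ ![a, b]) • fderiv ℝ f y := by
    intro a b
    simp only [ContinuousAlternatingMap.smul_apply, smul_eq_mul]
    exact fderiv_mul_const hf _
  have hb : ∀ a b : E4, VectorField.lieBracket ℝ (fun _ : E4 => a) (fun _ : E4 => b) y = 0 := by
    intro a b
    simp [VectorField.lieBracket]
  have h0 : ∀ a : E4, (f y • wedge β γ) ![0, a] = 0 := fun a => by simp [wedge_apply]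
  rw [h]
  simp only [e, hb, h0, smul_apply, smul_eq_mul]
  ring

/-! ### Metric and tetrad in a chart -/

section Metric

variable {M : Type*} [TopologicalSpace M]

lemma eventually_mem_target_symm_mem (c : OpenPartialHomeomorph M E4) {Ω : Set M}
    (hΩ : IsOpen Ω) {y : E4}
    (hy : y ∈ c.target) (hyΩ : c.symm y ∈ Ω) : ∀ᶠ z in 𝓝 y, z ∈ c.target ∧ c.symm z ∈ Ω :=
  (c.isOpen_inter_preimage_symm hΩ).mem_nhds ⟨hy, hyΩ⟩

variable [ChartedSpace E4 M] {c : OpenPartialHomeomorph M E4}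

lemma coordVec_symm (hc : c ∈ IsManifold.maximalAtlas (𝓡 4) ∞ M) {y : E4} (hy : y ∈ c.target)
    (i : Fin 4) : coordVec c (c.symm y) i = symmDiff c y (stdVec i) := by
  unfold coordVec
  conv_lhs => rw [← chartDiff_symmDiff hc hy (stdVec i)]
  exact (isInvertible_chartDiff hc (c.map_target hy)).inverse_apply_self _

variable [IsManifold (𝓡 4) ∞ M] {g : LorentzMetric M}

lemma smoothAt_pullback_const (hc : c ∈ IsManifold.maximalAtlas (𝓡 4) ∞ M) (v : E4) {x : M}
    (hx : x ∈ c.source) :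
    SmoothAt (fun x => (chartDiff c x).inverse v) x :=
  ContMDiffAt.mpullback_vectorField_preimage (I := 𝓡 4) (I' := 𝓘(ℝ, E4)) (n := ∞)
    (m := ∞) (f := c) (V := fun _ => v) (x₀ := x)
    (contMDiffAt_vectorSpace_iff_contDiffAt.2 contDiffAt_const)
    (contMDiffAt_of_mem_maximalAtlas hc hx) (isInvertible_chartDiff hc hx) (by simp)

lemma metricInChart_apply (p : M) (z v w : E4) :
    metricInChart g p z v w = g.val ((chartAt E4 p).symm z) (symmDiff (chartAt E4 p) z v)
      (symmDiff (chartAt E4 p) z w) := rfl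

lemma metricInChart_fieldIn (p : M) {z : E4} (hz : z ∈ (chartAt E4 p).target) (X Y : VField M) :
    metricInChart g p z (fieldIn (chartAt E4 p) X z) (fieldIn (chartAt E4 p) Y z) =
      g.ip X Y ((chartAt E4 p).symm z) := by
  have hc := IsManifold.chart_mem_maximalAtlas (I := 𝓡 4) (n := ∞) p
  rw [metricInChart_apply, symmDiff_fieldIn hc X hz, symmDiff_fieldIn hc Y hz]
  rfl

lemma contDiffAt_metricInChart (p : M) {y : E4} (hy : y ∈ (chartAt E4 p).target) :
    ContDiffAt ℝ ∞ (metricInChart g p) y := by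
  have hc := IsManifold.chart_mem_maximalAtlas (I := 𝓡 4) (n := ∞) p
  refine ContDiffOn.contDiffAt (s := (chartAt E4 p).target) ?_
    ((chartAt E4 p).open_target.mem_nhds hy)
  refine contDiffOn_clm_apply.2 fun v => contDiffOn_clm_apply.2 fun w => fun z hz => ?_
  refine ContDiffAt.contDiffWithinAt ?_
  have h1 := contDiffAt_comp_symm hc hz (smoothAt_ip g
    (smoothAt_pullback_const hc v ((chartAt E4 p).map_target hz))
    (smoothAt_pullback_const hc w ((chartAt E4 p).map_target hz)))
  refine h1.congr_of_eventuallyEq ?_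
  filter_upwards [(chartAt E4 p).open_target.mem_nhds hz] with z' hz'
  rw [← metricInChart_fieldIn p hz']
  have e : ∀ v, fieldIn (chartAt E4 p) (fun x => (chartDiff (chartAt E4 p) x).inverse v) z' = v :=
    fun v => (isInvertible_chartDiff hc ((chartAt E4 p).map_target hz')).self_apply_inverse v
  rw [e, e]

variable {S l A n : VField M} {Ω : Set M}

lemma IsNullTetrad.isNullFrame_fieldIn (hT : IsNullTetrad g S l A n Ω) (p : M) {z : E4}
    (hz : z ∈ (chartAt E4 p).target) (hzΩ : (chartAt E4 p).symm z ∈ Ω) :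
    IsNullFrame (metricInChart g p z) (fieldIn (chartAt E4 p) S z) (fieldIn (chartAt E4 p) l z)
      (fieldIn (chartAt E4 p) A z) (fieldIn (chartAt E4 p) n z) where
  symm v w := by rw [metricInChart_apply, metricInChart_apply, g.symm]
  ss := (metricInChart_fieldIn p hz _ _).trans (hT.ss _ hzΩ)
  αα := (metricInChart_fieldIn p hz _ _).trans (hT.αα _ hzΩ)
  nl := (metricInChart_fieldIn p hz _ _).trans (hT.nl _ hzΩ)
  ll := (metricInChart_fieldIn p hz _ _).trans (hT.ll _ hzΩ)
  nn := (metricInChart_fieldIn p hz _ _).trans (hT.nn _ hzΩ)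
  ns := (metricInChart_fieldIn p hz _ _).trans (hT.ns _ hzΩ)
  nα := (metricInChart_fieldIn p hz _ _).trans (hT.nα _ hzΩ)
  αs := (metricInChart_fieldIn p hz _ _).trans (hT.αs _ hzΩ)
  αl := (metricInChart_fieldIn p hz _ _).trans (hT.αl _ hzΩ)
  sl := (metricInChart_fieldIn p hz _ _).trans (hT.sl _ hzΩ)

lemma IsNullTetrad.isSmoothNullFrameAt (hT : IsNullTetrad g S l A n Ω) (hΩ : IsOpen Ω) (p : M)
    {y : E4} (hy : y ∈ (chartAt E4 p).target) (hyΩ : (chartAt E4 p).symm y ∈ Ω) :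
    IsSmoothNullFrameAt (metricInChart g p) (fieldIn (chartAt E4 p) S) (fieldIn (chartAt E4 p) l)
      (fieldIn (chartAt E4 p) A) (fieldIn (chartAt E4 p) n) y := by
  have hc := IsManifold.chart_mem_maximalAtlas (I := 𝓡 4) (n := ∞) p
  exact
    { frame := (eventually_mem_target_symm_mem _ hΩ hy hyΩ).mono fun z hz =>
        hT.isNullFrame_fieldIn p hz.1 hz.2
      metric := contDiffAt_metricInChart p hy
      s := contDiffAt_fieldIn hc hy (hT.smooth_s.smoothAt hΩ hyΩ)
      l := contDiffAt_fieldIn hc hy (hT.smooth_l.smoothAt hΩ hyΩ)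
      α := contDiffAt_fieldIn hc hy (hT.smooth_α.smoothAt hΩ hyΩ)
      n := contDiffAt_fieldIn hc hy (hT.smooth_n.smoothAt hΩ hyΩ) }

lemma formIn_smul_wedge (p : M) {z : E4} (hz : z ∈ (chartAt E4 p).target) (X Y : VField M)
    (f : M → ℝ) :
    formIn (chartAt E4 p) (fun x => f x • wedge (g.val x (X x)) (g.val x (Y x))) z =
      f ((chartAt E4 p).symm z) • wedge (metricInChart g p z (fieldIn (chartAt E4 p) X z))
        (metricInChart g p z (fieldIn (chartAt E4 p) Y z)) := by
  have hc := IsManifold.chart_mem_maximalAtlas (I := 𝓡 4) (n := ∞) p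
  refine twoForm_ext fun v w => ?_
  simp only [ContinuousAlternatingMap.smul_apply, wedge_apply, metricInChart_apply,
    symmDiff_fieldIn hc _ hz]
  rfl

/-- The current of a closed field `φ A^♭ ∧ l^♭` vanishes on `l` and on `A`. -/
lemma current_apply_eq_zero (hT : IsNullTetrad g S l A n Ω) (hΩ : IsOpen Ω) {x : M} (hx : x ∈ Ω)
    (hC : ConformalBrackets g S l A x) {f : M → ℝ} {F : DForm M 2}
    (hF : F = fun x => f x • wedge (g.val x (A x)) (g.val x (l x)))
    (hs : ContDiffAt ℝ ∞ (formInChart x F) (extChartAt (𝓡 4) x x)) (hd : extD F x = 0) :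
    current g F x (l x) = 0 ∧ current g F x (A x) = 0 := by
  have hc := IsManifold.chart_mem_maximalAtlas (I := 𝓡 4) (n := ∞) x
  have hxs := mem_chart_source E4 x
  set c := chartAt E4 x with hcdef
  set y := c x with hy
  have hyt : y ∈ c.target := c.map_source hxs
  have hyx : c.symm y = x := c.left_inv hxs
  have hyΩ : c.symm y ∈ Ω := by rwa [hyx]
  have hfr := hT.isSmoothNullFrameAt hΩ x hyt hyΩ
  have hev : formInChart x F =ᶠ[𝓝 y] fun z => f (c.symm z) •
      wedge (metricInChart g x z (fieldIn c A z)) (metricInChart g x z (fieldIn c l z)) := by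
    filter_upwards [c.open_target.mem_nhds hyt] with z hz
    rw [hF]
    exact formIn_smul_wedge x hz A l f
  have hφ : ContDiffAt ℝ ∞ (fun z => f (c.symm z)) y := by
    have h1 : ContDiffAt ℝ ∞ (fun z => -formInChart x F z ![fieldIn c A z, fieldIn c n z]) y :=
      (contDiffAt_twoForm_apply hs hfr.α hfr.n).neg
    refine h1.congr_of_eventuallyEq ?_
    filter_upwards [hev, hfr.frame] with z hz hzf
    rw [hz, ContinuousAlternatingMap.smul_apply, wedge_apply, hzf.αα, hzf.ln, hzf.αn]
    simp
  have hbr : ∀ {X Y : VField M}, SmoothAt X (c.symm y) → SmoothAt Y (c.symm y) → ∀ Z : VField M,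
      metricInChart g x y (VectorField.lieBracket ℝ (fieldIn c X) (fieldIn c Y) y)
        (fieldIn c Z y) = g.ip (bracket X Y) Z x := by
    intro X Y hX hY Z
    rw [← chartDiff_bracket hc hyt hX hY]
    exact (metricInChart_fieldIn x hyt (bracket X Y) Z).trans
      (congrArg (g.ip (bracket X Y) Z) hyx)
  have hS' := hT.smooth_s.smoothAt hΩ hyΩ
  have hl' := hT.smooth_l.smoothAt hΩ hyΩ
  have hA' := hT.smooth_α.smoothAt hΩ hyΩ
  have key := coordCurrent_eq_zero hfr hφ hev ((extD_eq_zero_iff F x).1 hd)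
    (by rw [hbr hl' hA']; exact hC.αl) (by rw [hbr hl' hS', hbr hl' hA']; exact hC.diag)
  rw [fieldIn_apply_of_mem l hxs, fieldIn_apply_of_mem A hxs] at key
  exact key

end Metric

/-! ### Null force-free fields of a foliation -/

section ForceFree

variable {M : Type*} [TopologicalSpace M] {e : OpenPartialHomeomorph M E4}

/-- The projection to the last two coordinates. -/
def lastTwo : E4 →L[ℝ] ℝ × ℝ := (stdCovec 2).prod (stdCovec 3)

lemma lastTwo_apply (y : E4) : lastTwo y = (y 2, y 3) := rfl

lemma contDiffAt_comp_lastTwo {u : ℝ × ℝ → ℝ}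
    (hu : ContDiffOn ℝ ∞ u ((fun x => (e x 2, e x 3)) '' e.source)) {y : E4} (hy : y ∈ e.target) :
    ContDiffAt ℝ ∞ (fun z => u (lastTwo z)) y := by
  have h : ContDiffOn ℝ ∞ (fun z => u (lastTwo z)) e.target :=
    hu.comp lastTwo.contDiff.contDiffOn fun z hz =>
      ⟨e.symm z, e.map_target hz, by simp only [e.right_inv hz]; rfl⟩
  exact h.contDiffAt (e.open_target.mem_nhds hy)

variable [ChartedSpace E4 M]

lemma IsFoliatedChart.symmDiff_mem {D : (x : M) → Submodule ℝ (TangentSpace (𝓡 4) x)}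
    (he : IsFoliatedChart D e) {y : E4} (hy : y ∈ e.target) :
    symmDiff e y (stdVec 0) ∈ D (e.symm y) ∧ symmDiff e y (stdVec 1) ∈ D (e.symm y) := by
  constructor <;>
  · rw [he.tangent _ (e.map_target hy), chartDiff_symmDiff he.mem_atlas hy]
    simp

/-- In an adapted chart, a 2-form whose kernel contains the distribution has a single component. -/
lemma formIn_eq_smul_wedge {D : (x : M) → Submodule ℝ (TangentSpace (𝓡 4) x)}
    (he : IsFoliatedChart D e) {F : DForm M 2}
    (hF : ∀ x ∈ e.source, ∀ v ∈ D x, ∀ w, F x ![v, w] = 0) {y : E4} (hy : y ∈ e.target) :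
    formIn e F y =
      formIn e F y ![stdVec 2, stdVec 3] • wedge (stdCovec 2) (stdCovec 3) := by
  have hap : ∀ v w, formIn e F y ![v, w] = F (e.symm y) ![symmDiff e y v, symmDiff e y w] := by
    intro v w
    unfold formIn
    rw [ContinuousAlternatingMap.compContinuousLinearMap_apply]
    congr 1
    ext1 i; fin_cases i <;> rfl
  refine twoForm_eq_smul_wedge_of_kernel (fun w => ?_) (fun w => ?_)
  · rw [hap]; exact hF _ (e.map_target hy) _ (he.symmDiff_mem hy).1 _
  · rw [hap]; exact hF _ (e.map_target hy) _ (he.symmDiff_mem hy).2 _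

variable [IsManifold (𝓡 4) ∞ M] {g : LorentzMetric M} {S l A n : VField M} {Ω : Set M}

/-- The kernel of `A^♭ ∧ l^♭` is `span(l, S)`. -/
lemma wedge_kernel (hT : IsNullTetrad g S l A n Ω) {x : M} (hx : x ∈ Ω)
    {v : TangentSpace (𝓡 4) x} :
    (∀ w, wedge (g.val x (A x)) (g.val x (l x)) ![v, w] = 0) ↔ v ∈ spanDist l S x := by
  have hF := hT.isNullFrame hx
  rw [spanDist, hF.mem_span_iff (finrank_tangentSpace x)]
  simp only [wedge_apply]
  constructor
  · intro h
    have h1 := h (n x)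
    have h2 := h (A x)
    rw [hF.αn, hF.ln, hF.symm (A x) v] at h1
    rw [hF.αα, hF.lα, hF.symm (l x) v] at h2
    constructor <;> linarith
  · rintro ⟨h1, h2⟩ w
    rw [hF.symm (A x) v, hF.symm (l x) v, h1, h2]
    ring

lemma sheetField_apply (x : M) (u : ℝ × ℝ → ℝ) (v w : TangentSpace (𝓡 4) x) :
    sheetField g A l e u x ![v, w] = u (e x 2, e x 3) * kappa g A l e x *
      wedge (g.val x (A x)) (g.val x (l x)) ![v, w] := rfl

/-- The quantity inverted in `kappa` is the component of `A^♭ ∧ l^♭` along `(∂₂, ∂₃)`, the only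
component in an adapted chart. It does not vanish, so `kappa` is not a junk value. -/
lemma kappa_ne_zero (hT : IsNullTetrad g S l A n Ω) (he : IsFoliatedChart (spanDist l S) e)
    (hes : e.source ⊆ Ω) {x : M} (hx : x ∈ e.source) : kappa g A l e x ≠ 0 := by
  have hy := e.map_source hx
  have hk := (wedge_apply (g.val x (A x)) (g.val x (l x)) (coordVec e x 2) (coordVec e x 3))
  unfold kappa
  refine inv_ne_zero fun h0 => ?_
  have h1 := formIn_eq_smul_wedge he (F := fun x => wedge (g.val x (A x)) (g.val x (l x)))
    (fun x hx v hv => (wedge_kernel hT (hes hx)).2 hv) hy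
  have h2 : formIn e (fun x => wedge (g.val x (A x)) (g.val x (l x))) (e x)
      ![stdVec 2, stdVec 3] = 0 := by
    have h3 := formIn_apply_chartDiff he.mem_atlas
      (fun x => wedge (g.val x (A x)) (g.val x (l x))) hx ![coordVec e x 2, coordVec e x 3]
    have h4 : (fun i => chartDiff e x (![coordVec e x 2, coordVec e x 3] i)) =
        ![stdVec 2, stdVec 3] := by
      ext1 i
      fin_cases i
      · exact (isInvertible_chartDiff he.mem_atlas hx).self_apply_inverse _
      · exact (isInvertible_chartDiff he.mem_atlas hx).self_apply_inverse _
    rw [h4] at h3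
    rw [h3, hk]
    linarith
  rw [h2, zero_smul] at h1
  have h3 := formIn_apply_chartDiff he.mem_atlas
      (fun x => wedge (g.val x (A x)) (g.val x (l x))) hx ![A x, n x]
  have hF := hT.isNullFrame (hes hx)
  rw [h1, wedge_apply, hF.αα, hF.ln, hF.αn] at h3
  have h4 : (0 : ℝ) = 1 * -1 - 0 * g.val x (l x) (A x) := h3
  norm_num at h4

/-- In an adapted chart, the field built from `u` is `u(x², x³) dx² ∧ dx³`. -/
lemma formIn_sheetField (hT : IsNullTetrad g S l A n Ω) (he : IsFoliatedChart (spanDist l S) e)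
    (hes : e.source ⊆ Ω) (u : ℝ × ℝ → ℝ) {y : E4} (hy : y ∈ e.target) :
    formIn e (sheetField g A l e u) y = u (y 2, y 3) • wedge (stdCovec 2) (stdCovec 3) := by
  have h1 := formIn_eq_smul_wedge he (F := sheetField g A l e u)
    (fun x hx v hv w => by
      rw [sheetField_apply, (wedge_kernel hT (hes hx)).2 hv, mul_zero]) hy
  rw [h1]
  congr 1
  have hx := e.map_target hy
  have hk := kappa_ne_zero hT he hes hx
  have h2 : formIn e (sheetField g A l e u) y ![stdVec 2, stdVec 3] =
      sheetField g A l e u (e.symm y) ![symmDiff e y (stdVec 2), symmDiff e y (stdVec 3)] := by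
    unfold formIn
    rw [ContinuousAlternatingMap.compContinuousLinearMap_apply]
    congr 1
    ext1 i; fin_cases i <;> rfl
  rw [h2, sheetField_apply, ← coordVec_symm he.mem_atlas hy, ← coordVec_symm he.mem_atlas hy,
    e.right_inv hy, wedge_apply]
  have h3 : kappa g A l e (e.symm y) * (g.val (e.symm y) (A (e.symm y)) (coordVec e (e.symm y) 2)
      * g.val (e.symm y) (l (e.symm y)) (coordVec e (e.symm y) 3)
    - g.val (e.symm y) (A (e.symm y)) (coordVec e (e.symm y) 3)
      * g.val (e.symm y) (l (e.symm y)) (coordVec e (e.symm y) 2)) = 1 := by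
    unfold kappa at hk ⊢
    exact inv_mul_cancel₀ fun h0 => hk (by rw [h0, inv_zero])
  rw [mul_assoc, h3, mul_one]

lemma formIn_sheetField_eventuallyEq (hT : IsNullTetrad g S l A n Ω)
    (he : IsFoliatedChart (spanDist l S) e) (hes : e.source ⊆ Ω) (u : ℝ × ℝ → ℝ) {y : E4}
    (hy : y ∈ e.target) : formIn e (sheetField g A l e u) =ᶠ[𝓝 y]
      fun z => u (lastTwo z) • wedge (stdCovec 2) (stdCovec 3) := by
  filter_upwards [e.open_target.mem_nhds hy] with z hz
  exact formIn_sheetField hT he hes u hz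

/-- The field built from `u` is closed since it is `u(x², x³) dx² ∧ dx³`, force-free since its
current is tangent to its kernel, and null since `A^♭ ∧ l^♭` is. -/
theorem isNullForceFree_sheetField (hΩ : IsOpen Ω) (hT : IsNullTetrad g S l A n Ω)
    (hC : ∀ x ∈ Ω, ConformalBrackets g S l A x) (he : IsFoliatedChart (spanDist l S) e)
    (hes : e.source ⊆ Ω) {u : ℝ × ℝ → ℝ}
    (hu : ContDiffOn ℝ ∞ u ((fun x => (e x 2, e x 3)) '' e.source)) :
    IsNullForceFree g (sheetField g A l e u) e.source := by
  have hsm : ∀ x ∈ e.source, ContDiffAt ℝ ∞ (formIn e (sheetField g A l e u)) (e x) := by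
    intro x hx
    have hy := e.map_source hx
    exact ((contDiffAt_comp_lastTwo hu hy).smul contDiffAt_const).congr_of_eventuallyEq
      (formIn_sheetField_eventuallyEq hT he hes u hy)
  have hd : ∀ x ∈ e.source, extDeriv (formIn e (sheetField g A l e u)) (e x) = 0 := by
    intro x hx
    have hy := e.map_source hx
    rw [(formIn_sheetField_eventuallyEq hT he hes u hy).extDeriv_eq]
    have hdu := (contDiffAt_comp_lastTwo hu hy).differentiableAt (by simp)
    ext v
    have hv : v = ![v 0, v 1, v 2] := by ext1 i; fin_cases i <;> rfl
    rw [hv, extDeriv_smul_wedge hdu]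
    have hz : ∀ i, lastTwo (stdVec i) = 0 →
        fderiv ℝ (fun z => u (lastTwo z)) (e x) (stdVec i) = 0 :=
      fun i hi => fderiv_comp_clm_eq_zero EventuallyEq.rfl hdu hi
    have hw : ∀ w : E4, fderiv ℝ (fun z => u (lastTwo z)) (e x) w =
        w 2 * fderiv ℝ (fun z => u (lastTwo z)) (e x) (stdVec 2) +
        w 3 * fderiv ℝ (fun z => u (lastTwo z)) (e x) (stdVec 3) := by
      intro w
      conv_lhs => rw [eq_sum_stdVec w]
      rw [Fin.sum_univ_four]
      simp only [map_add, map_smul, hz 0 (by simp [lastTwo_apply]),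
        hz 1 (by simp [lastTwo_apply]), smul_eq_mul]
      ring
    rw [hw (v 0), hw (v 1), hw (v 2)]
    simp only [wedge_apply, stdCovec_apply]
    change _ = (0 : ℝ)
    ring
  have hsmooth : SmoothFormOn (sheetField g A l e u) e.source := fun x hx =>
    contDiffAt_formInChart he.mem_atlas hx (hsm x hx)
  have hclosed : ∀ x ∈ e.source, extD (sheetField g A l e u) x = 0 := fun x hx =>
    extD_eq_zero_of_formIn he.mem_atlas hx (hsm x hx) (hd x hx)
  refine ⟨hsmooth, hclosed, fun x hx v => ?_, fun x hx => ?_⟩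
  · have hj := current_apply_eq_zero hT hΩ (hes hx) (hC x (hes hx))
      (F := sheetField g A l e u) (f := fun x => u (e x 2, e x 3) * kappa g A l e x) rfl
      (hsmooth x hx) (hclosed x hx)
    have hF := hT.isNullFrame (hes hx)
    have hsharp : ∀ w, g.val x w (sharp g x (current g (sheetField g A l e u) x)) =
        current g (sheetField g A l e u) x w := by
      intro w
      exact IsNullFrame.apply_inverse (G := g.val x) hF _ w
    rw [sheetField_apply, wedge_apply, hsharp, hsharp, hj.1, hj.2]
    ring
  · have hxs := mem_chart_source E4 x
    have hy := (chartAt E4 x).map_source hxs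
    have hfr := hT.isNullFrame_fieldIn x hy (by
      rw [(chartAt E4 x).left_inv hxs]; exact hes hx)
    have h1 := formIn_smul_wedge (g := g) x hy A l fun x => u (e x 2, e x 3) * kappa g A l e x
    have h2 := hfr.normSq2_wedge (((fun x => u (e x 2, e x 3) * kappa g A l e x)
      ((chartAt E4 x).symm (chartAt E4 x x))))
    rw [← h1] at h2
    exact h2

/-- A closed 2-form on an adapted box chart whose kernel contains the distribution has a single
component, which depends on the last two coordinates only. -/
theorem exists_eq_sheetField (hT : IsNullTetrad g S l A n Ω)
    (he : IsFoliatedChart (spanDist l S) e) (hes : e.source ⊆ Ω) {F : DForm M 2}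
    (hF : IsNullForceFree g F e.source)
    (hker : ∀ x ∈ e.source, ∀ v ∈ spanDist l S x, ∀ w, F x ![v, w] = 0) :
    ∃ u : ℝ × ℝ → ℝ, ContDiffOn ℝ ∞ u ((fun x => (e x 2, e x 3)) '' e.source) ∧
      ∀ x ∈ e.source, F x = sheetField g A l e u x := by
  rcases e.source.eq_empty_or_nonempty with hemp | ⟨p, hp⟩
  · exact ⟨0, contDiffOn_const, by simp [hemp]⟩
  obtain ⟨a, b, hbox⟩ := he.box
  have hbox : e.target = box a b := hbox
  let f : E4 → ℝ := fun y => formIn e F y ![stdVec 2, stdVec 3]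
  have hform : ∀ y ∈ e.target, formIn e F y = f y • wedge (stdCovec 2) (stdCovec 3) :=
    fun y hy => formIn_eq_smul_wedge he hker hy
  have hFs : ∀ y ∈ e.target, ContDiffAt ℝ ∞ (formIn e F) y := by
    intro y hy
    have := contDiffAt_formIn hF.smooth he.mem_atlas (e.map_target hy) (e.map_target hy)
    rwa [e.right_inv hy] at this
  have hfs : ∀ y ∈ e.target, ContDiffAt ℝ ∞ f y := fun y hy =>
    contDiffAt_twoForm_apply_const (hFs y hy) _
  have hfd : ∀ y ∈ e.target, ∀ i : Fin 4, i = 0 ∨ i = 1 → fderiv ℝ f y (stdVec i) = 0 := by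
    intro y hy i hi
    have h1 := extDeriv_formIn_eq_zero hF.smooth he.mem_atlas (e.map_target hy) (e.map_target hy)
      (hF.closed _ (e.map_target hy))
    rw [e.right_inv hy] at h1
    have h2 : formIn e F =ᶠ[𝓝 y] fun z => f z • wedge (stdCovec 2) (stdCovec 3) := by
      filter_upwards [e.open_target.mem_nhds hy] with z hz using hform z hz
    rw [h2.extDeriv_eq] at h1
    have h3 := extDeriv_smul_wedge ((hfs y hy).differentiableAt (by simp)) (stdCovec 2)
      (stdCovec 3) (stdVec i) (stdVec 2) (stdVec 3)
    rw [h1] at h3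
    have h4 : (0 : ℝ) = _ := h3
    rcases hi with rfl | rfl <;> simp [wedge_apply, stdCovec_apply] at h4 <;> exact h4.symm
  set q := e p with hq
  have hqt : q ∈ box a b := hbox ▸ e.map_source hp
  -- restrict the component of `F` to the slice of the box through `p` where `y⁰`, `y¹` are constant
  let J : ℝ × ℝ → E4 := fun z => !₂[q 0, q 1, z.1, z.2]
  have hJs : ContDiff ℝ ∞ J := by
    rw [contDiff_euclidean]
    intro i
    fin_cases i
    · exact contDiff_const
    · exact contDiff_const
    · exact contDiff_fst
    · exact contDiff_snd
  have hJ : ∀ y ∈ e.target, J (y 2, y 3) ∈ e.target := by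
    intro y hy
    rw [hbox] at hy ⊢
    intro i
    fin_cases i
    · exact hqt 0
    · exact hqt 1
    · exact hy 2
    · exact hy 3
  have hfJ : ∀ y ∈ e.target, f y = f (J (y 2, y 3)) := by
    intro y hy
    refine eq_of_fderiv_sub_eq_zero (s := e.target) (hbox ▸ convex_box a b)
      (fun z hz => (hfs z hz).differentiableAt (by simp)) hy (hJ y hy) (fun z hz => ?_)
    have : J (y 2, y 3) - y = (q 0 - y 0) • stdVec 0 + (q 1 - y 1) • stdVec 1 := by
      ext i
      fin_cases i <;> simp [J]
    rw [this, map_add, map_smul, map_smul, hfd z hz 0 (.inl rfl), hfd z hz 1 (.inr rfl)]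
    simp
  refine ⟨fun z => f (J z), ?_, fun x hx => ?_⟩
  · have hf : ContDiffOn ℝ ∞ f e.target := fun y hy => (hfs y hy).contDiffWithinAt
    refine hf.comp hJs.contDiffOn ?_
    rintro _ ⟨x, hx, rfl⟩
    exact hJ _ (e.map_source hx)
  · have hy := e.map_source hx
    have h1 : formIn e F (e x) = formIn e (sheetField g A l e fun z => f (J z)) (e x) := by
      rw [hform _ hy, formIn_sheetField hT he hes _ hy, hfJ _ hy]
    ext v
    rw [← formIn_apply_chartDiff he.mem_atlas F hx, h1,
      formIn_apply_chartDiff he.mem_atlas _ hx]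

lemma sheetField_kernel (hT : IsNullTetrad g S l A n Ω)
    (he : IsFoliatedChart (spanDist l S) e) (hes : e.source ⊆ Ω) (u : ℝ × ℝ → ℝ) {x : M}
    (hx : x ∈ e.source) (hu : u (e x 2, e x 3) ≠ 0) (v : TangentSpace (𝓡 4) x) :
    (∀ w, sheetField g A l e u x ![v, w] = 0) ↔ v ∈ spanDist l S x := by
  rw [← wedge_kernel hT (hes hx)]
  refine forall_congr' fun w => ?_
  rw [sheetField_apply, mul_eq_zero]
  exact or_iff_right (mul_ne_zero hu (kappa_ne_zero hT he hes hx))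

end ForceFree

end NullFFE

open NullFFE in
theorem theorem4 {M : Type*} [TopologicalSpace M] [ChartedSpace E4 M] [IsManifold (𝓡 4) ∞ M]
    (g : LorentzMetric M) (s l α n : VField M)
    (hl : IsNullGeodesic g l univ)
    (htetrad : IsNullTetrad g s l α n univ)
    (hequi : Equipartition g s l α univ)
    (hunif : UniformEquipartition g s l α univ) :
    -- a rotation gives an involutive pair exactly when it solves the transport equation
    (∀ (Ω : Set M) (Θ : M → ℝ), IsOpen Ω → ContMDiffOn (𝓡 4) 𝓘(ℝ, ℝ) ∞ Θ Ω →
      (Involutive l (rotS Θ s α) Ω ↔ Transport g s l α Θ Ω)) ∧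
    -- locally, the solutions are parametrized by an arbitrary function of three variables
    (∀ p : M, ∃ (e : OpenPartialHomeomorph M E4) (Θ₀ : M → ℝ),
      IsBoxChart e ∧ p ∈ e.source ∧ (∀ x ∈ e.source, chartDiff e x (l x) = stdVec 0) ∧
      ∀ Θ : M → ℝ,
        (ContMDiffOn (𝓡 4) 𝓘(ℝ, ℝ) ∞ Θ e.source ∧ Transport g s l α Θ e.source) ↔
        ∃ h : ℝ × ℝ × ℝ → ℝ,
          ContDiffOn ℝ ∞ h ((fun x => (e x 1, e x 2, e x 3)) '' e.source) ∧
          ∀ x ∈ e.source, Θ x = Θ₀ x + h (e x 1, e x 2, e x 3)) ∧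
    -- each solution gives a null field sheet foliation, with its null force-free fields
    (∀ (Ω : Set M) (Θ : M → ℝ), IsOpen Ω → ContMDiffOn (𝓡 4) 𝓘(ℝ, ℝ) ∞ Θ Ω →
      Transport g s l α Θ Ω →
      (∃ leaves : Set (Set M),
        IsNullFieldSheetFoliation g (rotS Θ s α) l (rotα Θ s α) n Ω leaves) ∧
      ∀ e : OpenPartialHomeomorph M E4,
        IsFoliatedChart (spanDist l (rotS Θ s α)) e → e.source ⊆ Ω →
        -- each function `u` of two variables gives a null force-free field,
        -- and its field sheets are the leaves wherever it does not vanish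
        (∀ u : ℝ × ℝ → ℝ, ContDiffOn ℝ ∞ u ((fun x => (e x 2, e x 3)) '' e.source) →
          IsNullForceFree g (sheetField g (rotα Θ s α) l e u) e.source ∧
          ∀ x ∈ e.source, u (e x 2, e x 3) ≠ 0 → ∀ v : TangentSpace (𝓡 4) x,
            ((∀ w, sheetField g (rotα Θ s α) l e u x ![v, w] = 0) ↔
              v ∈ spanDist l (rotS Θ s α) x)) ∧
        -- and there are no others
        (∀ F : DForm M 2, IsNullForceFree g F e.source →
          (∀ x ∈ e.source, ∀ v ∈ spanDist l (rotS Θ s α) x, ∀ w, F x ![v, w] = 0) →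
          ∃ u : ℝ × ℝ → ℝ, ContDiffOn ℝ ∞ u ((fun x => (e x 2, e x 3)) '' e.source) ∧
            ∀ x ∈ e.source, F x = sheetField g (rotα Θ s α) l e u x)) := by
  have hC := conformalBrackets htetrad hl hequi hunif
  refine ⟨fun Ω Θ hΩ hΘ => involutive_iff_transport hC htetrad hΩ hΘ,
    exists_transport_chart htetrad, fun Ω Θ hΩ hΘ htr => ?_⟩
  have hT := htetrad.rotate hΩ hΘ
  have hinv := (involutive_iff_transport hC htetrad hΩ hΘ).2 htr
  have hCΘ : ∀ x ∈ Ω, ConformalBrackets g (rotS Θ s α) l (rotα Θ s α) x := fun x hx =>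
    ((hC x).rotate htetrad (hΘ.contMDiffAt (hΩ.mem_nhds hx))).1
  refine ⟨?_, fun e he hes => ⟨fun u hu => ⟨isNullForceFree_sheetField hΩ hT hCΘ he hes hu,
    fun x hx hux => sheetField_kernel hT he hes u hx hux⟩,
    fun F hF hker => exists_eq_sheetField hT he hes hF hker⟩⟩
  obtain ⟨leaves, hleaves⟩ := exists_isFoliation
    fun x hx => exists_foliatedChart hΩ hT hinv (p := x) hx
  exact ⟨leaves,
    { foliation := hleaves
      tetrad := hT
      geodesic :=
        { smooth := hl.smooth.mono (subset_univ _)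
          ne_zero := fun x _ => hl.ne_zero x (mem_univ x)
          null := fun x _ => hl.null x (mem_univ x)
          geodesic := fun x _ => hl.geodesic x (mem_univ x) }
      equipartition := equipartition_rotate hC htetrad hΩ hΘ }⟩
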